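/- **Setting.** Let $q\ge 1$, $\mathcal S_q=\{\mathbf s=(s_1,\dots,s_q): s_j>0,\ s_\cdot:=\sum_{j=1}^q s_j<1\}$, let $\Omega$ be a standard Borel space (e.g. a Polish space), $B_0$ a nonatomic probability measure on $\Omega$, and $\rho_q(d\mathbf s\,|\,\omega)$ an s-finite kernel from $\Omega$ to $\mathbb R^q$, concentrated on $\mathcal S_q$, with $\int_\Omega\int s_\cdot\,\rho_q(d\mathbf s|\omega)B_0(d\omega)<\infty$. Let $N=\sum_k\delta_{(\mathbf p_k,\tilde\omega_k)}$ be a Poisson random measure with mean intensity $\rho_q(d\mathbf s|\omega)B_0(d\omega)$ (written $\mathrm{PRM}(\rho_qB_0)$), with finitely or infinitely many points, and let $\mu_0=(\mu_1,\dots,\mu_q)$, $\mu_j=\sum_k p_{j,k}\delta_{\tilde\omega_k}$, be the corresponding multivariate completely random measure. For $\mathbf s$ with $s_j\ge 0$, $s_\cdot\le1$, let $\mathsf M(1,\mathbf s)$ be the distribution on vectors $a\in\{0,1\}^q$ with $a_\cdot=\sum_ja_j\le 1$ and probability mass function $\big[\prod_j s_j^{a_j}\big](1-s_\cdot)^{1-a_\cdot}$.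 Given the points $(\mathbf p_k,\tilde\omega_k)_k$, let $b^{(i)}_{0,k}=(b^{(i)}_{1,k},\dots,b^{(i)}_{q,k})$ be independent over $(i,k)$ with distribution $\mathsf M(1,\mathbf p_k)$, and let $Z^{(i)}_0=(Z^{(i)}_1,\dots,Z^{(i)}_q)$, $Z^{(i)}_j=\sum_k b^{(i)}_{j,k}\delta_{\tilde\omega_k}$; that is, $Z_0^{(1)},Z_0^{(2)},\dots\,|\,\mu_0$ are iid $\mathrm{IBP}(\mathsf M(1,\mathbf p_q)|\mu_0)$, and the law of $Z^{(1)}_0$ is called $\mathrm{IBP}(\mathsf M(1,\mathbf p_q),\rho_qB_0)$. Let $M\ge0$. Write $\rho_{q,M}(d\mathbf s|\omega)=(1-s_\cdot)^M\rho_q(d\mathbf s|\omega)$. Let $\omega_1,\dots,\omega_K$ be the distinct features chosen by the customers $1,\dots,M$ (the $\omega$ with $Z^{(i)}_j(\{\omega\})\ne0$ for some $i\le M$ and $j$), $c_{j,\ell,M}=\sum_{i=1}^M Z_j^{(i)}(\{\omega_\ell\})$, $c_{\ell,M}=\sum_jc_{j,\ell,M}$, $\mathbf c_{\ell,M}=(c_{1,\ell,M},\dots,c_{q,\ell,M})$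 and $$\kappa_{\mathbf c_{\ell,M}}(\rho_{q,M}|\omega_\ell)=\int_{\mathcal S_q}\Big[\prod_{j=1}^q s_j^{c_{j,\ell,M}}\Big](1-s_\cdot)^{M-c_{\ell,M}}\rho_q(d\mathbf s|\omega_\ell).$$ **Proposition.** Almost surely $K<\infty$ and $0<\kappa_{\mathbf c_{\ell,M}}(\rho_{q,M}|\omega_\ell)<\infty$ for $\ell=1,\dots,K$, and: 1. The conditional distribution of $N$ given $Z_0^{(1)},\dots,Z_0^{(M)}$ is the distribution of $N_M+\sum_{\ell=1}^K\delta_{(\mathbf J_{q,\ell},\omega_\ell)}$, where $N_M$ is $\mathrm{PRM}(\rho_{q,M}B_0)$ and, independent of $N_M$, the vectors $\mathbf J_{q,\ell}=(J_{1,\ell},\dots,J_{q,\ell})$ are independent with $$\mathbb P(\mathbf J_{q,\ell}\in d\mathbf s)=\frac{\big[\prod_{j=1}^q s_j^{c_{j,\ell,M}}\big](1-s_\cdot)^{M-c_{\ell,M}}\rho_q(d\mathbf s|\omega_\ell)}{\kappa_{\mathbf c_{\ell,M}}(\rho_{q,M}|\omega_\ell)}.$$ 2. The conditional distribution of $(N,Z_0^{(M+1)})$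 given $Z_0^{(1)},\dots,Z_0^{(M)}$ is the distribution of $\big(N_M+\sum_{\ell}\delta_{(\mathbf J_{q,\ell},\omega_\ell)},\ \tilde Z^{(M+1)}_0+\sum_{\ell=1}^K b_0^{(\ell)}\delta_{\omega_\ell}\big)$, where $N_M$ and $\mathbf J_{q,\ell}$ are as in 1, $\tilde Z_0^{(M+1)}|N_M$ is a multinomial IBP process driven by $N_M$, so that $\tilde Z_0^{(M+1)}$ has law $\mathrm{IBP}(\mathsf M(1,\mathbf p_q),\rho_{q,M}B_0)$, $b_0^{(\ell)}=(b^{(\ell)}_1,\dots,b^{(\ell)}_q)$ given $\mathbf J_{q,\ell}=\mathbf s$ has distribution $\mathsf M(1,\mathbf s)$, and the pairs $(N_M,\tilde Z_0^{(M+1)}),(\mathbf J_{q,1},b_0^{(1)}),\dots,(\mathbf J_{q,K},b_0^{(K)})$ are independent. In particular, the $j$-th component of $Z_0^{(M+1)}$ given $Z_0^{(1)},\dots,Z_0^{(M)}$ is distributed as $\tilde Z_j^{(M+1)}+\sum_{\ell}b_j^{(\ell)}\delta_{\omega_\ell}$. 3. For each $\ell$, $b_0^{(\ell)}$ is marginally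 $\mathsf M(1,\mathbf r_{q,\ell})$, where $\mathbf r_{q,\ell}=(r_{1,\ell},\dots,r_{q,\ell})\in\mathcal S_q$, $$r_{k,\ell}=\mathbb E[J_{k,\ell}|\mathbf c_{\ell,M}]=\frac{\int_{\mathcal S_q}s_k\big[\prod_{j=1}^q s_j^{c_{j,\ell,M}}\big](1-s_\cdot)^{M-c_{\ell,M}}\rho_q(d\mathbf s|\omega_\ell)}{\kappa_{\mathbf c_{\ell,M}}(\rho_{q,M}|\omega_\ell)},\qquad k=1,\dots,q.$$ 4. Hence $b^{(\ell)}_\cdot=\sum_{j=1}^qb^{(\ell)}_j$ is Bernoulli$\big(\sum_{j=1}^qr_{j,\ell}\big)$, and given $b^{(\ell)}_\cdot=1$ the vector $b_0^{(\ell)}$ has the probability mass function $a\mapsto\mathbb I_{\{a_\cdot=1\}}\prod_{j=1}^q u_{j,\ell}^{a_j}$ on $\mathbb Z_{\ge0}^q$, where $u_{j,\ell}=r_{j,\ell}/\sum_{k=1}^qr_{k,\ell}$. -/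

import Mathlib

open MeasureTheory ProbabilityTheory
open scoped ENNReal

universe u v

noncomputable section

namespace MultinomialIBP

/-- The constraint set `S_q = {s : s_j > 0 for all j, s_1 + ... + s_q < 1}`. -/
def simplex (q : ℕ) : Set (Fin q → ℝ) := {s | (∀ j, 0 < s j) ∧ ∑ j, s j < 1}

/-- The probability mass function of `M(1, s)` on vectors `a ∈ ℕ^q`: it is
`(∏ j, s_j ^ a_j) * (1 - s_·) ^ (1 - a_·)` if at most one entry of `a` is one and the others
are zero, and `0` for the other vectors. -/
def multinomialPMF {q : ℕ} (s : Fin q → ℝ) (a : Fin q → ℕ) : ℝ :=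
  if ∑ j, a j ≤ 1 then (∏ j, s j ^ a j) * (1 - ∑ j, s j) ^ (1 - ∑ j, a j) else 0

lemma measurable_multinomialPMF {q : ℕ} (a : Fin q → ℕ) :
    Measurable fun s : Fin q → ℝ => multinomialPMF s a := by
  unfold multinomialPMF
  split_ifs <;> fun_prop

/-- The kernel `s ↦ M(1, s)`: the measure on `ℕ^q` with point masses `multinomialPMF s`
(a probability measure when `s ∈ S_q`). -/
def multinomial (q : ℕ) : Kernel (Fin q → ℝ) (Fin q → ℕ) where
  toFun s := Measure.sum fun a : Fin q → ℕ =>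
    ENNReal.ofReal (multinomialPMF s a) • Measure.dirac a
  measurable' := by
    refine Measure.measurable_of_measurable_coe _ fun A hA => ?_
    simp only [Measure.sum_apply _ hA, Measure.smul_apply, smul_eq_mul]
    exact Measurable.tsum fun a =>
      ((measurable_multinomialPMF a).ennreal_ofReal).mul_const _

lemma multinomial_singleton {q : ℕ} (s : Fin q → ℝ) (a : Fin q → ℕ) :
    multinomial q s {a} = ENNReal.ofReal (multinomialPMF s a) := by
  change (Measure.sum fun a : Fin q → ℕ =>
    ENNReal.ofReal (multinomialPMF s a) • Measure.dirac a) {a} = _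
  exact Measure.sum_smul_dirac_singleton

instance (q : ℕ) : IsSFiniteKernel (multinomial q) := by
  have h : multinomial q = Kernel.sum fun a : Fin q → ℕ =>
      Kernel.withDensity (Kernel.const (Fin q → ℝ) (Measure.dirac a))
        (fun s _ => ENNReal.ofReal (multinomialPMF s a)) := by
    ext1 s
    rw [Kernel.sum_apply]
    change Measure.sum _ = _
    congr 1
    funext a
    have hm : Measurable (Function.uncurry fun (s : Fin q → ℝ) (_ : Fin q → ℕ) =>
        ENNReal.ofReal (multinomialPMF s a)) :=
      ((measurable_multinomialPMF a).comp measurable_fst).ennreal_ofReal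
    rw [Kernel.withDensity_apply _ hm, Kernel.const_apply, withDensity_const]
  rw [h]
  have : ∀ a : Fin q → ℕ, IsSFiniteKernel
      (Kernel.withDensity (Kernel.const (Fin q → ℝ) (Measure.dirac a))
        (fun s _ => ENNReal.ofReal (multinomialPMF s a))) :=
    fun a => Kernel.IsSFiniteKernel.withDensity _ fun _ _ => ENNReal.ofReal_ne_top
  infer_instance

/-- `N` is a Poisson random measure with mean intensity `ν`, `PRM(ν)`, under `P`: the mass of a
measurable set `A` is Poisson with mean `ν A` (a.s. infinite if `ν A = ∞`), and the masses of
disjoint measurable sets are independent. -/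
structure IsPRM {𝒲 E : Type*} [MeasurableSpace 𝒲] [MeasurableSpace E]
    (P : Measure 𝒲) (ν : Measure E) (N : 𝒲 → Measure E) : Prop where
  measurable : Measurable N
  law : ∀ A, MeasurableSet A → ν A ≠ ∞ →
    HasLaw (fun w => N w A) ((poissonMeasure (ν A).toNNReal).map (fun k : ℕ => (k : ℝ≥0∞))) P
  law_top : ∀ A, MeasurableSet A → ν A = ∞ → ∀ᵐ w ∂P, N w A = ∞
  indep : ∀ (m : ℕ) (A : Fin m → Set E), (∀ i, MeasurableSet (A i)) →
    Pairwise (Function.onFun Disjoint A) → iIndepFun (fun i w => N w (A i)) P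

/-- The random measure `N = ∑ₖ δ_(pₖ, θₖ)` with jump vectors `pₖ ∈ ℝ^q` and feature labels `θₖ`.
By convention `pₖ = 0` means that there is no `k`-th point (zero is never a jump), so that `N` may
also have finitely many points. -/
def pointProcess {q : ℕ} {Ω 𝒲 : Type*} [MeasurableSpace Ω]
    (p : ℕ → 𝒲 → Fin q → ℝ) (θ : ℕ → 𝒲 → Ω) (w : 𝒲) : Measure ((Fin q → ℝ) × Ω) :=
  open scoped Classical in
  Measure.sum fun k => if p k w = 0 then 0 else Measure.dirac (p k w, θ k w)

/-- The vector valued feature process `Z_0 = (Z_1, …, Z_q)`, `Z_j = ∑ₖ b_{j,k} δ_{θₖ}`. -/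
def featureProcess {q : ℕ} {Ω 𝒲 : Type*} [MeasurableSpace Ω]
    (b : ℕ → 𝒲 → Fin q → ℕ) (θ : ℕ → 𝒲 → Ω) (w : 𝒲) : Fin q → Measure Ω :=
  fun j => Measure.sum fun k => (b k w j : ℝ≥0∞) • Measure.dirac (θ k w)

/-- The multinomial IBP model with `n` customers. The points `(pₖ, θₖ)` are those of a Poisson
random measure `N` with mean intensity `ν` (equivalently, of a multivariate CRM
`μ_j = ∑ₖ p_{j,k} δ_{θₖ}`, `j = 1, …, q`) and, given these points, the vectors `b i k`
(customer `i`, feature `k`) are independent with distribution `M(1, pₖ)`. So the processes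
`featureProcess (b i) θ`, `i = 1, …, n`, are conditionally iid `IBP(M(1, p_q) | μ_0)`. -/
structure IsIBPModel {q n : ℕ} {Ω 𝒲 : Type*} [MeasurableSpace Ω] [MeasurableSpace 𝒲]
    (P : Measure 𝒲) (ν : Measure ((Fin q → ℝ) × Ω))
    (p : ℕ → 𝒲 → Fin q → ℝ) (θ : ℕ → 𝒲 → Ω) (b : Fin n → ℕ → 𝒲 → Fin q → ℕ) : Prop where
  measurable_p : ∀ k, Measurable (p k)
  measurable_θ : ∀ k, Measurable (θ k)
  measurable_b : ∀ i k, Measurable (b i k)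
  p_mem : ∀ᵐ w ∂P, ∀ k, p k w ∈ simplex q ∨ p k w = 0
  prm : IsPRM P ν (pointProcess p θ)
  cond_b : ∀ (F : Finset (Fin n × ℕ)) (a : Fin n × ℕ → Fin q → ℕ),
    P⟦{w | ∀ x ∈ F, b x.1 x.2 w = a x} |
        MeasurableSpace.comap (fun w (k : ℕ) => (p k w, θ k w)) inferInstance⟧
      =ᵐ[P] fun w => ∏ x ∈ F, multinomialPMF (p x.2 w) (a x)

/-- `L` is the joint law of a pair `(N, Z_0)`, where `N` is `PRM(ν)` and, given `N`, `Z_0` is an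
`IBP(M(1, p_q) | N)` process; the second marginal of `L` is the law `IBP(M(1, p_q), ν)`. -/
def IsIBPPairLaw {q : ℕ} {Ω : Type u} [MeasurableSpace Ω] (ν : Measure ((Fin q → ℝ) × Ω))
    (L : Measure (Measure ((Fin q → ℝ) × Ω) × (Fin q → Measure Ω))) : Prop :=
  ∃ (𝒱 : Type u) (_ : MeasurableSpace 𝒱) (Q : Measure 𝒱) (_ : IsProbabilityMeasure Q)
    (p : ℕ → 𝒱 → Fin q → ℝ) (θ : ℕ → 𝒱 → Ω) (b : ℕ → 𝒱 → Fin q → ℕ),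
    IsIBPModel Q ν p θ (fun _ : Fin 1 => b) ∧
    L = Q.map fun x => (pointProcess p θ x, featureProcess b θ x)

/-- The mean intensity `ν(ds, dω) = ρ_q(ds | ω) B_0(dω)`. -/
def intensity {q : ℕ} {Ω : Type*} [MeasurableSpace Ω] (ρ : Kernel Ω (Fin q → ℝ))
    (B₀ : Measure Ω) : Measure ((Fin q → ℝ) × Ω) :=
  (B₀ ⊗ₘ ρ).map Prod.swap

/-- The mean intensity `(1 - s_·)^M ρ_q(ds | ω) B_0(dω)`. -/
def updatedIntensity {q : ℕ} {Ω : Type*} [MeasurableSpace Ω] (ρ : Kernel Ω (Fin q → ℝ))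
    (B₀ : Measure Ω) (M : ℕ) : Measure ((Fin q → ℝ) × Ω) :=
  (intensity ρ B₀).withDensity fun e => ENNReal.ofReal ((1 - ∑ j, e.1 j) ^ M)

/-- The weight `(∏ j, s_j ^ c_j) (1 - s_·) ^ (M - c_·)`, with an integer exponent `M - c_·`. -/
def jumpWeight {q : ℕ} (M : ℕ) (c : Fin q → ℕ) (s : Fin q → ℝ) : ℝ :=
  (∏ j, s j ^ c j) * (1 - ∑ j, s j) ^ ((M : ℤ) - ∑ j, (c j : ℤ))

/-- The normalizing constant `κ_c(ρ_{q,M} | ω)`. -/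
def kappa {q : ℕ} {Ω : Type*} [MeasurableSpace Ω] (ρ : Kernel Ω (Fin q → ℝ))
    (M : ℕ) (c : Fin q → ℕ) (ω : Ω) : ℝ≥0∞ :=
  ∫⁻ s in simplex q, ENNReal.ofReal (jumpWeight M c s) ∂ρ ω

/-- The law of a jump vector of the posterior: its density with respect to `ρ_q(ds | ω)` is
`jumpWeight M c s / κ_c(ρ_{q,M} | ω)`. -/
def jumpLaw {q : ℕ} {Ω : Type*} [MeasurableSpace Ω] (ρ : Kernel Ω (Fin q → ℝ))
    (M : ℕ) (c : Fin q → ℕ) (ω : Ω) : Measure (Fin q → ℝ) :=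
  (ρ ω).withDensity fun s => ENNReal.ofReal (jumpWeight M c s) / kappa ρ M c ω

/-- Given the processes `z i = (z i 1, …, z i q)` of `M` customers, `ω 1, …, ω K` lists the
distinct features chosen by at least one customer, each exactly once, and `c ℓ j` is the number
`c_{j,ℓ,M} = ∑ᵢ b^{(i)}_{j,ℓ}`, where `b^{(i)}_{j,ℓ}` is the mass of `z i j` at `ω ℓ`. -/
structure IsDishList {q M K : ℕ} {Ω : Type*} [MeasurableSpace Ω]
    (z : Fin M → Fin q → Measure Ω) (ω : Fin K → Ω) (c : Fin K → Fin q → ℕ) : Prop where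
  injective : Function.Injective ω
  range_eq : Set.range ω = {x | ∃ i j, z i j {x} ≠ 0}
  count : ∀ ℓ j, ∑ i, z i j {ω ℓ} = (c ℓ j : ℝ≥0∞)

end MultinomialIBP

end

/-! Attach to each Poisson point `(p k, θ k)` the array of the choices of the first `M` customers.
The points with their arrays form a Poisson process whose intensity at `((s, ω), a)` is the base
intensity times the probability `markWeight s a` of the array (`IsIBPModel.laplace`,
`IsIBPModel.isMarkedPoisson`). Points with array zero are the unchosen ones. They form a Poisson
process independent of the chosen ones, with the base intensity thinned by `(1 - s_·)^M`. Given the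
labels and arrays of the chosen points, their jump vectors are independent. The law of each is the
disintegration of `markWeight s a · ρ(ds | ω)`, and by `markWeight_eq_jumpWeight` this weight
depends on `a` only through the counts `c_j`. This is the posterior law `jumpLaw`.

Three facts turn this into a statement about the observed processes `Z`. The expected number of
chosen points is at most `M ∫ s_· dν`, so it is finite. No two points share a label, because `B₀`
has no atoms (`IsPRM.measure_fiber_lt_two`); hence the atoms of `Z` and their masses recover the
labels and arrays of the chosen points. Finally, `κ_c` is positive and finite at almost every chosen
label. Finiteness follows from the same moment bound, and `κ_c = 0` would force `ρ ω = 0`, so that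
no point could have that label.

A conditional distribution must be a kernel on all patterns `Z`, whereas a list of the chosen
features is not canonical. `exists_posteriorKernel` embeds `Ω` in the line and measurably strips off
the atoms from left to right. `IsMarkedPoisson.exists_posterior` then compares the joint Laplace
functional of `(Z, N)` with that of the proposed posterior. Both are exponentials of integrals
against the marked intensity. They agree on mark zero by thinning, and elsewhere because averaging
`exp (-f)` over the jump law does not change the integral. Laplace functionals determine laws, by
Stone–Weierstrass on cubes.

The prediction rule is the same abstract theorem with the jump vector replaced by the pair (jump
vector, choice of customer `M + 1`). What remains is to recognise the unchosen points with the new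
choices as a multinomial IBP driven by the thinned process (`isIBPPairLaw_of_hasProductMarks`). The
marginal laws of `b^(ℓ)` follow because the point masses of `M(1, s)` are affine in `s`, so mixing
over `s` only replaces `s` by its mean. -/

noncomputable section

namespace MultinomialIBP

/-! ### Multiplicative classes of functions determine finite measures -/

section MultiplicativeClass

open BoundedContinuousFunction Filter Topology

/-- The `i`-th coordinate on a cube, as a bounded continuous function. -/
def cubeCoord {ι : Type*} (i : ι) : (ι → unitInterval) →ᵇ ℝ :=
  BoundedContinuousFunction.mkOfCompact ⟨fun x => (x i : ℝ), by fun_prop⟩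

/-- The polynomial functions on a cube, as a star subalgebra. -/
def cubePolynomials (ι : Type*) : StarSubalgebra ℝ ((ι → unitInterval) →ᵇ ℝ) where
  toSubalgebra := Algebra.adjoin ℝ (Set.range cubeCoord)
  star_mem' {a} ha := by
    have : star a = a := by ext x; simp
    exact this ▸ ha

/-- Stone–Weierstrass: coordinates separate the points of the cube, so polynomials determine finite
measures. Polynomials are the linear span of monomials, so monomials suffice. -/
lemma cube_measure_ext {ι : Type*} [Finite ι] {μ ν : Measure (ι → unitInterval)}
    [IsFiniteMeasure μ] [IsFiniteMeasure ν]
    (h : ∀ g ∈ Submonoid.closure (Set.range (cubeCoord (ι := ι))), ∫ x, g x ∂μ = ∫ x, g x ∂ν) :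
    μ = ν := by
  have := Fintype.ofFinite ι
  refine ext_of_forall_mem_subalgebra_integral_eq_of_polish (𝕜 := ℝ) (A := cubePolynomials ι)
    ?_ ?_
  · intro x y hxy
    obtain ⟨i, hi⟩ := Function.ne_iff.mp hxy
    refine ⟨fun z => (z i : ℝ), ⟨toContinuousMapStarₐ ℝ (cubeCoord i), ⟨cubeCoord i, ?_, rfl⟩, rfl⟩,
      fun he => hi (Subtype.ext he)⟩
    exact Algebra.subset_adjoin ⟨i, rfl⟩
  · intro g hg
    have hg' : g ∈ Submodule.span ℝ
        (Submonoid.closure (Set.range (cubeCoord (ι := ι))) : Set ((ι → unitInterval) →ᵇ ℝ)) := by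
      rw [← Algebra.adjoin_eq_span]; exact hg
    induction hg' using Submodule.span_induction with
    | mem x hx => exact h x hx
    | zero => simp
    | add x y _ _ hx hy =>
      simp only [BoundedContinuousFunction.coe_add, Pi.add_apply]
      rw [integral_add (x.integrable μ) (y.integrable μ),
        integral_add (x.integrable ν) (y.integrable ν)]
      have mem : ∀ z, z ∈ Submodule.span ℝ
        (Submonoid.closure (Set.range (cubeCoord (ι := ι))) : Set ((ι → unitInterval) →ᵇ ℝ)) →
          z ∈ cubePolynomials ι := by
        intro z hz
        rw [← Algebra.adjoin_eq_span] at hz; exact hz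
      rw [hx (mem _ ‹_›), hy (mem _ ‹_›)]
    | smul c x hmem hx =>
      have : x ∈ cubePolynomials ι := by
        rw [← Algebra.adjoin_eq_span] at hmem; exact hmem
      simp only [BoundedContinuousFunction.coe_smul, integral_smul]
      rw [hx this]

/-- Two finite measures agree if they give the same integrals to a multiplicative class of
`[0, 1]`-valued functions that generates the σ-algebra. -/
theorem measure_ext_of_multiplicative {X : Type*} [mX : MeasurableSpace X] {μ ν : Measure X}
    [IsFiniteMeasure μ] [IsFiniteMeasure ν] (C : Submonoid (X → ℝ≥0∞))
    (hmeas : ∀ g ∈ C, Measurable g) (hle : ∀ g ∈ C, g ≤ 1)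
    (hgen : mX ≤ ⨆ g : C, MeasurableSpace.comap (g : X → ℝ≥0∞) inferInstance)
    (h : ∀ g ∈ C, ∫⁻ x, g x ∂μ = ∫⁻ x, g x ∂ν) : μ = ν := by
  have hone : ∀ g ∈ C, ∀ x, g x ≤ 1 := fun g hg x => hle g hg x
  -- Evaluating all members of `C` at once maps `X` into a cube. By `hgen` the σ-algebra of `X` is
  -- pulled back from the product σ-algebra, so it is enough to compare the image measures, and for
  -- these the finite-dimensional marginals.
  let Φ : X → (C → unitInterval) := fun x g =>
    ⟨((g : X → ℝ≥0∞) x).toReal, ENNReal.toReal_nonneg,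
      ENNReal.toReal_le_of_le_ofReal zero_le_one (by simpa using hone g g.2 x)⟩
  have hΦ : Measurable Φ := by
    refine measurable_pi_iff.mpr fun g => ?_
    exact ((hmeas g g.2).ennreal_toReal).subtype_mk
  have hcomap : mX = MeasurableSpace.comap Φ inferInstance := by
    refine le_antisymm (hgen.trans (iSup_le fun g => ?_)) hΦ.comap_le
    have : (g : X → ℝ≥0∞) = (fun y : C → unitInterval => ENNReal.ofReal (y g)) ∘ Φ := by
      funext x
      simp only [Function.comp, Φ]
      rw [ENNReal.ofReal_toReal (ne_top_of_le_ne_top ENNReal.one_ne_top (hone g g.2 x))]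
    rw [this, ← MeasurableSpace.comap_comp]
    exact MeasurableSpace.comap_mono (Measurable.comap_le (by fun_prop))
  have key : μ.map Φ = ν.map Φ := by
    refine ext_of_generate_finite _ (generateFrom_squareCylinders).symm
      (isPiSystem_squareCylinders (fun _ => MeasurableSpace.isPiSystem_measurableSet)
        fun _ => by simp) ?_ ?_
    · rintro _ ⟨s, t, ht, rfl⟩
      have hfin : μ.map (fun x (i : s) => Φ x i) = ν.map (fun x (i : s) => Φ x i) := by
        have hm : Measurable (fun x (i : s) => Φ x i) := by fun_prop
        refine cube_measure_ext fun g hg => ?_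
        rw [integral_map hm.aemeasurable g.continuous.aestronglyMeasurable,
          integral_map hm.aemeasurable g.continuous.aestronglyMeasurable]
        -- Multiplicativity enters here: a monomial in finitely many coordinates, pulled back to
        -- `X`, is again a member of `C`.
        have : ∃ c ∈ C, ∀ x, g (fun i : s => Φ x i) = (c x).toReal := by
          induction hg using Submonoid.closure_induction with
          | mem g hg =>
            obtain ⟨i, rfl⟩ := hg
            exact ⟨i, i.1.2, fun x => rfl⟩
          | one => exact ⟨1, C.one_mem, fun x => by simp⟩
          | mul g g' _ _ h1 h2 =>
            obtain ⟨c, hc, hc'⟩ := h1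
            obtain ⟨d, hd, hd'⟩ := h2
            exact ⟨c * d, C.mul_mem hc hd, fun x => by simp [hc', hd']⟩
        obtain ⟨c, hc, hcx⟩ := this
        simp only [hcx]
        rw [integral_toReal (hmeas c hc).aemeasurable
            (ae_of_all _ fun x => (hone c hc x).trans_lt ENNReal.one_lt_top),
          integral_toReal (hmeas c hc).aemeasurable
            (ae_of_all _ fun x => (hone c hc x).trans_lt ENNReal.one_lt_top), h c hc]
      have hset : (fun x (i : s) => Φ x i) ⁻¹' (Set.univ.pi fun i : s => t i) =
          Φ ⁻¹' ((s : Set C).pi t) := by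
        ext x; simp [Set.mem_pi]
      have hm : Measurable (fun x (i : s) => Φ x i) := by fun_prop
      have hts : ∀ i, MeasurableSet (t i) := fun i => ht i (Set.mem_univ i)
      have hpi : MeasurableSet (Set.univ.pi fun i : s => t i) :=
        MeasurableSet.univ_pi fun i => hts i
      rw [Measure.map_apply hΦ (MeasurableSet.pi (Finset.countable_toSet s) fun i _ => hts i),
        Measure.map_apply hΦ (MeasurableSet.pi (Finset.countable_toSet s) fun i _ => hts i),
        ← hset, ← Measure.map_apply hm hpi, hfin, Measure.map_apply hm hpi]
    · rw [Measure.map_apply hΦ .univ, Measure.map_apply hΦ .univ]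
      simpa using h 1 C.one_mem
  ext A hA
  rw [hcomap] at hA
  obtain ⟨B, hB, rfl⟩ := hA
  rw [← Measure.map_apply hΦ hB, key, Measure.map_apply hΦ hB]

end MultiplicativeClass

/-! ### The functions `x ↦ exp (-x)` and `x ↦ -log x` on `[0, ∞]` -/

/-- `exp (-x)` for `x ∈ [0, ∞]`. -/
def expNeg (x : ℝ≥0∞) : ℝ≥0∞ := EReal.exp (-(x : EReal))

/-- `-log x` for `x ∈ [0, 1]`. -/
def negLog (x : ℝ≥0∞) : ℝ≥0∞ := (-(ENNReal.log x)).toENNReal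

lemma continuous_expNeg : Continuous expNeg :=
  ENNReal.continuous_exp.comp (continuous_neg.comp continuous_coe_ennreal_ereal)

@[fun_prop]
lemma measurable_expNeg : Measurable expNeg := continuous_expNeg.measurable

@[fun_prop]
lemma measurable_negLog : Measurable negLog := by
  unfold negLog; fun_prop

@[simp] lemma expNeg_zero : expNeg 0 = 1 := by simp [expNeg]

@[simp] lemma expNeg_top : expNeg ∞ = 0 := by simp [expNeg]

lemma expNeg_ofReal {x : ℝ} (hx : 0 ≤ x) :
    expNeg (ENNReal.ofReal x) = ENNReal.ofReal (Real.exp (-x)) := by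
  rw [expNeg, EReal.coe_ennreal_ofReal, max_eq_left hx, ← EReal.coe_neg, EReal.exp_coe]

lemma expNeg_add (x y : ℝ≥0∞) : expNeg (x + y) = expNeg x * expNeg y := by
  rw [expNeg, expNeg, expNeg, ← EReal.exp_add, EReal.coe_ennreal_add, EReal.neg_add, sub_eq_add_neg]
  · left; simp
  · right; simp

lemma expNeg_antitone : Antitone expNeg := fun x y h =>
  EReal.exp_monotone (EReal.neg_le_neg_iff.mpr (by simpa using h))

lemma expNeg_le_one (x : ℝ≥0∞) : expNeg x ≤ 1 := by
  simpa using expNeg_antitone (zero_le (a := x))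

lemma expNeg_ne_top (x : ℝ≥0∞) : expNeg x ≠ ∞ :=
  ne_top_of_le_ne_top ENNReal.one_ne_top (expNeg_le_one x)

lemma expNeg_eq_zero {x : ℝ≥0∞} : expNeg x = 0 ↔ x = ∞ := by
  simp [expNeg, EReal.neg_eq_bot_iff]

lemma expNeg_injective : Function.Injective expNeg := fun x y h => by
  have := EReal.exp_strictMono.injective h
  simpa using this

lemma expNeg_negLog {x : ℝ≥0∞} (hx : x ≤ 1) : expNeg (negLog x) = x := by
  have : (0 : EReal) ≤ -(ENNReal.log x) := by
    rw [EReal.le_neg]; simpa using hx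
  rw [expNeg, negLog, EReal.coe_toENNReal this, neg_neg, ENNReal.exp_log]

@[simp] lemma negLog_one : negLog 1 = 0 := by simp [negLog]

lemma expNeg_sum {ι : Type*} (s : Finset ι) (f : ι → ℝ≥0∞) :
    expNeg (∑ i ∈ s, f i) = ∏ i ∈ s, expNeg (f i) := by
  classical
  induction s using Finset.induction with
  | empty => simp
  | insert a s ha ih => rw [Finset.sum_insert ha, Finset.prod_insert ha, expNeg_add, ih]

lemma expNeg_nsmul (n : ℕ) (x : ℝ≥0∞) : expNeg (n * x) = expNeg x ^ n := by
  have := expNeg_sum (Finset.range n) fun _ => x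
  simpa using this

lemma measurableEmbedding_expNeg : MeasurableEmbedding expNeg :=
  continuous_expNeg.measurableEmbedding expNeg_injective

/-- `expNeg` is a measurable embedding, so composing with it loses no information about `f`. -/
lemma comap_expNeg_comp {X : Type*} (f : X → ℝ≥0∞) :
    MeasurableSpace.comap (fun x => expNeg (f x)) inferInstance =
      MeasurableSpace.comap f inferInstance := by
  conv_rhs => rw [← measurableEmbedding_expNeg.comap_eq, MeasurableSpace.comap_comp]
  rfl

/-! ### Laplace functionals determine laws -/

/-- `expNeg` turns an additive family into a multiplicative class of `[0, 1]`-valued functions that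
generates the same σ-algebra. Working in `[0, ∞]` removes all integrability conditions from the test
functions. -/
lemma measure_ext_of_expNeg {X ι : Type*} [mX : MeasurableSpace X] {μ ν : Measure X}
    [IsFiniteMeasure μ] [IsFiniteMeasure ν] (φ : ι → X → ℝ≥0∞) (hφ : ∀ i, Measurable (φ i))
    (hzero : ∃ i, φ i = 0) (hadd : ∀ i j, ∃ k, φ k = φ i + φ j)
    (hgen : mX ≤ ⨆ i, MeasurableSpace.comap (φ i) inferInstance)
    (h : ∀ i, ∫⁻ x, expNeg (φ i x) ∂μ = ∫⁻ x, expNeg (φ i x) ∂ν) : μ = ν := by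
  let C : Submonoid (X → ℝ≥0∞) :=
    { carrier := Set.range fun i x => expNeg (φ i x)
      one_mem' := by
        obtain ⟨i, hi⟩ := hzero
        exact ⟨i, by funext x; simp [hi]⟩
      mul_mem' := by
        rintro _ _ ⟨i, rfl⟩ ⟨j, rfl⟩
        obtain ⟨k, hk⟩ := hadd i j
        exact ⟨k, by funext x; simp [hk, expNeg_add]⟩ }
  refine measure_ext_of_multiplicative C ?_ ?_ ?_ ?_
  · rintro _ ⟨i, rfl⟩
    exact measurable_expNeg.comp (hφ i)
  · rintro _ ⟨i, rfl⟩ x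
    exact expNeg_le_one _
  · refine hgen.trans (iSup_le fun i => ?_)
    refine le_trans (le_of_eq ?_)
      (le_iSup (fun g : C => MeasurableSpace.comap (g : X → ℝ≥0∞) inferInstance) ⟨_, ⟨i, rfl⟩⟩)
    exact (comap_expNeg_comp _).symm
  · rintro _ ⟨i, rfl⟩
    exact h i

/-- The σ-algebra on measures is generated by the evaluations at measurable sets. This supplies the
generation hypothesis of `measure_ext_of_expNeg` for random measures. -/
lemma measurableSpace_measure_le {X E ι : Type*} [MeasurableSpace E] (Y : X → Measure E)
    (φ : ι → X → ℝ≥0∞)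
    (h : ∀ A, MeasurableSet A → ∃ i, φ i = fun x => Y x A) :
    MeasurableSpace.comap Y inferInstance ≤
      ⨆ i, MeasurableSpace.comap (φ i) inferInstance := by
  rw [Measure.instMeasurableSpace, MeasurableSpace.comap_iSup]
  refine iSup_le fun A => ?_
  rw [MeasurableSpace.comap_iSup]
  refine iSup_le fun hA => ?_
  obtain ⟨i, hi⟩ := h A hA
  rw [MeasurableSpace.comap_comp]
  refine le_trans (le_of_eq ?_) (le_iSup _ i)
  rw [hi]
  rfl

/-- The law of a random measure is determined by its Laplace functional. -/
lemma randomMeasure_ext {E : Type*} [MeasurableSpace E] {μ ν : Measure (Measure E)}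
    [IsFiniteMeasure μ] [IsFiniteMeasure ν]
    (h : ∀ f : E → ℝ≥0∞, Measurable f →
      ∫⁻ m, expNeg (∫⁻ e, f e ∂m) ∂μ = ∫⁻ m, expNeg (∫⁻ e, f e ∂m) ∂ν) : μ = ν := by
  refine measure_ext_of_expNeg (ι := {f : E → ℝ≥0∞ // Measurable f})
    (fun f m => ∫⁻ e, f.1 e ∂m) (fun f => Measure.measurable_lintegral f.2)
    ⟨⟨0, measurable_zero⟩, by funext m; simp⟩
    (fun f g => ⟨⟨f.1 + g.1, f.2.add g.2⟩, by funext m; simp [lintegral_add_left f.2]⟩)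
    ?_ (fun f => h f.1 f.2)
  have := measurableSpace_measure_le (X := Measure E) id
    (fun (f : {f : E → ℝ≥0∞ // Measurable f}) m => ∫⁻ e, f.1 e ∂m)
    (fun A hA => ⟨⟨A.indicator 1, measurable_one.indicator hA⟩, by
      funext m; simp [lintegral_indicator_one hA]⟩)
  simpa using this

/-- The joint law of finitely many random measures on `Ω` and a random measure on `E` is
determined by its Laplace functional. -/
lemma joint_randomMeasure_ext {Ω E ι κ : Type*} [Fintype ι] [Fintype κ] [MeasurableSpace Ω]
    [MeasurableSpace E]
    {μ ν : Measure ((ι → κ → Measure Ω) × Measure E)} [IsFiniteMeasure μ] [IsFiniteMeasure ν]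
    (h : ∀ (g : ι → κ → Ω → ℝ≥0∞) (f : E → ℝ≥0∞), (∀ i j, Measurable (g i j)) → Measurable f →
      ∫⁻ x, expNeg (∑ i, ∑ j, ∫⁻ o, g i j o ∂x.1 i j + ∫⁻ e, f e ∂x.2) ∂μ =
        ∫⁻ x, expNeg (∑ i, ∑ j, ∫⁻ o, g i j o ∂x.1 i j + ∫⁻ e, f e ∂x.2) ∂ν) : μ = ν := by
  classical
  let I := {gf : (ι → κ → Ω → ℝ≥0∞) × (E → ℝ≥0∞) // (∀ i j, Measurable (gf.1 i j)) ∧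
    Measurable gf.2}
  let φ : I → (ι → κ → Measure Ω) × Measure E → ℝ≥0∞ := fun a x =>
    ∑ i, ∑ j, ∫⁻ o, a.1.1 i j o ∂x.1 i j + ∫⁻ e, a.1.2 e ∂x.2
  have hg : ∀ (g : Ω → ℝ≥0∞), Measurable g → ∀ i j, Measurable
      fun x : (ι → κ → Measure Ω) × Measure E => ∫⁻ o, g o ∂x.1 i j := fun g hg i j =>
    (Measure.measurable_lintegral hg).comp (by fun_prop)
  refine measure_ext_of_expNeg φ (fun a => ?_) ⟨⟨0, fun _ _ => measurable_zero, measurable_zero⟩, ?_⟩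
    (fun a b => ⟨⟨a.1 + b.1, fun i j => (a.2.1 i j).add (b.2.1 i j), a.2.2.add b.2.2⟩, ?_⟩)
    ?_ (fun a => h _ _ a.2.1 a.2.2)
  · refine Measurable.add (Finset.measurable_sum _ fun i _ => Finset.measurable_sum _ fun j _ =>
      hg _ (a.2.1 i j) i j) ?_
    exact (Measure.measurable_lintegral a.2.2).comp measurable_snd
  · funext x; simp [φ]
  · funext x
    simp only [φ, Prod.fst_add, Prod.snd_add, Pi.add_apply]
    rw [lintegral_add_left a.2.2]
    simp_rw [fun i j => lintegral_add_left (μ := x.1 i j) (a.2.1 i j) (b.1.1 i j)]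
    simp_rw [Finset.sum_add_distrib]
    ring
  · refine sup_le ?_ ?_
    · simp only [MeasurableSpace.pi, MeasurableSpace.comap_iSup, MeasurableSpace.comap_comp]
      refine iSup_le fun i => iSup_le fun j => ?_
      refine measurableSpace_measure_le
        (fun x : (ι → κ → Measure Ω) × Measure E => x.1 i j) φ fun A hA => ?_
      -- The indicator of `A` placed at the single index `(i, j)` recovers the evaluation `x.1 i j
      -- A`.
      refine ⟨⟨(fun i' j' => if i' = i then (if j' = j then A.indicator 1 else 0) else 0, 0),
        fun i' j' => ?_, measurable_zero⟩, ?_⟩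
      · dsimp only
        split_ifs
        exacts [measurable_one.indicator hA, measurable_zero, measurable_zero]
      · funext x
        simp only [φ]
        rw [Finset.sum_eq_single i, Finset.sum_eq_single j]
        · simp [lintegral_indicator_one hA]
        · intro j' _ hj; simp [hj]
        · simp
        · intro i' _ hi; simp [hi]
        · simp
    · refine measurableSpace_measure_le
        (fun x : (ι → κ → Measure Ω) × Measure E => x.2) φ fun A hA => ?_
      refine ⟨⟨(0, A.indicator 1), fun _ _ => measurable_zero, measurable_one.indicator hA⟩, ?_⟩
      funext x
      simp [φ, lintegral_indicator_one hA]

/-- The law of a vector with entries in `[0, ∞]` is determined by its Laplace transform. -/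
lemma ennreal_pi_ext {ι : Type*} [Fintype ι] {μ ν : Measure (ι → ℝ≥0∞)}
    [IsFiniteMeasure μ] [IsFiniteMeasure ν]
    (h : ∀ t : ι → ℝ≥0∞, ∫⁻ x, expNeg (∑ i, t i * x i) ∂μ = ∫⁻ x, expNeg (∑ i, t i * x i) ∂ν) :
    μ = ν := by
  classical
  refine measure_ext_of_expNeg (fun (t : ι → ℝ≥0∞) x => ∑ i, t i * x i) (fun t => by fun_prop)
    ⟨0, by funext x; simp⟩
    (fun s t => ⟨s + t, by funext x; simp [add_mul, Finset.sum_add_distrib]⟩) ?_ h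
  rw [MeasurableSpace.pi]
  refine iSup_le fun i => le_trans (le_of_eq ?_) (le_iSup _ (Pi.single i 1))
  congr
  funext x
  simp [Pi.single_apply]

lemma ennreal_ext {μ ν : Measure ℝ≥0∞} [IsFiniteMeasure μ] [IsFiniteMeasure ν]
    (h : ∀ t : ℝ≥0∞, ∫⁻ x, expNeg (t * x) ∂μ = ∫⁻ x, expNeg (t * x) ∂ν) : μ = ν := by
  refine measure_ext_of_expNeg (fun t x => t * x) (fun t => by fun_prop) ⟨0, by funext x; simp⟩
    (fun s t => ⟨s + t, by funext x; simp [add_mul]⟩) ?_ h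
  refine le_trans (le_of_eq ?_) (le_iSup _ 1)
  simp only [one_mul]
  exact MeasurableSpace.comap_id.symm

lemma lintegral_pi_prod {ι : Type*} [Fintype ι] {X : ι → Type*} [∀ i, MeasurableSpace (X i)]
    (μ : ∀ i, Measure (X i)) [∀ i, IsProbabilityMeasure (μ i)] {g : ∀ i, X i → ℝ≥0∞}
    (hg : ∀ i, Measurable (g i)) :
    ∫⁻ x, ∏ i, g i (x i) ∂Measure.pi μ = ∏ i, ∫⁻ y, g i y ∂μ i := by
  rw [lintegral_prod_eq_prod_lintegral_of_indepFun Finset.univ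
    (fun i (x : ∀ i, X i) => g i (x i))
    (iIndepFun_pi fun i => (hg i).aemeasurable) fun i => (hg i).comp (measurable_pi_apply i)]
  exact Finset.prod_congr rfl fun i _ =>
    (measurePreserving_eval μ i).lintegral_comp (hg i)

/-! ### Poisson distributions -/

/-- The Poisson distribution with parameter `r`, on `[0, ∞]`. -/
abbrev poissonENNReal (r : NNReal) : Measure ℝ≥0∞ :=
  (poissonMeasure r).map (fun k : ℕ => (k : ℝ≥0∞))

lemma lintegral_poissonENNReal (r : NNReal) {f : ℝ≥0∞ → ℝ≥0∞} (hf : Measurable f) :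
    ∫⁻ x, f x ∂poissonENNReal r =
      ∑' k : ℕ, f k * ENNReal.ofReal (Real.exp (-r) * r ^ k / k.factorial) := by
  rw [lintegral_map hf measurable_from_top, lintegral_countable']
  simp_rw [poissonMeasure_singleton]

/-- This is the generating function of the Poisson law at `y = exp (-t)`. The value `t = ∞` is
included, with `y = 0` and `y ^ 0 = 1`. -/
lemma laplace_poissonENNReal (r : NNReal) (t : ℝ≥0∞) :
    ∫⁻ x, expNeg (t * x) ∂poissonENNReal r = expNeg ((1 - expNeg t) * r) := by
  rw [lintegral_poissonENNReal r (by fun_prop)]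
  obtain ⟨y, hy⟩ : ∃ y : NNReal, expNeg t = y := ⟨_, (ENNReal.coe_toNNReal (expNeg_ne_top t)).symm⟩
  have hy1 : y ≤ 1 := by
    have := expNeg_le_one t
    rw [hy] at this; exact_mod_cast this
  have hterm : ∀ k : ℕ, expNeg (t * k) * ENNReal.ofReal (Real.exp (-r) * r ^ k / k.factorial) =
      ENNReal.ofReal (Real.exp (-r) * ((y * r : ℝ) ^ k / k.factorial)) := by
    intro k
    rw [mul_comm t, expNeg_nsmul, hy, ← ENNReal.coe_pow, ← ENNReal.ofReal_coe_nnreal,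
      ← ENNReal.ofReal_mul (by positivity)]
    congr 1
    push_cast
    rw [mul_pow]; ring
  simp_rw [hterm]
  have hs : HasSum (fun k : ℕ => Real.exp (-r) * ((y * r : ℝ) ^ k / k.factorial))
      (Real.exp (-r) * Real.exp (y * r)) := by
    rw [Real.exp_eq_exp_ℝ]
    exact (NormedSpace.expSeries_div_hasSum_exp (y * r : ℝ)).mul_left _
  rw [← ENNReal.ofReal_tsum_of_nonneg (fun k => by positivity) hs.summable, hs.tsum_eq, hy,
    ← ENNReal.coe_one, ← ENNReal.coe_sub, ← ENNReal.coe_mul, ← ENNReal.ofReal_coe_nnreal,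
    expNeg_ofReal (by positivity), ← Real.exp_add]
  congr 2
  push_cast [hy1]
  ring

lemma mean_poissonENNReal (r : NNReal) : ∫⁻ x, x ∂poissonENNReal r = r := by
  rw [lintegral_poissonENNReal r (f := fun x => x) measurable_id, tsum_eq_zero_add' ENNReal.summable]
  have hterm : ∀ k : ℕ, ((k + 1 : ℕ) : ℝ≥0∞) *
      ENNReal.ofReal (Real.exp (-r) * r ^ (k + 1) / (k + 1).factorial) =
      r * ENNReal.ofReal (Real.exp (-r) * r ^ k / k.factorial) := by
    intro k
    rw [← ENNReal.ofReal_coe_nnreal, ← ENNReal.ofReal_natCast,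
      ← ENNReal.ofReal_mul (by positivity), ← ENNReal.ofReal_mul (by positivity)]
    congr 1
    rw [Nat.factorial_succ]
    push_cast
    field_simp
    ring
  simp_rw [hterm]
  rw [ENNReal.tsum_mul_left, ← ENNReal.ofReal_tsum_of_nonneg (fun k => by positivity)
    (hasSum_one_poissonMeasure r).summable, (hasSum_one_poissonMeasure r).tsum_eq]
  simp

/-- From `exp (-r) ≥ 1 - r` one gets `(1 + r) exp (-r) ≥ 1 - r²`. The quadratic bound is what
excludes coinciding labels. -/
lemma poissonENNReal_two_le (r : NNReal) : poissonENNReal r {x | 2 ≤ x} ≤ (r : ℝ≥0∞) ^ 2 := by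
  have hm : MeasurableSet {x : ℝ≥0∞ | 2 ≤ x} := measurableSet_Ici
  rw [Measure.map_apply measurable_from_top hm]
  have hset : (fun k : ℕ => (k : ℝ≥0∞)) ⁻¹' {x | 2 ≤ x} = ({0, 1} : Set ℕ)ᶜ := by
    ext k
    simp only [Set.mem_preimage, Set.mem_ofPred_eq, Set.mem_compl_iff, Set.mem_insert_iff,
      Set.mem_singleton_iff]
    rw [show (2 : ℝ≥0∞) = ((2 : ℕ) : ℝ≥0∞) by norm_num, Nat.cast_le]
    omega
  rw [hset, ← ofReal_measureReal, probReal_compl_eq_one_sub (MeasurableSet.of_discrete),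
    show ({0, 1} : Set ℕ) = {0} ∪ {1} by rfl, measureReal_union (by simp) (by simp),
    poissonMeasure_real_singleton, poissonMeasure_real_singleton, ← ENNReal.ofReal_coe_nnreal,
    ← ENNReal.ofReal_pow (by positivity)]
  refine ENNReal.ofReal_le_ofReal ?_
  have h1 : 1 - (r : ℝ) ≤ Real.exp (-r) := by
    have := Real.add_one_le_exp (-(r : ℝ)); linarith
  have h2 : (0 : ℝ) ≤ r := r.2
  simp only [pow_zero, Nat.factorial, pow_one]
  norm_num
  nlinarith

/-! ### Poisson random measures -/

section PRM

variable {𝒲 E : Type*} [MeasurableSpace 𝒲] [MeasurableSpace E] {P : Measure 𝒲} {ν : Measure E}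
  {N : 𝒲 → Measure E}

lemma one_sub_expNeg_ne_zero {t : ℝ≥0∞} (ht : t ≠ 0) : 1 - expNeg t ≠ 0 := by
  rw [Ne, tsub_eq_zero_iff_le, not_le, ← expNeg_zero]
  exact lt_of_le_of_ne (expNeg_antitone zero_le) (expNeg_injective.ne ht)

lemma IsPRM.measurable_apply (h : IsPRM P ν N) {A : Set E} (hA : MeasurableSet A) :
    Measurable fun w => N w A :=
  (Measure.measurable_coe hA).comp h.measurable

lemma IsPRM.measurable_lintegral (h : IsPRM P ν N) {f : E → ℝ≥0∞} (hf : Measurable f) :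
    Measurable fun w => ∫⁻ e, f e ∂N w :=
  (Measure.measurable_lintegral hf).comp h.measurable

lemma IsPRM.lintegral_apply [IsProbabilityMeasure P] (h : IsPRM P ν N) {A : Set E}
    (hA : MeasurableSet A) : ∫⁻ w, N w A ∂P = ν A := by
  by_cases htop : ν A = ∞
  · rw [lintegral_congr_ae (h.law_top A hA htop)]
    simp [htop]
  · have hm := mean_poissonENNReal (ν A).toNNReal
    rw [poissonENNReal, ← (h.law A hA htop).map_eq,
      lintegral_map (f := fun x => x) measurable_id (h.measurable_apply hA), ENNReal.coe_toNNReal htop] at hm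
    exact hm

/-- The mean of a Poisson random measure is its intensity. -/
lemma IsPRM.lintegral_lintegral [IsProbabilityMeasure P] (h : IsPRM P ν N) {f : E → ℝ≥0∞}
    (hf : Measurable f) : ∫⁻ w, ∫⁻ e, f e ∂N w ∂P = ∫⁻ e, f e ∂ν := by
  have : P.bind N = ν := by
    ext A hA
    rw [Measure.bind_apply hA h.measurable.aemeasurable, h.lintegral_apply hA]
  rw [← this, Measure.lintegral_bind h.measurable.aemeasurable hf.aemeasurable]

/-- If `ν A = ∞`, the mass is almost surely infinite and both sides vanish unless `t = 0`, so the
Poisson formula persists. -/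
lemma IsPRM.laplace_apply [IsProbabilityMeasure P] (h : IsPRM P ν N) {A : Set E}
    (hA : MeasurableSet A) (t : ℝ≥0∞) :
    ∫⁻ w, expNeg (t * N w A) ∂P = expNeg ((1 - expNeg t) * ν A) := by
  by_cases htop : ν A = ∞
  · rw [lintegral_congr_ae (g := fun _ => expNeg (t * ∞))
      ((h.law_top A hA htop).mono fun w hw => by simp [hw]), htop]
    rcases eq_or_ne t 0 with rfl | ht
    · simp
    · rw [ENNReal.mul_top ht, ENNReal.mul_top]
      · simp
      · exact one_sub_expNeg_ne_zero ht
  · have hm := laplace_poissonENNReal (ν A).toNNReal t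
    rw [poissonENNReal, ← (h.law A hA htop).map_eq,
      lintegral_map (by fun_prop) (h.measurable_apply hA), ENNReal.coe_toNNReal htop] at hm
    exact hm

/-- The level sets of a simple function are disjoint, so their masses are independent and the
expectation factors into Poisson Laplace transforms. -/
lemma IsPRM.laplace_simpleFunc [IsProbabilityMeasure P] (h : IsPRM P ν N) (f : SimpleFunc E ℝ≥0∞) :
    ∫⁻ w, expNeg (∫⁻ e, f e ∂N w) ∂P = expNeg (∫⁻ e, (1 - expNeg (f e)) ∂ν) := by
  let e : Fin f.range.card ≃ f.range := f.range.equivFin.symm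
  have hsum : ∀ (g : ℝ≥0∞ → ℝ≥0∞) (μ : Measure E),
      ∫⁻ x, g (f x) ∂μ = ∑ i, g (e i) * μ (f ⁻¹' {(e i : ℝ≥0∞)}) := by
    intro g μ
    have h1 := SimpleFunc.lintegral_eq_lintegral (f.map g) μ
    rw [SimpleFunc.map_lintegral] at h1
    rw [Equiv.sum_comp e (fun i => g i * μ (f ⁻¹' {(i : ℝ≥0∞)})),
      Finset.sum_coe_sort f.range (fun y => g y * μ (f ⁻¹' {y})), ← h1]
    rfl
  have hA : ∀ i, MeasurableSet (f ⁻¹' {(e i : ℝ≥0∞)}) := fun i => f.measurableSet_fiber _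
  have hind := h.indep _ (fun i => f ⁻¹' {(e i : ℝ≥0∞)}) hA (fun i j hij => by
    refine Disjoint.preimage _ ?_
    rw [Set.disjoint_singleton]
    exact fun he => hij (e.injective (Subtype.ext he)))
  have hind' := hind.comp (fun i x => expNeg (e i * x)) (fun i => by fun_prop)
  simp_rw [hsum (fun y => 1 - expNeg y), hsum (fun y => y), expNeg_sum]
  have hprod := lintegral_prod_eq_prod_lintegral_of_indepFun Finset.univ _ hind'
    (fun i => Measurable.comp (by fun_prop) (h.measurable_apply (hA i)))
  simp only [Function.comp] at hprod
  rw [hprod]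
  exact Finset.prod_congr rfl fun i _ => h.laplace_apply (hA i) _

/-- The Laplace functional of a Poisson random measure. -/
theorem IsPRM.laplace [IsProbabilityMeasure P] (h : IsPRM P ν N) {f : E → ℝ≥0∞}
    (hf : Measurable f) :
    ∫⁻ w, expNeg (∫⁻ e, f e ∂N w) ∂P = expNeg (∫⁻ e, (1 - expNeg (f e)) ∂ν) := by
  open Filter Topology in
  -- Simple functions increase to `f`. Monotone convergence handles the inner integrals, and
  -- boundedness of `expNeg` by one handles the expectation.
  have hmono : ∀ x, Monotone fun n => SimpleFunc.eapprox f n x := fun x m n hmn =>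
    SimpleFunc.monotone_eapprox f hmn x
  have hlim : ∀ x, Tendsto (fun n => SimpleFunc.eapprox f n x) atTop (𝓝 (f x)) := fun x =>
    SimpleFunc.tendsto_eapprox hf x
  have h1 : Tendsto (fun n => ∫⁻ w, expNeg (∫⁻ e, SimpleFunc.eapprox f n e ∂N w) ∂P) atTop
      (𝓝 (∫⁻ w, expNeg (∫⁻ e, f e ∂N w) ∂P)) := by
    refine tendsto_lintegral_of_dominated_convergence (fun _ => 1) (fun n => ?_)
      (fun n => ae_of_all _ fun w => expNeg_le_one _) (by simp) (ae_of_all _ fun w => ?_)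
    · exact measurable_expNeg.comp (h.measurable_lintegral (SimpleFunc.measurable _))
    · refine (continuous_expNeg.tendsto _).comp ?_
      exact lintegral_tendsto_of_tendsto_of_monotone
        (fun n => (SimpleFunc.measurable _).aemeasurable) (ae_of_all _ hmono) (ae_of_all _ hlim)
  have h2 : Tendsto (fun n => expNeg (∫⁻ e, (1 - expNeg (SimpleFunc.eapprox f n e)) ∂ν)) atTop
      (𝓝 (expNeg (∫⁻ e, (1 - expNeg (f e)) ∂ν))) := by
    refine (continuous_expNeg.tendsto _).comp ?_
    refine lintegral_tendsto_of_tendsto_of_monotone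
      (fun n => (measurable_const.sub
        (measurable_expNeg.comp (SimpleFunc.measurable _))).aemeasurable)
      (ae_of_all _ fun x m n hmn => tsub_le_tsub_left (expNeg_antitone (hmono x hmn)) 1)
      (ae_of_all _ fun x => ?_)
    exact ENNReal.Tendsto.sub tendsto_const_nhds ((continuous_expNeg.tendsto _).comp (hlim x))
      (Or.inl ENNReal.one_ne_top)
  refine tendsto_nhds_unique h1 (h2.congr fun n => (h.laplace_simpleFunc _).symm)

/-- A random measure with the Laplace functional of `PRM(ν)` is a Poisson random measure. -/
theorem isPRM_of_laplace [IsProbabilityMeasure P] (hN : Measurable N)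
    (h : ∀ f : E → ℝ≥0∞, Measurable f →
      ∫⁻ w, expNeg (∫⁻ e, f e ∂N w) ∂P = expNeg (∫⁻ e, (1 - expNeg (f e)) ∂ν)) :
    IsPRM P ν N := by
  classical
  have hNA : ∀ A, MeasurableSet A → Measurable fun w => N w A := fun A hA =>
    (Measure.measurable_coe hA).comp hN
  -- The test function is the step function with value `t i` on `A i`. By disjointness `1 - expNeg`
  -- of it is again a step function, so the Laplace functional factors. This gives both the
  -- marginals and their independence.
  have hmulti : ∀ (m : ℕ) (A : Fin m → Set E), (∀ i, MeasurableSet (A i)) →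
      Pairwise (Function.onFun Disjoint A) → ∀ t : Fin m → ℝ≥0∞,
      ∫⁻ w, expNeg (∑ i, t i * N w (A i)) ∂P = ∏ i, expNeg ((1 - expNeg (t i)) * ν (A i)) := by
    intro m A hA hd t
    have hmeas : ∀ (c : Fin m → ℝ≥0∞) i, Measurable ((A i).indicator fun _ => c i) := fun c i =>
      measurable_const.indicator (hA i)
    have hI : ∀ (c : Fin m → ℝ≥0∞) (μ : Measure E),
        ∫⁻ e, ∑ i, (A i).indicator (fun _ => c i) e ∂μ = ∑ i, c i * μ (A i) := by
      intro c μ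
      rw [lintegral_finsetSum _ fun i _ => hmeas c i]
      exact Finset.sum_congr rfl fun i _ => lintegral_indicator_const (hA i) _
    have := h (fun e => ∑ i, (A i).indicator (fun _ => t i) e)
      (Finset.measurable_sum _ fun i _ => hmeas t i)
    simp_rw [hI t] at this
    rw [this, ← expNeg_sum, ← hI (fun i => 1 - expNeg (t i))]
    congr 2
    funext e
    by_cases he : ∃ i, e ∈ A i
    · obtain ⟨i, hi⟩ := he
      have hne : ∀ j, j ≠ i → e ∉ A j := fun j hj hej =>
        Set.disjoint_left.mp (hd hj) hej hi
      rw [Finset.sum_eq_single i (fun j _ hj => by simp [hne j hj]) (by simp),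
        Finset.sum_eq_single i (fun j _ hj => by simp [hne j hj]) (by simp)]
      simp [hi]
    · have he : ∀ i, e ∉ A i := by simpa using he
      simp [he]
  have hone : ∀ A, MeasurableSet A → ∀ t : ℝ≥0∞,
      ∫⁻ w, expNeg (t * N w A) ∂P = expNeg ((1 - expNeg t) * ν A) := by
    intro A hA t
    have := hmulti 1 (fun _ => A) (fun _ => hA) (fun i j hij => (hij (Subsingleton.elim _ _)).elim)
      fun _ => t
    simpa using this
  refine ⟨hN, fun A hA hfin => ⟨(hNA A hA).aemeasurable, ?_⟩, fun A hA htop => ?_,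
    fun m A hA hd => ?_⟩
  · have : IsProbabilityMeasure (P.map fun w => N w A) :=
      Measure.isProbabilityMeasure_map (hNA A hA).aemeasurable
    refine ennreal_ext fun t => ?_
    rw [lintegral_map (by fun_prop) (hNA A hA), hone A hA,
      laplace_poissonENNReal, ENNReal.coe_toNNReal hfin]
  · have hmeas := hNA A hA
    -- At `t = 1` the transform is zero, so the nonnegative variable `expNeg (N A)` vanishes almost
    -- surely. Any `t ≠ 0` would do.
    have h2 := hone A hA 1
    rw [htop, ENNReal.mul_top, expNeg_top,
      lintegral_eq_zero_iff (by fun_prop)] at h2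
    · filter_upwards [h2] with w hw
      simpa [expNeg_eq_zero] using hw
    · exact one_sub_expNeg_ne_zero one_ne_zero
  · rw [iIndepFun_iff_map_fun_eq_pi_map fun i => (hNA _ (hA i)).aemeasurable]
    have hm : Measurable fun w i => N w (A i) := measurable_pi_iff.mpr fun i => hNA _ (hA i)
    have : ∀ i, IsProbabilityMeasure (P.map fun w => N w (A i)) := fun i =>
      Measure.isProbabilityMeasure_map (hNA _ (hA i)).aemeasurable
    have := Measure.isProbabilityMeasure_map (μ := P) hm.aemeasurable
    refine ennreal_pi_ext fun t => ?_
    rw [lintegral_map (by fun_prop) hm, hmulti m A hA hd]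
    simp_rw [expNeg_sum]
    rw [lintegral_pi_prod _ (g := fun i y => expNeg (t i * y)) fun i => by fun_prop]
    refine Finset.prod_congr rfl fun i _ => ?_
    rw [lintegral_map (by fun_prop) (hNA _ (hA i)), hone _ (hA i)]

/-- Almost surely, no two points of a Poisson random measure with finite intensity on `A` have
the same label, if the law of the labels is nonatomic. -/
lemma IsPRM.measure_fiber_lt_two [IsProbabilityMeasure P] (h : IsPRM P ν N) {T : E → ℝ}
    (hT : Measurable T) {A : Set E} (hA : MeasurableSet A) (hfin : ν A ≠ ∞)
    (hatom : ∀ t, ν (A ∩ T ⁻¹' {t}) = 0) : ∀ᵐ w ∂P, ∀ t, N w (A ∩ T ⁻¹' {t}) < 2 := by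
  open Filter Topology in
  let μ : Measure ℝ := (ν.restrict A).map T
  have hμ : ∀ B, MeasurableSet B → μ B = ν (A ∩ T ⁻¹' B) := fun B hB => by
    rw [Measure.map_apply hT hB, Measure.restrict_apply (hT hB), Set.inter_comm]
  have : IsFiniteMeasure μ := ⟨by rw [hμ _ .univ]; simpa using hfin.lt_top⟩
  -- The cells at level `n` are intervals of length `1 / (n + 1)`. Two points in a common fibre lie
  -- in a common cell. A cell holds two points with probability at most the square of its mass, and
  -- the squares of the cells lie in the strip `D n`, which shrinks to the diagonal.
  let cell : ℕ → ℤ → Set ℝ := fun n j => (fun t => ⌊((n : ℝ) + 1) * t⌋) ⁻¹' {j}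
  have hcell : ∀ n j, MeasurableSet (cell n j) := fun n j => by
    have : Measurable fun t : ℝ => ⌊((n : ℝ) + 1) * t⌋ :=
      Int.measurable_floor.comp (measurable_const_mul _)
    exact this (MeasurableSet.of_discrete)
  let D : ℕ → Set (ℝ × ℝ) := fun n => {x | |x.1 - x.2| ≤ 1 / ((n : ℝ) + 1)}
  have hD : ∀ n, MeasurableSet (D n) := fun n =>
    measurableSet_le (by fun_prop) measurable_const
  have hlim : Tendsto (fun n => (μ.prod μ) (D n)) atTop (𝓝 0) := by
    -- The diagonal is null for `μ × μ` because `μ` has no atoms.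
    have h0 : (μ.prod μ) (⋂ n, D n) = 0 := by
      have hsub : ⋂ n, D n ⊆ {x : ℝ × ℝ | x.1 = x.2} := by
        intro x hx
        rw [Set.mem_iInter] at hx
        have : |x.1 - x.2| ≤ 0 := ge_of_tendsto' tendsto_one_div_add_atTop_nhds_zero_nat hx
        simpa [sub_eq_zero] using this
      refine measure_mono_null hsub ?_
      have hdiag : MeasurableSet {x : ℝ × ℝ | x.1 = x.2} :=
        measurableSet_eq_fun measurable_fst measurable_snd
      rw [Measure.measure_prod_null hdiag]
      refine ae_of_all _ fun t => ?_
      have : Prod.mk t ⁻¹' {x : ℝ × ℝ | x.1 = x.2} = {t} := by ext s; simp [eq_comm]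
      simp only [this, Pi.zero_apply]
      rw [hμ _ (measurableSet_singleton t)]
      exact hatom t
    rw [← h0]
    refine tendsto_measure_iInter_atTop (fun n => (hD n).nullMeasurableSet) ?_
      ⟨0, measure_ne_top _ _⟩
    intro m n hmn x hx
    refine le_trans (show |x.1 - x.2| ≤ _ from hx) ?_
    have : (m : ℝ) ≤ n := by exact_mod_cast hmn
    exact one_div_le_one_div_of_le (by positivity) (by linarith)
  -- The event involves uncountably many `t`. Only monotonicity and subadditivity are used for it,
  -- so its measurability is not needed.
  have hbound : ∀ n, P {w | ∃ t, 2 ≤ N w (A ∩ T ⁻¹' {t})} ≤ (μ.prod μ) (D n) := by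
    intro n
    calc P {w | ∃ t, 2 ≤ N w (A ∩ T ⁻¹' {t})}
        ≤ P (⋃ j, {w | 2 ≤ N w (A ∩ T ⁻¹' cell n j)}) := by
          refine measure_mono ?_
          rintro w ⟨t, ht⟩
          refine Set.mem_iUnion.mpr ⟨⌊((n : ℝ) + 1) * t⌋, ht.trans (measure_mono ?_)⟩
          refine Set.inter_subset_inter_right _ (Set.preimage_mono ?_)
          rintro s rfl
          rfl
      _ ≤ ∑' j, P {w | 2 ≤ N w (A ∩ T ⁻¹' cell n j)} := measure_iUnion_le _
      _ ≤ ∑' j, (μ.prod μ) (cell n j ×ˢ cell n j) := by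
          refine ENNReal.tsum_le_tsum fun j => ?_
          have hAj := hA.inter (hT (hcell n j))
          have hne : ν (A ∩ T ⁻¹' cell n j) ≠ ∞ :=
            ne_top_of_le_ne_top hfin (measure_mono Set.inter_subset_left)
          rw [Measure.prod_prod, hμ _ (hcell n j), ← sq]
          have := poissonENNReal_two_le (ν (A ∩ T ⁻¹' cell n j)).toNNReal
          rw [ENNReal.coe_toNNReal hne, poissonENNReal, ← (h.law _ hAj hne).map_eq,
            Measure.map_apply (h.measurable_apply hAj)
              (measurableSet_le measurable_const measurable_id')] at this
          exact this
      _ = (μ.prod μ) (⋃ j, cell n j ×ˢ cell n j) := by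
          refine (measure_iUnion (fun i j hij => ?_) fun j => (hcell n j).prod (hcell n j)).symm
          refine Set.disjoint_left.mpr fun x hx hx' => hij ?_
          exact hx.1.symm.trans hx'.1
      _ ≤ (μ.prod μ) (D n) := by
          refine measure_mono (Set.iUnion_subset fun j x hx => ?_)
          have h1 : ⌊((n : ℝ) + 1) * x.1⌋ = ⌊((n : ℝ) + 1) * x.2⌋ := hx.1.trans hx.2.symm
          have h2 := Int.abs_sub_lt_one_of_floor_eq_floor h1
          have hpos : (0 : ℝ) < (n : ℝ) + 1 := by positivity
          rw [← mul_sub, abs_mul, abs_of_pos hpos] at h2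
          change |x.1 - x.2| ≤ 1 / ((n : ℝ) + 1)
          rw [le_div_iff₀ hpos, mul_comm]
          exact h2.le
  have hzero : P {w | ∃ t, 2 ≤ N w (A ∩ T ⁻¹' {t})} = 0 :=
    le_antisymm (ge_of_tendsto' hlim hbound) zero_le
  rw [ae_iff]
  simpa using hzero

end PRM

/-! ### Conditionally independent discrete marks -/

lemma prod_tsum_fin {A : Type*} [Countable A] : ∀ {m : ℕ} (g : Fin m → A → ℝ≥0∞),
    ∏ k, ∑' a, g k a = ∑' a : Fin m → A, ∏ k, g k (a k)
  | 0, g => by simp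
  | m + 1, g => by
    rw [Fin.prod_univ_succ, prod_tsum_fin (fun k => g k.succ), ← ENNReal.tsum_mul_right,
      ← (Fin.consEquiv fun _ => A).tsum_eq, ENNReal.tsum_prod']
    refine tsum_congr fun a => ?_
    rw [← ENNReal.tsum_mul_left]
    refine tsum_congr fun b => ?_
    simp [Fin.consEquiv, Fin.prod_univ_succ]

section Marks

variable {𝒲 𝕌 A : Type*} [MeasurableSpace 𝒲] [MeasurableSpace 𝕌] [MeasurableSpace A]
  [Countable A] [MeasurableSingletonClass A]

/-- Given `U`, the discrete marks `β 0, β 1, …` are independent with point masses `π k U`. -/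
def HasMarks (P : Measure 𝒲) (U : 𝒲 → 𝕌) (β : ℕ → 𝒲 → A) (π : ℕ → 𝕌 → A → ℝ≥0∞) : Prop :=
  ∀ (m : ℕ) (a : Fin m → A) (B : Set 𝕌), MeasurableSet B →
    P (U ⁻¹' B ∩ {w | ∀ k : Fin m, β k w = a k}) = ∫⁻ w in U ⁻¹' B, ∏ k : Fin m, π k (U w) (a k) ∂P

variable {P : Measure 𝒲} {U : 𝒲 → 𝕌} {β : ℕ → 𝒲 → A} {π : ℕ → 𝕌 → A → ℝ≥0∞}

-- `HasMarks` says that `P` restricted to the event and `P` weighted by the conditional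
-- probabilities have the same image under `U`. Hence they integrate every function of `U` alike.
omit [Countable A] in
lemma HasMarks.lintegral_event (h : HasMarks P U β π) (hU : Measurable U)
    (hβ : ∀ k, Measurable (β k)) (hπ : ∀ k a, Measurable fun u => π k u a) {m : ℕ} (a : Fin m → A)
    {G : 𝕌 → ℝ≥0∞} (hG : Measurable G) :
    ∫⁻ w, {w | ∀ k : Fin m, β k w = a k}.indicator (fun w => G (U w)) w ∂P =
      ∫⁻ w, G (U w) * ∏ k : Fin m, π k (U w) (a k) ∂P := by
  have hS : MeasurableSet {w | ∀ k : Fin m, β k w = a k} := by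
    rw [Set.ofPred_forall]
    exact MeasurableSet.iInter fun k => hβ k (measurableSet_singleton (a k))
  have hd : Measurable fun w => ∏ k : Fin m, π k (U w) (a k) :=
    Finset.measurable_prod _ fun k _ => (hπ k (a k)).comp hU
  have heq : (P.restrict {w | ∀ k : Fin m, β k w = a k}).map U =
      (P.withDensity fun w => ∏ k : Fin m, π k (U w) (a k)).map U := by
    ext B hB
    rw [Measure.map_apply hU hB, Measure.map_apply hU hB, Measure.restrict_apply (hU hB),
      withDensity_apply _ (hU hB), h m a B hB]
  rw [lintegral_indicator hS, ← lintegral_map hG hU, heq, lintegral_map hG hU,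
    lintegral_withDensity_eq_lintegral_mul _ hd (g := fun w => G (U w)) (hG.comp hU)]
  exact lintegral_congr fun w => mul_comm _ _

/-- Decompose over the countably many values of the first `m` marks; the sum of products is then
folded back into a product of sums. -/
lemma HasMarks.lintegral_prod (h : HasMarks P U β π) (hU : Measurable U)
    (hβ : ∀ k, Measurable (β k)) (hπ : ∀ k a, Measurable fun u => π k u a) (m : ℕ)
    {g : ℕ → 𝕌 → A → ℝ≥0∞} (hg : ∀ k a, Measurable fun u => g k u a) :
    ∫⁻ w, ∏ k : Fin m, g k (U w) (β k w) ∂P =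
      ∫⁻ w, ∏ k : Fin m, ∑' a, g k (U w) a * π k (U w) a ∂P := by
  classical
  have hS : ∀ a : Fin m → A, MeasurableSet {w | ∀ k : Fin m, β k w = a k} := fun a => by
    rw [Set.ofPred_forall]
    exact MeasurableSet.iInter fun k => hβ k (measurableSet_singleton (a k))
  have hprod : ∀ a : Fin m → A, Measurable fun u => ∏ k : Fin m, g k u (a k) := fun a =>
    Finset.measurable_prod _ fun k _ => hg k (a k)
  have hsplit : ∀ w, ∏ k : Fin m, g k (U w) (β k w) =
      ∑' a : Fin m → A, {w | ∀ k : Fin m, β k w = a k}.indicator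
        (fun w => ∏ k : Fin m, g k (U w) (a k)) w := by
    intro w
    rw [tsum_eq_single (fun k : Fin m => β k w)]
    · simp
    · intro a ha
      refine Set.indicator_of_notMem (fun hw => ha ?_) _
      exact funext fun k => (hw k).symm
  simp_rw [hsplit, prod_tsum_fin]
  rw [lintegral_tsum, lintegral_tsum]
  rotate_left
  · exact fun a => (Finset.measurable_prod _ fun (k : Fin m) _ =>
      ((hg k (a k)).comp hU).mul ((hπ k (a k)).comp hU)).aemeasurable
  · exact fun a => (((hprod a).comp hU).indicator (hS a)).aemeasurable
  · refine tsum_congr fun a => ?_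
    rw [h.lintegral_event hU hβ hπ a (hprod a)]
    simp_rw [Finset.prod_mul_distrib]

lemma tendsto_expNeg_sum_fin (f : ℕ → ℝ≥0∞) :
    Filter.Tendsto (fun m => expNeg (∑ k : Fin m, f k)) Filter.atTop (nhds (expNeg (∑' k, f k))) := by
  refine (continuous_expNeg.tendsto _).comp ?_
  simp_rw [Fin.sum_univ_eq_sum_range]
  exact ENNReal.summable.hasSum.tendsto_sum_nat

/-- The Laplace functional of a marked sequence. -/
theorem HasMarks.laplace [IsProbabilityMeasure P] (h : HasMarks P U β π) (hU : Measurable U)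
    (hβ : ∀ k, Measurable (β k)) (hπ : ∀ k a, Measurable fun u => π k u a)
    (hπ_le : ∀ᵐ w ∂P, ∀ k, ∑' a, π k (U w) a ≤ 1)
    {f : ℕ → 𝕌 → A → ℝ≥0∞} (hf : ∀ k a, Measurable fun u => f k u a) :
    ∫⁻ w, expNeg (∑' k, f k (U w) (β k w)) ∂P =
      ∫⁻ w, expNeg (∑' k, negLog (∑' a, expNeg (f k (U w) a) * π k (U w) a)) ∂P := by
  have hfβ : ∀ k, Measurable fun w => f k (U w) (β k w) := fun k => by
    have : Measurable (Function.uncurry fun (a : A) (u : 𝕌) => f k u a) :=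
      measurable_from_prod_countable_right fun a => hf k a
    exact this.comp ((hβ k).prodMk hU)
  have hs : ∀ k, Measurable fun w => negLog (∑' a, expNeg (f k (U w) a) * π k (U w) a) :=
    fun k => measurable_negLog.comp (Measurable.tsum fun a =>
      (measurable_expNeg.comp ((hf k a).comp hU)).mul ((hπ k a).comp hU))
  have h1 : Filter.Tendsto (fun m : ℕ => ∫⁻ w, expNeg (∑ k : Fin m, f k (U w) (β k w)) ∂P)
      Filter.atTop (nhds (∫⁻ w, expNeg (∑' k, f k (U w) (β k w)) ∂P)) := by
    refine tendsto_lintegral_of_dominated_convergence (fun _ => 1) (fun n => ?_)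
      (fun n => ae_of_all _ fun w => expNeg_le_one _) (by simp)
      (ae_of_all _ fun w => tendsto_expNeg_sum_fin fun k => f k (U w) (β k w))
    exact measurable_expNeg.comp (Finset.measurable_sum _ fun k _ => hfβ k)
  have h2 : Filter.Tendsto (fun m : ℕ => ∫⁻ w, expNeg (∑ k : Fin m,
      negLog (∑' a, expNeg (f k (U w) a) * π k (U w) a)) ∂P)
      Filter.atTop (nhds (∫⁻ w, expNeg (∑' k,
        negLog (∑' a, expNeg (f k (U w) a) * π k (U w) a)) ∂P)) := by
    refine tendsto_lintegral_of_dominated_convergence (fun _ => 1) (fun n => ?_)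
      (fun n => ae_of_all _ fun w => expNeg_le_one _) (by simp)
      (ae_of_all _ fun w => tendsto_expNeg_sum_fin
        fun k => negLog (∑' a, expNeg (f k (U w) a) * π k (U w) a))
    exact measurable_expNeg.comp (Finset.measurable_sum _ fun k _ => hs k)
  -- Both sides are limits of their first `m` factors. Writing each conditional mean as `expNeg
  -- (negLog ·)` keeps the infinite product a series in an exponent.
  refine tendsto_nhds_unique h1 (h2.congr fun m => ?_)
  simp_rw [expNeg_sum]
  rw [h.lintegral_prod hU hβ hπ m (g := fun k u a => expNeg (f k u a))
    fun k a => measurable_expNeg.comp (hf k a)]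
  refine lintegral_congr_ae (hπ_le.mono fun w hw => Finset.prod_congr rfl fun k _ => ?_)
  refine expNeg_negLog (le_trans (ENNReal.tsum_le_tsum fun a => ?_) (hw k))
  exact mul_le_of_le_one_left zero_le (expNeg_le_one _)

end Marks

/-! ### Multinomial weights -/

section Weights

variable {q : ℕ}

lemma multinomialPMF_zero_right (s : Fin q → ℝ) : multinomialPMF s 0 = 1 - ∑ j, s j := by
  simp [multinomialPMF]

lemma multinomialPMF_single (s : Fin q → ℝ) (j : Fin q) :
    multinomialPMF s (Pi.single j 1) = s j := by
  have h1 : ∑ i, (Pi.single j 1 : Fin q → ℕ) i = 1 := by simp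
  rw [multinomialPMF, h1, if_pos le_rfl, Finset.prod_eq_single j]
  · simp
  · intro i _ hi; simp [hi]
  · simp

lemma eq_zero_or_single {a : Fin q → ℕ} (h : ∑ j, a j ≤ 1) : a = 0 ∨ ∃ j, a = Pi.single j 1 := by
  by_cases h0 : a = 0
  · exact Or.inl h0
  · obtain ⟨j, hj⟩ := Function.ne_iff.mp h0
    refine Or.inr ⟨j, funext fun i => ?_⟩
    rw [← Finset.add_sum_erase _ _ (Finset.mem_univ j)] at h
    have hj1 : 1 ≤ a j := Nat.one_le_iff_ne_zero.mpr hj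
    by_cases hij : i = j
    · subst hij; simp; omega
    · have := Finset.single_le_sum (f := a) (fun _ _ => Nat.zero_le _)
        (Finset.mem_erase.mpr ⟨hij, Finset.mem_univ i⟩)
      simp [hij]; omega

lemma multinomialPMF_eq_zero {s : Fin q → ℝ} {a : Fin q → ℕ} (h : 1 < ∑ j, a j) :
    multinomialPMF s a = 0 := by
  rw [multinomialPMF, if_neg (not_le.mpr h)]

/-- `M(1, s)` charges only the zero vector and the `q` unit vectors, with masses affine in `s`. -/
lemma tsum_multinomialPMF (s : Fin q → ℝ) (g : (Fin q → ℕ) → ℝ≥0∞) :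
    ∑' a, g a * ENNReal.ofReal (multinomialPMF s a) =
      g 0 * ENNReal.ofReal (1 - ∑ j, s j) +
        ∑ j, g (Pi.single j 1) * ENNReal.ofReal (s j) := by
  classical
  have hinj : Function.Injective fun j : Fin q => (Pi.single j 1 : Fin q → ℕ) := by
    intro i j hij
    by_contra hne
    have := congrFun hij i
    simp [hne] at this
  have hnot : (0 : Fin q → ℕ) ∉ Finset.univ.map ⟨_, hinj⟩ := by
    simp only [Finset.mem_map, Finset.mem_univ, true_and, not_exists]
    intro j hj
    have := congrFun hj j
    simp at this
  rw [tsum_eq_sum (s := insert 0 (Finset.univ.map ⟨_, hinj⟩)), Finset.sum_insert hnot,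
    Finset.sum_map, multinomialPMF_zero_right]
  · simp [multinomialPMF_single]
  · intro a ha
    rw [multinomialPMF_eq_zero]
    · simp
    · by_contra hle
      rcases eq_zero_or_single (not_lt.mp hle) with rfl | ⟨j, rfl⟩
      · simp at ha
      · simp at ha

/-- The value `s = 0` encodes an absent point, where `M(1, 0)` is the Dirac mass at zero. Allowing
it lets absent indices carry marks without special treatment. -/
lemma tsum_multinomialPMF_eq_one {s : Fin q → ℝ} (hs : s ∈ simplex q ∨ s = 0) :
    ∑' a, ENNReal.ofReal (multinomialPMF s a) = 1 := by
  have := tsum_multinomialPMF s fun _ => 1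
  simp only [one_mul] at this
  rw [this]
  rcases hs with hs | rfl
  · rw [← ENNReal.ofReal_sum_of_nonneg fun j _ => (hs.1 j).le, ← ENNReal.ofReal_add]
    · simp
    · linarith [hs.2]
    · exact Finset.sum_nonneg fun j _ => (hs.1 j).le
  · simp

lemma multinomialPMF_nonneg {s : Fin q → ℝ} (hs : s ∈ simplex q ∨ s = 0) (a : Fin q → ℕ) :
    0 ≤ multinomialPMF s a := by
  unfold multinomialPMF
  split_ifs
  · rcases hs with hs | rfl
    · exact mul_nonneg (Finset.prod_nonneg fun j _ => pow_nonneg (hs.1 j).le _)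
        (pow_nonneg (by linarith [hs.2]) _)
    · refine mul_nonneg (Finset.prod_nonneg fun j _ => pow_nonneg le_rfl _) (by simp)
  · exact le_rfl

/-- The probability that `n` independent vectors with distribution `M(1, s)` have the values
`a 1, …, a n`. -/
def markWeight {n : ℕ} (s : Fin q → ℝ) (a : Fin n → Fin q → ℕ) : ℝ≥0∞ :=
  ∏ i, ENNReal.ofReal (multinomialPMF s (a i))

@[fun_prop]
lemma measurable_markWeight {n : ℕ} (a : Fin n → Fin q → ℕ) :
    Measurable fun s : Fin q → ℝ => markWeight s a :=
  Finset.measurable_prod _ fun i _ => (measurable_multinomialPMF (a i)).ennreal_ofReal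

lemma tsum_markWeight {n : ℕ} {s : Fin q → ℝ} (hs : s ∈ simplex q ∨ s = 0) :
    ∑' a : Fin n → Fin q → ℕ, markWeight s a = 1 := by
  unfold markWeight
  rw [← prod_tsum_fin (fun (_ : Fin n) a => ENNReal.ofReal (multinomialPMF s a))]
  simp [tsum_multinomialPMF_eq_one hs]

end Weights

/-! ### The points of a multinomial IBP model as a marked sequence -/

section Model

variable {q n : ℕ} {Ω : Type u} {𝒲 : Type v} [MeasurableSpace Ω] [MeasurableSpace 𝒲]
  {P : Measure 𝒲} {ν : Measure ((Fin q → ℝ) × Ω)}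
  {p : ℕ → 𝒲 → Fin q → ℝ} {θ : ℕ → 𝒲 → Ω} {b : Fin n → ℕ → 𝒲 → Fin q → ℕ}

/-- The sequence of the points of the model. -/
def pointSeq (p : ℕ → 𝒲 → Fin q → ℝ) (θ : ℕ → 𝒲 → Ω) (w : 𝒲) (k : ℕ) : (Fin q → ℝ) × Ω :=
  (p k w, θ k w)

lemma IsIBPModel.measurable_pointSeq (h : IsIBPModel P ν p θ b) : Measurable (pointSeq p θ) :=
  measurable_pi_iff.mpr fun k => (h.measurable_p k).prodMk (h.measurable_θ k)

/-- The integrated form of the conditional law of the vectors `b i k`. -/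
lemma IsIBPModel.hasMarks [IsProbabilityMeasure P] (h : IsIBPModel P ν p θ b) :
    HasMarks P (pointSeq p θ) (fun k w i => b i k w) (fun k u a => markWeight (u k).1 a) := by
  classical
  intro m a B hB
  have hU := h.measurable_pointSeq
  let F : Finset (Fin n × ℕ) := Finset.univ ×ˢ Finset.range m
  -- The default value `0` is never read, since `F` contains only indices `k < m`.
  let a' : Fin n × ℕ → Fin q → ℕ := fun x => if hx : x.2 < m then a ⟨x.2, hx⟩ x.1 else 0
  have hset : {w | ∀ x ∈ F, b x.1 x.2 w = a' x} =
      {w | ∀ k : Fin m, (fun i => b i k w) = a k} := by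
    ext w
    simp only [Set.mem_ofPred_eq, F, a', Finset.mem_product, Finset.mem_univ, Finset.mem_range,
      true_and, Prod.forall]
    constructor
    · intro H k
      funext i
      have := H i k k.2
      simpa using this
    · intro H i k hk
      have := congrFun (H ⟨k, hk⟩) i
      simpa [hk] using this
  have hS : MeasurableSet {w | ∀ x ∈ F, b x.1 x.2 w = a' x} := by
    have : {w | ∀ x ∈ F, b x.1 x.2 w = a' x} = ⋂ x ∈ F, b x.1 x.2 ⁻¹' {a' x} := by ext w; simp
    rw [this]
    exact Finset.measurableSet_biInter _ fun x _ => h.measurable_b _ _ (measurableSet_singleton _)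
  have hc := h.cond_b F a'
  have hle : MeasurableSpace.comap (fun w (k : ℕ) => (p k w, θ k w)) inferInstance ≤
      (inferInstance : MeasurableSpace 𝒲) := hU.comap_le
  have hB' : MeasurableSet[MeasurableSpace.comap (fun w (k : ℕ) => (p k w, θ k w)) inferInstance]
      (pointSeq p θ ⁻¹' B) := ⟨B, hB, rfl⟩
  have hprod : ∀ w, (∏ x ∈ F, multinomialPMF (p x.2 w) (a' x)) =
      ∏ k : Fin m, ∏ i, multinomialPMF (p k w) (a k i) := by
    intro w
    rw [Finset.prod_product_right, Finset.prod_range]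
    refine Finset.prod_congr rfl fun k _ => Finset.prod_congr rfl fun i _ => ?_
    simp [a']
  have hnn : ∀ᵐ w ∂P, 0 ≤ ∏ k : Fin m, ∏ i, multinomialPMF (p k w) (a k i) := by
    filter_upwards [h.p_mem] with w hw
    exact Finset.prod_nonneg fun k _ => Finset.prod_nonneg fun i _ => multinomialPMF_nonneg (hw k) _
  have hmeasR : Measurable fun w => ∏ k : Fin m, ∏ i, multinomialPMF (p k w) (a k i) :=
    Finset.measurable_prod _ fun k _ => Finset.measurable_prod _ fun i _ =>
      (measurable_multinomialPMF (a k i)).comp (h.measurable_p k)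
  -- Integrability is inherited from the conditional expectation, which equals this product almost
  -- surely.
  have hint : Integrable (fun w => ∏ k : Fin m, ∏ i, multinomialPMF (p k w) (a k i)) P := by
    refine (integrable_condExp (m := MeasurableSpace.comap (fun w (k : ℕ) => (p k w, θ k w))
      inferInstance) (f := {w | ∀ x ∈ F, b x.1 x.2 w = a' x}.indicator fun _ => (1 : ℝ))
      (μ := P)).congr (hc.trans (ae_of_all _ fun w => hprod w))
  have h1 := setIntegral_condExp hle
    ((integrable_const (1 : ℝ)).indicator hS : Integrable _ P) hB'
  rw [setIntegral_congr_ae (hle _ hB') (hc.mono fun w hw _ => hw.trans (hprod w)),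
    setIntegral_indicator hS, setIntegral_const, smul_eq_mul, mul_one] at h1
  rw [← hset, ← ofReal_measureReal, ← h1,
    ofReal_integral_eq_lintegral_ofReal hint.integrableOn (ae_restrict_of_ae hnn)]
  refine lintegral_congr_ae (ae_restrict_of_ae (h.p_mem.mono fun w hw => ?_))
  dsimp only
  rw [ENNReal.ofReal_prod_of_nonneg fun (k : Fin m) _ => Finset.prod_nonneg fun i _ =>
    multinomialPMF_nonneg (hw k) (a k i)]
  refine Finset.prod_congr rfl fun k _ => ?_
  rw [ENNReal.ofReal_prod_of_nonneg fun i _ => multinomialPMF_nonneg (hw k) _]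
  rfl

-- Absent indices have `p k w = 0` and contribute no atom; the condition `f (0, ·) = 0` lets the sum
-- range over all `k`.
omit [MeasurableSpace 𝒲] in
lemma pointProcess_lintegral (w : 𝒲) {f : (Fin q → ℝ) × Ω → ℝ≥0∞} (hf : Measurable f)
    (hf0 : ∀ o, f (0, o) = 0) :
    ∫⁻ e, f e ∂(pointProcess p θ w) = ∑' k, f (p k w, θ k w) := by
  classical
  rw [pointProcess, lintegral_sum_measure]
  refine tsum_congr fun k => ?_
  split_ifs with h0
  · simp [h0, hf0]
  · rw [lintegral_dirac' _ hf]

/-- The Laplace functional of the marked point process of a multinomial IBP model. -/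
theorem IsIBPModel.laplace [IsProbabilityMeasure P] (h : IsIBPModel P ν p θ b)
    (hν : ∀ᵐ e ∂ν, e.1 ∈ simplex q)
    {f : (Fin q → ℝ) × Ω → (Fin n → Fin q → ℕ) → ℝ≥0∞} (hf : ∀ a, Measurable fun e => f e a)
    (hf0 : ∀ o a, f (0, o) a = 0) :
    ∫⁻ w, expNeg (∑' k, f (p k w, θ k w) fun i => b i k w) ∂P =
      expNeg (∫⁻ e, ∑' a, (1 - expNeg (f e a)) * markWeight e.1 a ∂ν) := by
  have hw : ∀ᵐ w ∂P, ∀ k, ∑' a : Fin n → Fin q → ℕ, markWeight (pointSeq p θ w k).1 a ≤ 1 := by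
    filter_upwards [h.p_mem] with w hw k
    exact (tsum_markWeight (hw k)).le
  refine (h.hasMarks.laplace h.measurable_pointSeq
    (fun k => measurable_pi_iff.mpr fun i => h.measurable_b i k)
    (fun k a => (measurable_markWeight a).comp (by fun_prop)) hw
    (f := fun k u a => f (u k) a) (fun k a => (hf a).comp (measurable_pi_apply k))).trans ?_
  -- Averaging over the marks turns `f` into this function of the unmarked points, to which the
  -- Poisson formula applies. Since the weights sum to one, `1 - expNeg F` is the average of `1 -
  -- expNeg f`.
  let F : (Fin q → ℝ) × Ω → ℝ≥0∞ := fun e => negLog (∑' a, expNeg (f e a) * markWeight e.1 a)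
  have hF : Measurable F := measurable_negLog.comp (Measurable.tsum fun a =>
    (measurable_expNeg.comp (hf a)).mul ((measurable_markWeight a).comp measurable_fst))
  have hF0 : ∀ o, F (0, o) = 0 := fun o => by
    simp [F, hf0, tsum_markWeight (s := (0 : Fin q → ℝ)) (Or.inr rfl)]
  have hL := h.prm.laplace hF
  simp_rw [fun w => pointProcess_lintegral (p := p) (θ := θ) w hF hF0] at hL
  refine hL.trans ?_
  congr 1
  refine lintegral_congr_ae (hν.mono fun e he => ?_)
  have hsum := tsum_markWeight (n := n) (s := e.1) (Or.inl he)
  have hle : ∀ a, expNeg (f e a) * markWeight e.1 a ≤ markWeight e.1 a := fun a =>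
    mul_le_of_le_one_left zero_le (expNeg_le_one _)
  have hle1 : ∑' a, expNeg (f e a) * markWeight e.1 a ≤ 1 :=
    (ENNReal.tsum_le_tsum hle).trans hsum.le
  simp only [F]
  rw [expNeg_negLog hle1]
  refine (ENNReal.eq_sub_of_add_eq (ne_top_of_le_ne_top ENNReal.one_ne_top hle1) ?_).symm
  rw [← ENNReal.tsum_add]
  refine Eq.trans (tsum_congr fun a => ?_) hsum
  rw [← add_mul, tsub_add_cancel_of_le (expNeg_le_one _), one_mul]

end Model

/-! ### Point patterns and their first atoms -/

/-- The measures `z i j` have finitely many atoms, listed by `ω` with masses `c`. -/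
structure IsListing {ι κ Ω : Type*} [MeasurableSpace Ω] {K : ℕ} (z : ι → κ → Measure Ω)
    (ω : Fin K → Ω) (c : Fin K → ι → κ → ℕ) : Prop where
  injective : Function.Injective ω
  ne_zero : ∀ ℓ, c ℓ ≠ 0
  eq_sum : ∀ i j, z i j = ∑ ℓ, (c ℓ i j : ℝ≥0∞) • Measure.dirac (ω ℓ)

section FirstAtom

variable {ι κ Ω : Type*} [Fintype ι] [Fintype κ] [MeasurableSpace Ω]

/-- The total mass of a set. -/
def totalMass (z : ι → κ → Measure Ω) (A : Set Ω) : ℝ≥0∞ := ∑ i, ∑ j, z i j A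

lemma measurable_totalMass {A : Set Ω} (hA : MeasurableSet A) :
    Measurable fun z : ι → κ → Measure Ω => totalMass z A :=
  Finset.measurable_sum _ fun i _ => Finset.measurable_sum _ fun j _ =>
    (Measure.measurable_coe hA).comp (by fun_prop : Measurable fun z : ι → κ → Measure Ω => z i j)

/-- The position of the first atom with respect to the position function `T`. -/
def firstLoc (T : Ω → EReal) (z : ι → κ → Measure Ω) : EReal :=
  ⨅ t : ℚ, open scoped Classical in
    if totalMass z {x | T x ≤ ((t : ℝ) : EReal)} = 0 then ⊤ else ((t : ℝ) : EReal)

/-- The mass of `z i j` at the first atom. -/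
def firstMass (T : Ω → EReal) (z : ι → κ → Measure Ω) (i : ι) (j : κ) : ℝ≥0∞ :=
  ⨅ t : ℚ, open scoped Classical in
    if firstLoc T z < ((t : ℝ) : EReal) then z i j {x | T x ≤ ((t : ℝ) : EReal)} else ⊤

/-- The vector of the masses at the first atom, as natural numbers. -/
def firstCount (T : Ω → EReal) (z : ι → κ → Measure Ω) (i : ι) (j : κ) : ℕ :=
  ⌊(firstMass T z i j).toReal⌋₊

/-- The pattern without its first atom. -/
def restPattern (T : Ω → EReal) (z : ι → κ → Measure Ω) (i : ι) (j : κ) : Measure Ω :=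
  (z i j).restrict {x | firstLoc T z < T x}

variable {T : Ω → EReal}

/-- Thresholds are rational, so the location is a countable infimum of measurable functions of the
pattern. -/
lemma measurable_firstLoc (hT : Measurable T) :
    Measurable (firstLoc T : (ι → κ → Measure Ω) → EReal) := by
  classical
  refine Measurable.iInf fun t => ?_
  refine Measurable.ite ?_ measurable_const measurable_const
  exact measurable_totalMass (measurableSet_le hT measurable_const) (measurableSet_singleton 0)

lemma measurable_firstMass (hT : Measurable T) (i : ι) (j : κ) :
    Measurable fun z : ι → κ → Measure Ω => firstMass T z i j := by
  classical
  refine Measurable.iInf fun t => ?_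
  refine Measurable.ite (measurableSet_lt (measurable_firstLoc hT) measurable_const) ?_
    measurable_const
  exact (Measure.measurable_coe (measurableSet_le hT measurable_const)).comp
    (by fun_prop : Measurable fun z : ι → κ → Measure Ω => z i j)

lemma measurable_firstCount (hT : Measurable T) :
    Measurable (firstCount T : (ι → κ → Measure Ω) → ι → κ → ℕ) :=
  measurable_pi_iff.mpr fun i => measurable_pi_iff.mpr fun j =>
    Nat.measurable_floor.comp (measurable_firstMass hT i j).ennreal_toReal

/-- The set removed depends on the pattern. What is left is a directed union of the fixed sets `{t ≤
T}` over rationals `t` above the first location, so its mass is a countable supremum. -/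
lemma measurable_restPattern (hT : Measurable T) :
    Measurable (restPattern T : (ι → κ → Measure Ω) → ι → κ → Measure Ω) := by
  classical
  refine measurable_pi_iff.mpr fun i => measurable_pi_iff.mpr fun j => ?_
  refine Measure.measurable_of_measurable_coe _ fun A hA => ?_
  have hs : ∀ t : ℚ, MeasurableSet {x | ((t : ℝ) : EReal) ≤ T x} := fun t =>
    measurableSet_le measurable_const hT
  have heq : ∀ z : ι → κ → Measure Ω, restPattern T z i j A =
      ⨆ t : ℚ, if firstLoc T z < ((t : ℝ) : EReal) then
        z i j (A ∩ {x | ((t : ℝ) : EReal) ≤ T x}) else 0 := by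
    intro z
    rw [restPattern, Measure.restrict_apply hA]
    have hU : A ∩ {x | firstLoc T z < T x} =
        ⋃ t : ℚ, if firstLoc T z < ((t : ℝ) : EReal) then
          A ∩ {x | ((t : ℝ) : EReal) ≤ T x} else ∅ := by
      ext x
      simp only [Set.mem_inter_iff, Set.mem_ofPred_eq, Set.mem_iUnion]
      constructor
      · rintro ⟨hxA, hx⟩
        obtain ⟨t, ht1, ht2⟩ := EReal.lt_iff_exists_rat_btwn.mp hx
        exact ⟨t, by rw [if_pos ht1]; exact ⟨hxA, ht2.le⟩⟩
      · rintro ⟨t, ht⟩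
        split_ifs at ht with h
        · exact ⟨ht.1, h.trans_le ht.2⟩
        · exact ht.elim
    rw [hU, Directed.measure_iUnion]
    · refine iSup_congr fun t => ?_
      split_ifs <;> simp
    · intro s t
      by_cases h1 : firstLoc T z < ((s : ℝ) : EReal)
      · by_cases h2 : firstLoc T z < ((t : ℝ) : EReal)
        · rcases le_total s t with hst | hst
          · refine ⟨s, subset_rfl, ?_⟩
            simp only [if_pos h1, if_pos h2]
            refine Set.inter_subset_inter_right _ fun x hx => ?_
            exact le_trans (show ((s : ℝ) : EReal) ≤ ((t : ℝ) : EReal) by exact_mod_cast hst) hx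
          · refine ⟨t, ?_, subset_rfl⟩
            simp only [if_pos h1, if_pos h2]
            refine Set.inter_subset_inter_right _ fun x hx => ?_
            exact le_trans (show ((t : ℝ) : EReal) ≤ ((s : ℝ) : EReal) by exact_mod_cast hst) hx
        · exact ⟨s, subset_rfl, by simp only [if_neg h2]; exact Set.empty_subset _⟩
      · exact ⟨t, by simp only [if_neg h1]; exact Set.empty_subset _, subset_rfl⟩
  simp_rw [heq]
  refine Measurable.iSup fun t => ?_
  refine Measurable.ite (measurableSet_lt (measurable_firstLoc hT) measurable_const) ?_
    measurable_const
  exact (Measure.measurable_coe (hA.inter (hs t))).comp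
    (by fun_prop : Measurable fun z : ι → κ → Measure Ω => z i j)

/-! #### Computation of the first atom of a listed pattern -/

variable {K : ℕ} {z : ι → κ → Measure Ω} {ω : Fin K → Ω} {c : Fin K → ι → κ → ℕ}

omit [Fintype ι] [Fintype κ] in
lemma IsListing.apply (h : IsListing z ω c) (i : ι) (j : κ) {A : Set Ω} (hA : MeasurableSet A) :
    z i j A = ∑ ℓ, (c ℓ i j : ℝ≥0∞) * A.indicator 1 (ω ℓ) := by
  rw [h.eq_sum i j]
  simp [Measure.finsetSum_apply, Measure.dirac_apply' _ hA]

lemma IsListing.totalMass_ne_zero (h : IsListing z ω c) {A : Set Ω} (hA : MeasurableSet A) :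
    totalMass z A ≠ 0 ↔ ∃ ℓ, ω ℓ ∈ A := by
  constructor
  · intro hne
    by_contra! hnot
    exact hne (by simp [totalMass, h.apply _ _ hA, hnot])
  · rintro ⟨ℓ, hℓ⟩ h0
    simp only [totalMass, Finset.sum_eq_zero_iff, Finset.mem_univ, true_imp_iff, h.apply _ _ hA,
      mul_eq_zero, Nat.cast_eq_zero] at h0
    refine h.ne_zero ℓ (funext fun i => funext fun j => ?_)
    simpa [hℓ] using h0 i j ℓ

/-- Every listed atom has total mass at least one. So the number of atoms is bounded by a measurable
function of the pattern, which fixes how often the first atom has to be removed. -/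
lemma IsListing.le_totalMass (h : IsListing z ω c) : (K : ℝ≥0∞) ≤ totalMass z Set.univ := by
  have h1 : ∀ ℓ, (1 : ℝ≥0∞) ≤ ∑ i, ∑ j, (c ℓ i j : ℝ≥0∞) := by
    intro ℓ
    have : ∑ i, ∑ j, c ℓ i j ≠ 0 := by
      intro h0
      simp only [Finset.sum_eq_zero_iff, Finset.mem_univ, true_imp_iff] at h0
      exact h.ne_zero ℓ (funext fun i => funext fun j => h0 i j)
    exact_mod_cast Nat.one_le_iff_ne_zero.mpr this
  calc (K : ℝ≥0∞) = ∑ ℓ : Fin K, 1 := by simp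
    _ ≤ ∑ ℓ, ∑ i, ∑ j, (c ℓ i j : ℝ≥0∞) := Finset.sum_le_sum fun ℓ _ => h1 ℓ
    _ = totalMass z Set.univ := by
      simp only [totalMass, h.apply _ _ .univ]
      rw [Finset.sum_comm]
      refine Finset.sum_congr rfl fun i _ => ?_
      rw [Finset.sum_comm]
      simp

lemma IsListing.totalMass_ne_top (h : IsListing z ω c) (A : Set Ω) : totalMass z A ≠ ∞ := by
  refine ENNReal.sum_ne_top.mpr fun i _ => ENNReal.sum_ne_top.mpr fun j _ => ?_
  refine ne_top_of_le_ne_top ?_ (measure_mono (Set.subset_univ A))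
  rw [h.apply i j .univ]
  exact ENNReal.sum_ne_top.mpr fun ℓ _ => by simp

lemma IsListing.firstLoc_eq (hT : Measurable T) (h : IsListing z ω c) {ℓ₀ : Fin K}
    (hmin : ∀ ℓ, T (ω ℓ₀) ≤ T (ω ℓ)) : firstLoc T z = T (ω ℓ₀) := by
  classical
  have hm : ∀ t : ℚ, MeasurableSet {x | T x ≤ ((t : ℝ) : EReal)} := fun t =>
    measurableSet_le hT measurable_const
  refine le_antisymm ?_ (le_iInf fun t => ?_)
  · refine le_of_forall_gt fun r hr => ?_
    obtain ⟨t, ht1, ht2⟩ := EReal.lt_iff_exists_rat_btwn.mp hr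
    refine lt_of_le_of_lt (iInf_le _ t) ?_
    rw [if_neg ((h.totalMass_ne_zero (hm t)).mpr ⟨ℓ₀, ht1.le⟩)]
    exact ht2
  · split_ifs with h0
    · exact le_top
    · obtain ⟨ℓ, hℓ⟩ := (h.totalMass_ne_zero (hm t)).mp h0
      exact (hmin ℓ).trans hℓ

lemma IsListing.firstCount_eq (hT : Measurable T) (hTinj : Function.Injective T)
    (hTtop : ∀ x, T x ≠ ⊤) (h : IsListing z ω c) {ℓ₀ : Fin K}
    (hmin : ∀ ℓ, T (ω ℓ₀) ≤ T (ω ℓ)) : firstCount T z = c ℓ₀ := by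
  classical
  have hm : ∀ t : ℚ, MeasurableSet {x | T x ≤ ((t : ℝ) : EReal)} := fun t =>
    measurableSet_le hT measurable_const
  -- A rational strictly between the first and second locations isolates the first atom. With a
  -- single atom the infimum is `⊤`, which is why `T` must avoid `⊤`.
  have hlt : T (ω ℓ₀) < (Finset.univ.erase ℓ₀).inf fun ℓ => T (ω ℓ) := by
    rw [Finset.lt_inf_iff (lt_top_iff_ne_top.mpr (hTtop _))]
    intro ℓ hℓ
    refine lt_of_le_of_ne (hmin ℓ) fun he => ?_
    exact (Finset.ne_of_mem_erase hℓ) (h.injective (hTinj he)).symm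
  obtain ⟨t₀, ht1, ht2⟩ := EReal.lt_iff_exists_rat_btwn.mp hlt
  funext i j
  have : firstMass T z i j = c ℓ₀ i j := by
    rw [firstMass, h.firstLoc_eq hT hmin]
    refine le_antisymm ((iInf_le _ t₀).trans ?_) (le_iInf fun t => ?_)
    · rw [if_pos ht1, h.apply i j (hm t₀), Finset.sum_eq_single ℓ₀]
      · exact mul_le_of_le_one_right zero_le (Set.indicator_le_self' (by simp) _)
      · intro ℓ _ hℓ
        have : ¬ T (ω ℓ) ≤ ((t₀ : ℝ) : EReal) := not_le.mpr
          (ht2.trans_le (Finset.inf_le (Finset.mem_erase.mpr ⟨hℓ, Finset.mem_univ ℓ⟩)))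
        simp [this]
      · simp
    · split_ifs with ht
      · rw [h.apply i j (hm t)]
        refine le_trans ?_ (Finset.single_le_sum (fun _ _ => zero_le) (Finset.mem_univ ℓ₀))
        simp [ht.le]
      · exact le_top
  simp [firstCount, this]

lemma IsListing.restPattern {z : ι → κ → Measure Ω} {ω : Fin (K + 1) → Ω}
    {c : Fin (K + 1) → ι → κ → ℕ} (hT : Measurable T) (hTinj : Function.Injective T)
    (h : IsListing z ω c) {ℓ₀ : Fin (K + 1)}
    (hmin : ∀ ℓ, T (ω ℓ₀) ≤ T (ω ℓ)) :
    IsListing (restPattern T z) (fun ℓ => ω (ℓ₀.succAbove ℓ)) (fun ℓ => c (ℓ₀.succAbove ℓ)) := by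
  refine ⟨h.injective.comp Fin.succAbove_right_injective, fun ℓ => h.ne_zero _, fun i j => ?_⟩
  have hm : MeasurableSet {x | T (ω ℓ₀) < T x} := measurableSet_lt measurable_const hT
  ext A hA
  rw [MultinomialIBP.restPattern, Measure.restrict_apply hA, h.firstLoc_eq hT hmin,
    h.apply i j (hA.inter hm), Fin.sum_univ_succAbove _ ℓ₀]
  have h0 : (A ∩ {x | T (ω ℓ₀) < T x}).indicator (1 : Ω → ℝ≥0∞) (ω ℓ₀) = 0 := by simp
  rw [h0, mul_zero, zero_add, Measure.finsetSum_apply]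
  refine Finset.sum_congr rfl fun ℓ _ => ?_
  have hlt : T (ω ℓ₀) < T (ω (ℓ₀.succAbove ℓ)) := by
    refine lt_of_le_of_ne (hmin _) fun he => ?_
    exact Fin.succAbove_ne ℓ₀ ℓ (h.injective (hTinj he)).symm
  by_cases hωA : ω (ℓ₀.succAbove ℓ) ∈ A <;> simp [Measure.dirac_apply' _ hA, hωA, hlt]

end FirstAtom

/-! ### The posterior kernel -/

section PosteriorKernel

variable {ι κ Ω D : Type*} [Fintype ι] [Fintype κ] [MeasurableSpace Ω] [MeasurableSpace D]

/-- The law of `m + δ_(d, ω)` when `m` and `d` are independent with laws `μ` and `ν`. -/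
def addPoint (μ : Measure (Measure (D × Ω))) (ν : Measure D) (ω : Ω) : Measure (Measure (D × Ω)) :=
  (μ.prod ν).map fun x => x.1 + Measure.dirac (x.2, ω)

lemma measurable_add_dirac :
    Measurable fun x : (Measure (D × Ω) × D) × Ω => x.1.1 + Measure.dirac (x.1.2, x.2) := by
  have : Measurable fun x : (Measure (D × Ω) × D) × Ω => Measure.dirac (x.1.2, x.2) :=
    Measure.measurable_dirac.comp (by fun_prop)
  exact (by fun_prop : Measurable fun x : (Measure (D × Ω) × D) × Ω => x.1.1).add this

lemma lintegral_expNeg_addPoint (μ : Measure (Measure (D × Ω))) [SFinite μ] (ν : Measure D)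
    [SFinite ν] (ω : Ω) {f : D × Ω → ℝ≥0∞} (hf : Measurable f) :
    ∫⁻ m, expNeg (∫⁻ e, f e ∂m) ∂addPoint μ ν ω =
      (∫⁻ m, expNeg (∫⁻ e, f e ∂m) ∂μ) * ∫⁻ d, expNeg (f (d, ω)) ∂ν := by
  have hm : Measurable fun x : Measure (D × Ω) × D => x.1 + Measure.dirac (x.2, ω) :=
    measurable_add_dirac.comp (measurable_id.prodMk measurable_const)
  have hL : Measurable fun m : Measure (D × Ω) => expNeg (∫⁻ e, f e ∂m) :=
    measurable_expNeg.comp (Measure.measurable_lintegral hf)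
  have hfω : Measurable fun d => expNeg (f (d, ω)) :=
    measurable_expNeg.comp (hf.comp (by fun_prop))
  rw [addPoint, lintegral_map hL hm, ← lintegral_prod_mul hL.aemeasurable hfω.aemeasurable]
  refine lintegral_congr fun x => ?_
  rw [lintegral_add_measure, lintegral_dirac' _ hf, expNeg_add]

/-- The law of `m + ∑ ℓ, δ_(d ℓ, ω ℓ)` when `m` and the `d ℓ` are independent with laws `μ` and
`ν ℓ`. -/
def addPoints {K : ℕ} (μ : Measure (Measure (D × Ω))) (ν : Fin K → Measure D) (ω : Fin K → Ω) :
    Measure (Measure (D × Ω)) :=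
  (μ.prod (Measure.pi ν)).map fun x => x.1 + ∑ ℓ, Measure.dirac (x.2 ℓ, ω ℓ)

lemma measurable_add_sum_dirac {K : ℕ} (ω : Fin K → Ω) :
    Measurable fun x : Measure (D × Ω) × (Fin K → D) =>
      x.1 + ∑ ℓ, Measure.dirac (x.2 ℓ, ω ℓ) := by
  refine Measure.measurable_of_measurable_coe _ fun A hA => ?_
  simp only [Measure.add_apply, Measure.finsetSum_apply]
  refine ((Measure.measurable_coe hA).comp measurable_fst).add
    (Finset.measurable_sum _ fun ℓ _ => ?_)
  exact (Measure.measurable_coe hA).comp (Measure.measurable_dirac.comp (by fun_prop))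

lemma lintegral_expNeg_addPoints {K : ℕ} (μ : Measure (Measure (D × Ω))) [SFinite μ]
    (ν : Fin K → Measure D) [∀ ℓ, IsProbabilityMeasure (ν ℓ)] (ω : Fin K → Ω)
    {f : D × Ω → ℝ≥0∞} (hf : Measurable f) :
    ∫⁻ m, expNeg (∫⁻ e, f e ∂m) ∂addPoints μ ν ω =
      (∫⁻ m, expNeg (∫⁻ e, f e ∂m) ∂μ) * ∏ ℓ, ∫⁻ d, expNeg (f (d, ω ℓ)) ∂ν ℓ := by
  have hL : Measurable fun m : Measure (D × Ω) => expNeg (∫⁻ e, f e ∂m) :=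
    measurable_expNeg.comp (Measure.measurable_lintegral hf)
  have hfω : ∀ ℓ, Measurable fun d => expNeg (f (d, ω ℓ)) := fun ℓ =>
    measurable_expNeg.comp (hf.comp (by fun_prop))
  rw [addPoints, lintegral_map hL (measurable_add_sum_dirac ω), ← lintegral_pi_prod ν hfω,
    ← lintegral_prod_mul (g := fun y : Fin K → D => ∏ ℓ, expNeg (f (y ℓ, ω ℓ))) hL.aemeasurable
      (Finset.measurable_prod _ fun ℓ _ => (hfω ℓ).comp (measurable_pi_apply ℓ)).aemeasurable]
  refine lintegral_congr fun x => ?_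
  rw [lintegral_add_measure, lintegral_finsetSum_measure, expNeg_add, expNeg_sum]
  simp_rw [lintegral_dirac' _ hf]

variable {T : Ω → EReal} (hT : Measurable T) {pt : EReal → Ω} (hpt : Measurable pt)
  (Q : Measure (Measure (D × Ω))) [IsProbabilityMeasure Q]
  (J : Kernel (Ω × (ι → κ → ℕ)) D) [IsMarkovKernel J]

open scoped Classical in
/-- The posterior kernel for patterns with at most `k` atoms, built by adding a point with law `J`
at the first atom and treating the remaining atoms in the same way. -/
def posteriorAux : ℕ → Kernel (ι → κ → Measure Ω) (Measure (D × Ω))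
  | 0 => Kernel.const _ Q
  | k + 1 => Kernel.piecewise
      (measurable_totalMass (ι := ι) (κ := κ) (Ω := Ω) .univ (measurableSet_singleton (0 : ℝ≥0∞)))
      (Kernel.const _ Q)
      (((((posteriorAux k).comap (restPattern T) (measurable_restPattern hT)) ×ₖ
        J.comap (fun z => (pt (firstLoc T z), firstCount T z))
          ((hpt.comp (measurable_firstLoc hT)).prodMk (measurable_firstCount hT))) ×ₖ
        Kernel.deterministic (fun z => pt (firstLoc T z)) (hpt.comp (measurable_firstLoc hT))).map
          fun x => x.1.1 + Measure.dirac (x.1.2, x.2))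

instance isMarkovKernel_posteriorAux (k : ℕ) : IsMarkovKernel (posteriorAux hT hpt Q J k) := by
  classical
  induction k with
  | zero => unfold posteriorAux; infer_instance
  | succ k ih =>
    unfold posteriorAux
    have := Kernel.IsMarkovKernel.map (((((posteriorAux hT hpt Q J k).comap (restPattern T)
      (measurable_restPattern hT)) ×ₖ
        J.comap (fun z => (pt (firstLoc T z), firstCount T z))
          ((hpt.comp (measurable_firstLoc hT)).prodMk (measurable_firstCount hT))) ×ₖ
        Kernel.deterministic (fun z => pt (firstLoc T z)) (hpt.comp (measurable_firstLoc hT))))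
      (measurable_add_dirac (Ω := Ω) (D := D))
    infer_instance

lemma posteriorAux_succ_apply (k : ℕ) {z : ι → κ → Measure Ω} (hz : totalMass z Set.univ ≠ 0) :
    posteriorAux hT hpt Q J (k + 1) z =
      addPoint (posteriorAux hT hpt Q J k (restPattern T z))
        (J (pt (firstLoc T z), firstCount T z)) (pt (firstLoc T z)) := by
  classical
  rw [posteriorAux, Kernel.piecewise_apply, if_neg (by simpa using hz),
    Kernel.map_apply _ measurable_add_dirac, Kernel.prod_apply, Kernel.prod_apply,
    Kernel.deterministic_apply, Kernel.comap_apply, Kernel.comap_apply, Measure.prod_dirac,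
    Measure.map_map measurable_add_dirac (by fun_prop)]
  rfl

omit [IsProbabilityMeasure Q] [IsMarkovKernel J] in
lemma posteriorAux_apply_of_zero (k : ℕ) {z : ι → κ → Measure Ω}
    (hz : totalMass z Set.univ = 0) : posteriorAux hT hpt Q J k z = Q := by
  classical
  cases k with
  | zero => simp [posteriorAux]
  | succ k => rw [posteriorAux, Kernel.piecewise_apply, if_pos (by simpa using hz)]; simp

/-- Induction on the number of atoms, each step removing the leftmost one and producing its factor.
The depth `k` need only be at least `K`, because the recursion returns `Q` once the pattern is
empty. The product is symmetric, so the order of removal leaves no trace. -/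
lemma posteriorAux_laplace (hTinj : Function.Injective T) (hTtop : ∀ x, T x ≠ ⊤)
    (hpt_left : ∀ x, pt (T x) = x) {f : D × Ω → ℝ≥0∞} (hf : Measurable f) {K : ℕ} :
    ∀ {k : ℕ} {z : ι → κ → Measure Ω} {ω : Fin K → Ω} {c : Fin K → ι → κ → ℕ},
      IsListing z ω c → K ≤ k →
      ∫⁻ m, expNeg (∫⁻ e, f e ∂m) ∂posteriorAux hT hpt Q J k z =
        (∫⁻ m, expNeg (∫⁻ e, f e ∂m) ∂Q) * ∏ ℓ, ∫⁻ d, expNeg (f (d, ω ℓ)) ∂J (ω ℓ, c ℓ) := by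
  induction K with
  | zero =>
    intro k z ω c h _
    rw [posteriorAux_apply_of_zero]
    · simp
    · by_contra h0
      obtain ⟨ℓ, -⟩ := (h.totalMass_ne_zero .univ).mp h0
      exact ℓ.elim0
  | succ K ih =>
    intro k z ω c h hk
    obtain ⟨k, rfl⟩ : ∃ k', k = k' + 1 := ⟨k - 1, by omega⟩
    obtain ⟨ℓ₀, -, hmin⟩ := Finset.exists_min_image Finset.univ (fun ℓ => T (ω ℓ))
      Finset.univ_nonempty
    replace hmin : ∀ ℓ, T (ω ℓ₀) ≤ T (ω ℓ) := fun ℓ => hmin ℓ (Finset.mem_univ ℓ)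
    rw [posteriorAux_succ_apply hT hpt Q J k
        ((h.totalMass_ne_zero .univ).mpr ⟨ℓ₀, Set.mem_univ _⟩),
      lintegral_expNeg_addPoint _ _ _ hf, ih (h.restPattern hT hTinj hmin) (by omega),
      h.firstLoc_eq hT hmin, hpt_left, h.firstCount_eq hT hTinj hTtop hmin,
      Fin.prod_univ_succAbove _ ℓ₀]
    ring

/-- There is a kernel which maps a pattern listed by `ω` and `c` to the law of
`m + ∑ ℓ, δ_(d ℓ, ω ℓ)`, where `m` and the `d ℓ` are independent with laws `Q` and
`J (ω ℓ, c ℓ)`. -/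
theorem exists_posteriorKernel [StandardBorelSpace Ω] [Nonempty Ω] :
    ∃ post : Kernel (ι → κ → Measure Ω) (Measure (D × Ω)), IsMarkovKernel post ∧
      ∀ {K : ℕ} {z : ι → κ → Measure Ω} {ω : Fin K → Ω} {c : Fin K → ι → κ → ℕ},
        IsListing z ω c → post z = addPoints Q (fun ℓ => J (ω ℓ, c ℓ)) ω := by
  -- A standard Borel space embeds measurably in the line. This orders the atoms, and the measurable
  -- left inverse `pt` recovers a label from its location.
  let T : Ω → EReal := fun x => (embeddingReal Ω x : EReal)
  have hemb : MeasurableEmbedding T :=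
    EReal.isOpenEmbedding_coe.measurableEmbedding.comp (measurableEmbedding_embeddingReal Ω)
  obtain ⟨pt, hpt, hpt_left⟩ := hemb.exists_measurable_extend measurable_id fun _ => ‹Nonempty Ω›
  have hT := hemb.measurable
  let aux : Kernel (ℕ × (ι → κ → Measure Ω)) (Measure (D × Ω)) :=
    { toFun := fun x => posteriorAux hT hpt Q J x.1 x.2
      measurable' := measurable_from_prod_countable_right fun k =>
        (posteriorAux hT hpt Q J k).measurable }
  have : IsMarkovKernel aux := ⟨fun x =>
    (inferInstance : IsProbabilityMeasure (posteriorAux hT hpt Q J x.1 x.2))⟩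
  -- The recursion depth is chosen as a measurable function of the pattern that dominates the number
  -- of its atoms.
  have hfloor : Measurable fun z : ι → κ → Measure Ω => ⌊(totalMass z Set.univ).toReal⌋₊ :=
    Nat.measurable_floor.comp (measurable_totalMass .univ).ennreal_toReal
  refine ⟨aux.comap (fun z => (⌊(totalMass z Set.univ).toReal⌋₊, z)) (hfloor.prodMk measurable_id),
    inferInstance, fun {K z ω c} h => ?_⟩
  rw [Kernel.comap_apply]
  change posteriorAux hT hpt Q J ⌊(totalMass z Set.univ).toReal⌋₊ z = _
  have hK : K ≤ ⌊(totalMass z Set.univ).toReal⌋₊ := by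
    refine Nat.le_floor ?_
    have := ENNReal.toReal_mono (h.totalMass_ne_top Set.univ) h.le_totalMass
    simpa using this
  have : IsProbabilityMeasure (addPoints Q (fun ℓ => J (ω ℓ, c ℓ)) ω) :=
    Measure.isProbabilityMeasure_map (measurable_add_sum_dirac ω).aemeasurable
  refine randomMeasure_ext fun f hf => ?_
  rw [posteriorAux_laplace hT hpt Q J hemb.injective (fun x => EReal.coe_ne_top _)
    (fun x => congrFun hpt_left x) hf h hK, lintegral_expNeg_addPoints Q _ ω hf]

end PosteriorKernel

/-! ### Sums of Dirac measures over a random set of indices -/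

section ActiveSum

variable {𝒲 E : Type*} [MeasurableSpace E]

/-- The random measure with atoms at the points `e k` with index in the random set
`{k | w ∈ S k}`. -/
def activeSum (S : ℕ → Set 𝒲) (e : ℕ → 𝒲 → E) (w : 𝒲) : Measure E :=
  open scoped Classical in Measure.sum fun k => if w ∈ S k then Measure.dirac (e k w) else 0

open scoped Classical in
lemma lintegral_activeSum (S : ℕ → Set 𝒲) (e : ℕ → 𝒲 → E) (w : 𝒲) {f : E → ℝ≥0∞}
    (hf : Measurable f) :
    ∫⁻ x, f x ∂activeSum S e w = ∑' k, if w ∈ S k then f (e k w) else 0 := by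
  rw [activeSum, lintegral_sum_measure]
  refine tsum_congr fun k => ?_
  split_ifs
  · exact lintegral_dirac' _ hf
  · simp

lemma measurable_activeSum [MeasurableSpace 𝒲] {S : ℕ → Set 𝒲} (hS : ∀ k, MeasurableSet (S k))
    {e : ℕ → 𝒲 → E} (he : ∀ k, Measurable (e k)) : Measurable (activeSum S e) := by
  classical
  refine Measure.measurable_of_measurable_coe _ fun A hA => ?_
  simp_rw [← lintegral_indicator_one hA,
    fun w => lintegral_activeSum S e w (measurable_one.indicator hA)]
  exact Measurable.tsum fun k =>
    Measurable.ite (hS k) ((measurable_one.indicator hA).comp (he k)) measurable_const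

end ActiveSum

/-! ### The abstract posterior theorem -/

section AbstractPosterior

variable {𝒲 ι κ Ω D : Type*} [Fintype ι] [Fintype κ] [MeasurableSpace 𝒲] [MeasurableSpace Ω]
  [MeasurableSpace D]

/-- The measures `∑ₖ c k i j • δ_(θ k)`. -/
def countPattern (θ : ℕ → 𝒲 → Ω) (c : ℕ → 𝒲 → ι → κ → ℕ) (w : 𝒲) (i : ι) (j : κ) : Measure Ω :=
  Measure.sum fun k => (c k w i j : ℝ≥0∞) • Measure.dirac (θ k w)

omit [Fintype ι] [Fintype κ] [MeasurableSpace 𝒲] in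
lemma lintegral_countPattern (θ : ℕ → 𝒲 → Ω) (c : ℕ → 𝒲 → ι → κ → ℕ) (w : 𝒲) (i : ι) (j : κ)
    {g : Ω → ℝ≥0∞} (hg : Measurable g) :
    ∫⁻ x, g x ∂countPattern θ c w i j = ∑' k, (c k w i j : ℝ≥0∞) * g (θ k w) := by
  rw [countPattern, lintegral_sum_measure]
  simp_rw [lintegral_smul_measure, lintegral_dirac' _ hg, smul_eq_mul]

omit [Fintype ι] [Fintype κ] in
lemma measurable_countPattern {θ : ℕ → 𝒲 → Ω} (hθ : ∀ k, Measurable (θ k))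
    {c : ℕ → 𝒲 → ι → κ → ℕ} (hc : ∀ k, Measurable (c k)) : Measurable (countPattern θ c) := by
  refine measurable_pi_iff.mpr fun i => measurable_pi_iff.mpr fun j =>
    Measure.measurable_of_measurable_coe _ fun A hA => ?_
  simp_rw [← lintegral_indicator_one hA,
    fun w => lintegral_countPattern θ c w i j (measurable_one.indicator hA)]
  refine Measurable.tsum fun k => Measurable.mul ?_ ((measurable_one.indicator hA).comp (hθ k))
  exact (measurable_from_top : Measurable fun n : ℕ => (n : ℝ≥0∞)).comp
    ((measurable_pi_apply j).comp ((measurable_pi_apply i).comp (hc k)))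

/-- The pattern at `w` has finitely many points, with distinct labels. -/
def IsSimpleAt (θ : ℕ → 𝒲 → Ω) (c : ℕ → 𝒲 → ι → κ → ℕ) (w : 𝒲) : Prop :=
  {k | c k w ≠ 0}.Finite ∧ Set.InjOn (fun k => θ k w) {k | c k w ≠ 0}

omit [Fintype ι] [Fintype κ] [MeasurableSpace 𝒲] in
lemma IsSimpleAt.exists_listing {θ : ℕ → 𝒲 → Ω} {c : ℕ → 𝒲 → ι → κ → ℕ} {w : 𝒲}
    (h : IsSimpleAt θ c w) : ∃ (K : ℕ) (k : Fin K → ℕ), Function.Injective k ∧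
      Set.range k = {k | c k w ≠ 0} ∧
      IsListing (countPattern θ c w) (fun ℓ => θ (k ℓ) w) (fun ℓ => c (k ℓ) w) := by
  classical
  obtain ⟨hfin, hinj⟩ := h
  let e : Fin hfin.toFinset.card ≃ hfin.toFinset := hfin.toFinset.equivFin.symm
  have hmem : ∀ ℓ, c (e ℓ) w ≠ 0 := fun ℓ => hfin.mem_toFinset.mp (e ℓ).2
  have hk : Function.Injective fun ℓ => (e ℓ : ℕ) := Subtype.val_injective.comp e.injective
  refine ⟨_, fun ℓ => e ℓ, hk, ?_, ⟨?_, hmem, fun i j => ?_⟩⟩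
  · ext k
    constructor
    · rintro ⟨ℓ, rfl⟩
      exact hmem ℓ
    · intro hkc
      obtain ⟨ℓ, hℓ⟩ := e.surjective ⟨k, by simpa using hkc⟩
      exact ⟨ℓ, by simp [hℓ]⟩
  · intro ℓ ℓ' hℓ
    exact hk (hinj (hmem ℓ) (hmem ℓ') hℓ)
  · ext A hA
    rw [countPattern, Measure.sum_apply _ hA, tsum_eq_sum (s := hfin.toFinset),
      ← Finset.sum_coe_sort, ← Equiv.sum_comp e, Measure.finsetSum_apply]
    intro k hk
    have : c k w = 0 := by simpa using hk
    simp [this]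

variable {P : Measure 𝒲} {d : ℕ → 𝒲 → D} {θ : ℕ → 𝒲 → Ω}
  {c : ℕ → 𝒲 → ι → κ → ℕ} {S : ℕ → Set 𝒲} {Λ : Measure ((D × Ω) × (ι → κ → ℕ))}

open scoped Classical in
/-- The points `(d k, θ k, c k)` with index in `{k | w ∈ S k}` form a Poisson point process with
intensity `Λ`; each point with `c k ≠ 0` belongs to it, there are finitely many such points, and
they have distinct labels. -/
structure IsMarkedPoisson (P : Measure 𝒲) (d : ℕ → 𝒲 → D) (θ : ℕ → 𝒲 → Ω)
    (c : ℕ → 𝒲 → ι → κ → ℕ) (S : ℕ → Set 𝒲) (Λ : Measure ((D × Ω) × (ι → κ → ℕ))) : Prop where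
  measurable_d : ∀ k, Measurable (d k)
  measurable_θ : ∀ k, Measurable (θ k)
  measurable_c : ∀ k, Measurable (c k)
  measurableSet_S : ∀ k, MeasurableSet (S k)
  mem_of_ne_zero : ∀ᵐ w ∂P, ∀ k, c k w ≠ 0 → w ∈ S k
  simple : ∀ᵐ w ∂P, IsSimpleAt θ c w
  laplace : ∀ F : (D × Ω) × (ι → κ → ℕ) → ℝ≥0∞, Measurable F →
    ∫⁻ w, expNeg (∑' k, if w ∈ S k then F ((d k w, θ k w), c k w) else 0) ∂P =
      expNeg (∫⁻ x, (1 - expNeg (F x)) ∂Λ)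

/-- The point process of the unmarked points. -/
def unmarked (d : ℕ → 𝒲 → D) (θ : ℕ → 𝒲 → Ω) (c : ℕ → 𝒲 → ι → κ → ℕ) (S : ℕ → Set 𝒲) :
    𝒲 → Measure (D × Ω) :=
  activeSum (fun k => S k ∩ {w | c k w = 0}) fun k w => (d k w, θ k w)

lemma measurableSet_eq_zero (h : IsMarkedPoisson P d θ c S Λ) (k : ℕ) :
    MeasurableSet {w | c k w = 0} :=
  h.measurable_c k (measurableSet_singleton 0)

lemma IsMarkedPoisson.measurable_unmarked (h : IsMarkedPoisson P d θ c S Λ) :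
    Measurable (unmarked d θ c S) :=
  measurable_activeSum (fun k => (h.measurableSet_S k).inter (measurableSet_eq_zero h k))
    fun k => (h.measurable_d k).prodMk (h.measurable_θ k)

/-- Restriction theorem for Poisson processes: use a test function that vanishes off mark zero. -/
lemma IsMarkedPoisson.laplace_unmarked (h : IsMarkedPoisson P d θ c S Λ) {f : D × Ω → ℝ≥0∞}
    (hf : Measurable f) :
    ∫⁻ w, expNeg (∫⁻ x, f x ∂unmarked d θ c S w) ∂P =
      expNeg (∫⁻ x in {x | x.2 = 0}, (1 - expNeg (f x.1)) ∂Λ) := by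
  classical
  have hs : MeasurableSet {x : (D × Ω) × (ι → κ → ℕ) | x.2 = 0} :=
    measurable_snd (measurableSet_singleton 0)
  have := h.laplace (fun x => {x : (D × Ω) × (ι → κ → ℕ) | x.2 = 0}.indicator (fun x => f x.1) x)
    ((hf.comp measurable_fst).indicator hs)
  rw [← lintegral_indicator hs]
  convert this using 3 with w x
  · rw [unmarked, lintegral_activeSum _ _ _ hf]
    congr 1
    refine tsum_congr fun k => ?_
    by_cases h1 : w ∈ S k <;> by_cases h2 : c k w = 0 <;> simp [h1, h2]
  · ext x
    by_cases hx : x.2 = 0 <;> simp [hx]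

/-- The conditional law of a marked Poisson process given the pattern of its marks. -/
theorem IsMarkedPoisson.exists_posterior [IsProbabilityMeasure P] [StandardBorelSpace Ω] [Nonempty Ω]
    (h : IsMarkedPoisson P d θ c S Λ) (J : Kernel (Ω × (ι → κ → ℕ)) D) [IsMarkovKernel J]
    (hJ : ∀ g : (D × Ω) × (ι → κ → ℕ) → ℝ≥0∞, Measurable g →
      ∫⁻ x in {x | x.2 ≠ 0}, g x ∂Λ =
        ∫⁻ x in {x | x.2 ≠ 0}, ∫⁻ d', g ((d', x.1.2), x.2) ∂J (x.1.2, x.2) ∂Λ) :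
    ∃ post : Kernel (ι → κ → Measure Ω) (Measure (D × Ω)), IsMarkovKernel post ∧
      HasCondDistrib (activeSum S fun k w => (d k w, θ k w)) (countPattern θ c) post P ∧
      ∀ {K : ℕ} {z : ι → κ → Measure Ω} {ω : Fin K → Ω} {c' : Fin K → ι → κ → ℕ},
        IsListing z ω c' →
          post z = addPoints (P.map (unmarked d θ c S)) (fun ℓ => J (ω ℓ, c' ℓ)) ω := by
  classical
  have hQ : IsProbabilityMeasure (P.map (unmarked d θ c S)) :=
    Measure.isProbabilityMeasure_map h.measurable_unmarked.aemeasurable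
  obtain ⟨post, hpost, hlist⟩ := exists_posteriorKernel (P.map (unmarked d θ c S)) J
  have hZ := measurable_countPattern h.measurable_θ h.measurable_c
  have hW := measurable_activeSum h.measurableSet_S
    fun k => (h.measurable_d k).prodMk (h.measurable_θ k)
  refine ⟨post, hpost, ⟨(hZ.prodMk hW).aemeasurable, ?_⟩, hlist⟩
  have := Measure.isProbabilityMeasure_map (μ := P) hZ.aemeasurable
  have := Measure.isProbabilityMeasure_map (μ := P) (hZ.prodMk hW).aemeasurable
  refine joint_randomMeasure_ext fun g f hg hf => ?_
  have hgZ : Measurable fun z : ι → κ → Measure Ω => ∑ i, ∑ j, ∫⁻ o, g i j o ∂z i j :=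
    Finset.measurable_sum _ fun i _ => Finset.measurable_sum _ fun j _ =>
      (Measure.measurable_lintegral (hg i j)).comp
        (by fun_prop : Measurable fun z : ι → κ → Measure Ω => z i j)
  have hfW : Measurable fun m : Measure (D × Ω) => ∫⁻ e, f e ∂m := Measure.measurable_lintegral hf
  have htest : Measurable fun x : (ι → κ → Measure Ω) × Measure (D × Ω) =>
      expNeg (∑ i, ∑ j, ∫⁻ o, g i j o ∂x.1 i j + ∫⁻ e, f e ∂x.2) :=
    measurable_expNeg.comp ((hgZ.comp measurable_fst).add (hfW.comp measurable_snd))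
  -- the contribution of the marks
  let G : Ω → (ι → κ → ℕ) → ℝ≥0∞ := fun o a => ∑ i, ∑ j, (a i j : ℝ≥0∞) * g i j o
  have hG : Measurable fun x : Ω × (ι → κ → ℕ) => G x.1 x.2 := by
    refine measurable_from_prod_countable_left fun a => ?_
    exact Finset.measurable_sum _ fun i _ => Finset.measurable_sum _ fun j _ =>
      (hg i j).const_mul (a i j : ℝ≥0∞)
  have hG0 : ∀ o, G o 0 = 0 := fun o => by simp [G]
  have hGZ : ∀ w, ∑ i, ∑ j, ∫⁻ o, g i j o ∂countPattern θ c w i j =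
      ∑' k, G (θ k w) (c k w) := by
    intro w
    simp_rw [fun i j => lintegral_countPattern θ c w i j (hg i j), G]
    rw [Summable.tsum_finsetSum fun _ _ => ENNReal.summable]
    exact Finset.sum_congr rfl fun i _ => (Summable.tsum_finsetSum fun _ _ => ENNReal.summable).symm
  -- `H` is the factor that a chosen point with given label and mark contributes to the Laplace
  -- functional of the proposed posterior.
  let H : Ω × (ι → κ → ℕ) → ℝ≥0∞ := fun x => ∫⁻ d', expNeg (f (d', x.1)) ∂J x
  have hH : Measurable H := by
    refine Measurable.lintegral_kernel_prod_right'
      (f := fun y : (Ω × (ι → κ → ℕ)) × D => expNeg (f (y.2, y.1.1))) ?_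
    exact measurable_expNeg.comp (hf.comp (by fun_prop))
  have hH1 : ∀ x, H x ≤ 1 := fun x => by
    calc H x ≤ ∫⁻ _, 1 ∂J x := lintegral_mono fun _ => expNeg_le_one _
      _ = 1 := by simp
  -- `F` is chosen so that `expNeg F` is `exp (-G) · H` on chosen points and one on the others. The
  -- product over chosen points in the posterior then becomes an instance of the Laplace formula for
  -- the marked process.
  let F : (D × Ω) × (ι → κ → ℕ) → ℝ≥0∞ := fun x =>
    {x : (D × Ω) × (ι → κ → ℕ) | x.2 ≠ 0}.indicator
      (fun x => G x.1.2 x.2 + negLog (H (x.1.2, x.2))) x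
  have hs0 : MeasurableSet {x : (D × Ω) × (ι → κ → ℕ) | x.2 = 0} :=
    measurable_snd (measurableSet_singleton 0)
  have hs : MeasurableSet {x : (D × Ω) × (ι → κ → ℕ) | x.2 ≠ 0} := hs0.compl
  have hsnd : Measurable fun x : (D × Ω) × (ι → κ → ℕ) => (x.1.2, x.2) := by fun_prop
  have hF : Measurable F :=
    ((hG.comp hsnd).add (measurable_negLog.comp (hH.comp hsnd))).indicator hs
  rw [lintegral_map htest (hZ.prodMk hW), Measure.lintegral_compProd htest,
    lintegral_map (Measurable.lintegral_kernel_prod_right' htest) hZ]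
  -- the left-hand side
  have hleft : ∫⁻ w, expNeg (∑ i, ∑ j, ∫⁻ o, g i j o ∂countPattern θ c w i j +
      ∫⁻ e, f e ∂activeSum S (fun k w => (d k w, θ k w)) w) ∂P =
      expNeg (∫⁻ x, (1 - expNeg (G x.1.2 x.2 + f x.1)) ∂Λ) := by
    rw [← h.laplace (fun x => G x.1.2 x.2 + f x.1) ((hG.comp hsnd).add (hf.comp measurable_fst))]
    refine lintegral_congr_ae (h.mem_of_ne_zero.mono fun w hw => ?_)
    dsimp only
    rw [hGZ, lintegral_activeSum _ _ _ hf, ← ENNReal.tsum_add]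
    congr 1
    refine tsum_congr fun k => ?_
    by_cases hk : w ∈ S k
    · simp [hk]
    · have : c k w = 0 := by_contra fun hne => hk (hw k hne)
      simp [hk, this, hG0]
  -- the right-hand side
  have hright : ∫⁻ w, ∫⁻ m, expNeg (∑ i, ∑ j, ∫⁻ o, g i j o ∂countPattern θ c w i j +
      ∫⁻ e, f e ∂m) ∂post (countPattern θ c w) ∂P =
      expNeg (∫⁻ x in {x | x.2 = 0}, (1 - expNeg (f x.1)) ∂Λ) *
        expNeg (∫⁻ x, (1 - expNeg (F x)) ∂Λ) := by
    have hm : Measurable fun w => ∑' k, if w ∈ S k then F ((d k w, θ k w), c k w) else 0 :=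
      Measurable.tsum fun k => Measurable.ite (h.measurableSet_S k)
        (hF.comp (((h.measurable_d k).prodMk (h.measurable_θ k)).prodMk (h.measurable_c k)))
        measurable_const
    have hm' : Measurable fun w =>
        expNeg (∑' k, if w ∈ S k then F ((d k w, θ k w), c k w) else 0) := measurable_expNeg.comp hm
    have hfW' : Measurable fun m : Measure (D × Ω) => expNeg (∫⁻ e, f e ∂m) :=
      measurable_expNeg.comp hfW
    rw [← h.laplace F hF, ← lintegral_const_mul _ hm']
    refine lintegral_congr_ae ?_
    filter_upwards [h.mem_of_ne_zero, h.simple] with w hw hsimple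
    obtain ⟨K, k, hkinj, hkrange, hL⟩ := hsimple.exists_listing
    simp_rw [expNeg_add]
    rw [lintegral_const_mul _ hfW', hlist hL,
      lintegral_expNeg_addPoints _ _ _ hf,
      lintegral_map hfW' h.measurable_unmarked, h.laplace_unmarked hf,
      mul_left_comm, hGZ]
    congr 1
    have hzero : ∀ k', k' ∉ Finset.univ.map ⟨k, hkinj⟩ → c k' w = 0 := by
      intro k' hk'
      by_contra hne
      have : k' ∈ Set.range k := by rw [hkrange]; exact hne
      obtain ⟨ℓ, rfl⟩ := this
      simp at hk'
    have hne : ∀ ℓ, c (k ℓ) w ≠ 0 := fun ℓ => by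
      have : k ℓ ∈ {k | c k w ≠ 0} := hkrange ▸ Set.mem_range_self ℓ
      exact this
    rw [tsum_eq_sum (s := Finset.univ.map ⟨k, hkinj⟩) fun k' hk' => by rw [hzero k' hk', hG0],
      tsum_eq_sum (s := Finset.univ.map ⟨k, hkinj⟩) fun k' hk' => by
        simp [F, hzero k' hk'], Finset.sum_map, Finset.sum_map, expNeg_sum, expNeg_sum,
      ← Finset.prod_mul_distrib]
    refine Finset.prod_congr rfl fun ℓ _ => ?_
    simp only [Function.Embedding.coeFn_mk, if_pos (hw _ (hne ℓ)), F]
    rw [Set.indicator_of_mem (show _ ∈ {x : (D × Ω) × (ι → κ → ℕ) | x.2 ≠ 0} from hne ℓ),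
      expNeg_add, expNeg_negLog (hH1 _)]
  refine hleft.trans (Eq.trans ?_ hright.symm)
  rw [← expNeg_add]
  congr 1
  -- On mark zero the exponents agree because `G` vanishes there. On the complement the
  -- disintegration `hJ` is needed.
  rw [← lintegral_add_compl _ hs0]
  congr 1
  · refine setLIntegral_congr_fun hs0 fun x hx => ?_
    have hx : x.2 = 0 := hx
    simp [hx, hG0]
  · have hcompl : {x : (D × Ω) × (ι → κ → ℕ) | x.2 = 0}ᶜ = {x | x.2 ≠ 0} := rfl
    have hGf : Measurable fun x : (D × Ω) × (ι → κ → ℕ) => 1 - expNeg (G x.1.2 x.2 + f x.1) :=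
      measurable_const.sub
        (measurable_expNeg.comp ((hG.comp hsnd).add (hf.comp measurable_fst)))
    -- `G` does not depend on the `D`-coordinate, so averaging over `J` replaces `expNeg f` by `H`
    -- and leaves `expNeg G` alone.
    rw [hcompl, hJ _ hGf, ← lintegral_indicator hs]
    refine lintegral_congr fun x => ?_
    by_cases hx : x.2 = 0
    · simp [F, hx]
    · rw [Set.indicator_of_mem (show _ ∈ {x : (D × Ω) × (ι → κ → ℕ) | x.2 ≠ 0} from hx)]
      simp only [F]
      rw [Set.indicator_of_mem (show _ ∈ {x : (D × Ω) × (ι → κ → ℕ) | x.2 ≠ 0} from hx),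
        expNeg_add, expNeg_negLog (hH1 _), lintegral_sub]
      · simp only [expNeg_add, lintegral_one, measure_univ]
        have hfx : Measurable fun d' => expNeg (f (d', x.1.2)) :=
          measurable_expNeg.comp (hf.comp (by fun_prop))
        rw [lintegral_const_mul _ hfx]
      · exact measurable_expNeg.comp (measurable_const.add (hf.comp (by fun_prop)))
      · refine ne_top_of_le_ne_top (b := 1) ENNReal.one_ne_top ?_
        calc _ ≤ ∫⁻ _, 1 ∂J (x.1.2, x.2) := lintegral_mono fun _ => expNeg_le_one _
          _ = 1 := by simp
      · exact ae_of_all _ fun _ => expNeg_le_one _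

end AbstractPosterior

/-! ### Intensities and jump laws -/

section Intensity

variable {q : ℕ} {Ω : Type u} [MeasurableSpace Ω]

lemma measurableSet_simplex : MeasurableSet (simplex q) := by
  have : simplex q = (⋂ j, {s : Fin q → ℝ | 0 < s j}) ∩ {s | ∑ j, s j < 1} := by
    ext s; simp [simplex]
  rw [this]
  exact (MeasurableSet.iInter fun j => measurableSet_lt measurable_const (by fun_prop)).inter
    (measurableSet_lt (by fun_prop) measurable_const)

lemma zero_notMem_simplex (hq : 0 < q) : (0 : Fin q → ℝ) ∉ simplex q := fun h =>
  lt_irrefl _ (h.1 ⟨0, hq⟩)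

lemma sum_pos_of_mem_simplex (hq : 0 < q) {s : Fin q → ℝ} (hs : s ∈ simplex q) :
    0 < ∑ j, s j :=
  Finset.sum_pos (fun j _ => hs.1 j) ⟨⟨0, hq⟩, Finset.mem_univ _⟩

@[fun_prop]
lemma measurable_jumpWeight (M : ℕ) (c : Fin q → ℕ) : Measurable (jumpWeight M c) := by
  unfold jumpWeight; fun_prop

lemma jumpWeight_pos {M : ℕ} {c : Fin q → ℕ} {s : Fin q → ℝ} (hs : s ∈ simplex q) :
    0 < jumpWeight M c s :=
  mul_pos (Finset.prod_pos fun j _ => pow_pos (hs.1 j) _) (zpow_pos (by linarith [hs.2]) _)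

lemma lintegral_intensity (ρ : Kernel Ω (Fin q → ℝ)) [IsSFiniteKernel ρ] (B₀ : Measure Ω)
    [SFinite B₀] {f : (Fin q → ℝ) × Ω → ℝ≥0∞} (hf : Measurable f) :
    ∫⁻ e, f e ∂intensity ρ B₀ = ∫⁻ ω, ∫⁻ s, f (s, ω) ∂ρ ω ∂B₀ := by
  rw [intensity, lintegral_map hf measurable_swap,
    Measure.lintegral_compProd (f := fun x => f x.swap) (hf.comp measurable_swap)]
  rfl

lemma ae_intensity_mem_simplex {ρ : Kernel Ω (Fin q → ℝ)} [IsSFiniteKernel ρ] {B₀ : Measure Ω}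
    [SFinite B₀] (hρ : ∀ ω, ρ ω (simplex q)ᶜ = 0) : ∀ᵐ e ∂intensity ρ B₀, e.1 ∈ simplex q := by
  have hm : MeasurableSet {e : (Fin q → ℝ) × Ω | e.1 ∉ simplex q} :=
    measurable_fst measurableSet_simplex.compl
  rw [ae_iff, ← lintegral_indicator_one hm, lintegral_intensity ρ B₀ (measurable_one.indicator hm)]
  refine (lintegral_congr fun ω => ?_).trans (lintegral_zero (μ := B₀))
  have : (fun s : Fin q → ℝ => {e : (Fin q → ℝ) × Ω | e.1 ∉ simplex q}.indicator
      (1 : (Fin q → ℝ) × Ω → ℝ≥0∞) (s, ω)) = (simplex q)ᶜ.indicator 1 := by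
    funext s
    by_cases hs : s ∈ simplex q <;> simp [hs]
  rw [this, lintegral_indicator_one measurableSet_simplex.compl, hρ ω]

lemma kappa_eq {ρ : Kernel Ω (Fin q → ℝ)} (hρ : ∀ ω, ρ ω (simplex q)ᶜ = 0) (M : ℕ)
    (c : Fin q → ℕ) (ω : Ω) :
    kappa ρ M c ω = ∫⁻ s, ENNReal.ofReal (jumpWeight M c s) ∂ρ ω := by
  rw [kappa, Measure.restrict_eq_self_of_ae_mem]
  rw [ae_iff]
  exact hρ ω

lemma measurable_kappa (ρ : Kernel Ω (Fin q → ℝ)) [IsSFiniteKernel ρ] (M : ℕ) (c : Fin q → ℕ) :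
    Measurable (kappa ρ M c) := by
  unfold kappa
  simp_rw [← lintegral_indicator measurableSet_simplex]
  exact Measurable.lintegral_kernel
    ((measurable_jumpWeight M c).ennreal_ofReal.indicator measurableSet_simplex)

lemma measurable_jumpLaw (ρ : Kernel Ω (Fin q → ℝ)) [IsSFiniteKernel ρ] (M : ℕ) (c : Fin q → ℕ) :
    Measurable (jumpLaw ρ M c) := by
  have hm : Measurable (Function.uncurry fun (ω : Ω) (s : Fin q → ℝ) =>
      ENNReal.ofReal (jumpWeight M c s) / kappa ρ M c ω) :=
    (((measurable_jumpWeight M c).comp measurable_snd).ennreal_ofReal).div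
      ((measurable_kappa ρ M c).comp measurable_fst)
  have : jumpLaw ρ M c = Kernel.withDensity ρ fun ω s =>
      ENNReal.ofReal (jumpWeight M c s) / kappa ρ M c ω := by
    funext ω
    rw [Kernel.withDensity_apply _ hm, jumpLaw]
  rw [this]
  exact Kernel.measurable _

lemma lintegral_jumpLaw (ρ : Kernel Ω (Fin q → ℝ)) (M : ℕ) (c : Fin q → ℕ)
    (ω : Ω) {f : (Fin q → ℝ) → ℝ≥0∞} (hf : Measurable f) :
    ∫⁻ s, f s ∂jumpLaw ρ M c ω =
      (∫⁻ s, f s * ENNReal.ofReal (jumpWeight M c s) ∂ρ ω) / kappa ρ M c ω := by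
  have hm : Measurable fun s => ENNReal.ofReal (jumpWeight M c s) / kappa ρ M c ω :=
    (measurable_jumpWeight M c).ennreal_ofReal.div_const _
  rw [jumpLaw, lintegral_withDensity_eq_lintegral_mul _ hm hf, div_eq_mul_inv,
    ← lintegral_mul_const _ (f := fun s => f s * ENNReal.ofReal (jumpWeight M c s))
      (hf.mul (measurable_jumpWeight M c).ennreal_ofReal)]
  refine lintegral_congr fun s => ?_
  simp only [Pi.mul_apply, div_eq_mul_inv]
  ring

/-- The normalizing constant `κ_c` is positive and finite at `ω`. -/
def IsRegular (ρ : Kernel Ω (Fin q → ℝ)) (M : ℕ) (c : Fin q → ℕ) (ω : Ω) : Prop :=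
  kappa ρ M c ω ≠ 0 ∧ kappa ρ M c ω ≠ ∞

lemma measurableSet_isRegular (ρ : Kernel Ω (Fin q → ℝ)) [IsSFiniteKernel ρ] (M : ℕ)
    (c : Fin q → ℕ) : MeasurableSet {ω | IsRegular ρ M c ω} :=
  ((measurable_kappa ρ M c) (measurableSet_singleton 0).compl).inter
    ((measurable_kappa ρ M c) (measurableSet_singleton ∞).compl)

lemma IsRegular.isProbabilityMeasure {ρ : Kernel Ω (Fin q → ℝ)}
    (hρ : ∀ ω, ρ ω (simplex q)ᶜ = 0) {M : ℕ} {c : Fin q → ℕ} {ω : Ω} (h : IsRegular ρ M c ω) :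
    IsProbabilityMeasure (jumpLaw ρ M c ω) := by
  refine ⟨?_⟩
  rw [← lintegral_one, lintegral_jumpLaw ρ M c ω (f := fun _ => 1) measurable_const]
  simp only [one_mul]
  rw [← kappa_eq hρ, ENNReal.div_self h.1 h.2]

lemma jumpLaw_simplex_compl {ρ : Kernel Ω (Fin q → ℝ)} (hρ : ∀ ω, ρ ω (simplex q)ᶜ = 0) (M : ℕ)
    (c : Fin q → ℕ) (ω : Ω) : jumpLaw ρ M c ω (simplex q)ᶜ = 0 :=
  withDensity_absolutelyContinuous _ _ (hρ ω)

/-- A point of the simplex. -/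
def simplexPoint (q : ℕ) : Fin q → ℝ := fun _ => 1 / ((q : ℝ) + 1)

lemma simplexPoint_mem : simplexPoint q ∈ simplex q := by
  refine ⟨fun j => by unfold simplexPoint; positivity, ?_⟩
  simp only [simplexPoint, Finset.sum_const, Finset.card_univ, Fintype.card_fin, nsmul_eq_mul]
  rw [mul_one_div, div_lt_one (by positivity)]
  linarith

open scoped Classical in
/-- The jump laws as a Markov kernel, with a default value at the irregular points. -/
def jumpKernel (ρ : Kernel Ω (Fin q → ℝ)) [IsSFiniteKernel ρ] (M : ℕ) :
    Kernel (Ω × (Fin M → Fin q → ℕ)) (Fin q → ℝ) where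
  toFun x := if IsRegular ρ M (∑ i, x.2 i) x.1 then jumpLaw ρ M (∑ i, x.2 i) x.1
    else Measure.dirac (simplexPoint q)
  measurable' := by
    refine measurable_from_prod_countable_left fun a => ?_
    exact Measurable.ite (measurableSet_isRegular ρ M (∑ i, a i))
      (measurable_jumpLaw ρ M (∑ i, a i)) measurable_const

lemma jumpKernel_apply {ρ : Kernel Ω (Fin q → ℝ)} [IsSFiniteKernel ρ] {M : ℕ} {ω : Ω}
    {a : Fin M → Fin q → ℕ} (h : IsRegular ρ M (∑ i, a i) ω) :
    jumpKernel ρ M (ω, a) = jumpLaw ρ M (∑ i, a i) ω := if_pos h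

lemma isMarkovKernel_jumpKernel {ρ : Kernel Ω (Fin q → ℝ)} [IsSFiniteKernel ρ]
    (hρ : ∀ ω, ρ ω (simplex q)ᶜ = 0) (M : ℕ) : IsMarkovKernel (jumpKernel ρ M) := by
  refine ⟨fun x => ?_⟩
  classical
  by_cases h : IsRegular ρ M (∑ i, x.2 i) x.1
  · rw [show jumpKernel ρ M x = jumpLaw ρ M (∑ i, x.2 i) x.1 from if_pos h]
    exact h.isProbabilityMeasure hρ
  · rw [show jumpKernel ρ M x = Measure.dirac (simplexPoint q) from if_neg h]
    infer_instance

/-- The default law at irregular points sits inside the simplex, so this holds everywhere. It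
guarantees that composing with `multinomial` preserves total mass one. -/
lemma jumpKernel_ae_mem_simplex {ρ : Kernel Ω (Fin q → ℝ)} [IsSFiniteKernel ρ]
    (hρ : ∀ ω, ρ ω (simplex q)ᶜ = 0) {M : ℕ} (x : Ω × (Fin M → Fin q → ℕ)) :
    ∀ᵐ s ∂jumpKernel ρ M x, s ∈ simplex q := by
  classical
  by_cases h : IsRegular ρ M (∑ i, x.2 i) x.1
  · rw [show jumpKernel ρ M x = jumpLaw ρ M (∑ i, x.2 i) x.1 from if_pos h, ae_iff]
    exact jumpLaw_simplex_compl hρ _ _ _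
  · rw [show jumpKernel ρ M x = Measure.dirac (simplexPoint q) from if_neg h]
    exact (ae_dirac_iff (p := fun s => s ∈ simplex q) measurableSet_simplex).mpr simplexPoint_mem

/-! #### The weights of the marks of `M` customers -/

/-- Sufficiency of the counts: each customer contributes the exponent `1 - ∑ j, a i j` of `1 - s_·`,
and these add up to `M - c_·`. Integer powers avoid truncated subtraction; positivity of the base
allows adding exponents. -/
lemma markWeight_eq_jumpWeight {M : ℕ} {s : Fin q → ℝ} (hs : s ∈ simplex q)
    {a : Fin M → Fin q → ℕ} (ha : ∀ i, ∑ j, a i j ≤ 1) :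
    markWeight s a = ENNReal.ofReal (jumpWeight M (∑ i, a i) s) := by
  have h1 : (0 : ℝ) < 1 - ∑ j, s j := by linarith [hs.2]
  rw [markWeight, ← ENNReal.ofReal_prod_of_nonneg fun i _ => multinomialPMF_nonneg (Or.inl hs) _]
  congr 1
  have h2 : ∀ i, multinomialPMF s (a i) =
      (∏ j, s j ^ a i j) * (1 - ∑ j, s j) ^ (1 - ∑ j, (a i j : ℤ)) := by
    intro i
    rw [multinomialPMF, if_pos (ha i), ← zpow_natCast, Nat.cast_sub (ha i)]
    push_cast
    rfl
  simp_rw [h2]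
  rw [Finset.prod_mul_distrib, Finset.prod_comm, jumpWeight]
  congr 1
  · refine Finset.prod_congr rfl fun j _ => ?_
    rw [Finset.prod_pow_eq_pow_sum, Finset.sum_apply]
  · have hz : ∀ (t : Finset (Fin M)) (f : Fin M → ℤ),
        ∏ i ∈ t, (1 - ∑ j, s j) ^ f i = (1 - ∑ j, s j) ^ ∑ i ∈ t, f i := by
      intro t f
      induction t using Finset.induction with
      | empty => simp
      | insert x t hx ih => rw [Finset.prod_insert hx, Finset.sum_insert hx, ih, zpow_add₀ h1.ne']
    rw [hz, Finset.sum_sub_distrib]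
    congr 1
    simp only [Finset.sum_const, Finset.card_univ, Fintype.card_fin, nsmul_eq_mul,
      mul_one, Finset.sum_apply, Nat.cast_sum]
    rw [Finset.sum_comm]

lemma markWeight_eq_zero {n : ℕ} {s : Fin q → ℝ} {a : Fin n → Fin q → ℕ} {i : Fin n}
    (hi : 1 < ∑ j, a i j) : markWeight s a = 0 :=
  Finset.prod_eq_zero (Finset.mem_univ i) (by rw [multinomialPMF_eq_zero hi, ENNReal.ofReal_zero])

lemma markWeight_zero {n : ℕ} {s : Fin q → ℝ} (hs : s ∈ simplex q) :
    markWeight s (0 : Fin n → Fin q → ℕ) = ENNReal.ofReal ((1 - ∑ j, s j) ^ n) := by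
  simp [markWeight, multinomialPMF_zero_right, ENNReal.ofReal_pow (by linarith [hs.2] :
    (0 : ℝ) ≤ 1 - ∑ j, s j)]

lemma markWeight_zero_left {n : ℕ} {a : Fin n → Fin q → ℕ} (ha : a ≠ 0) :
    markWeight (0 : Fin q → ℝ) a = 0 := by
  obtain ⟨i, hi⟩ := Function.ne_iff.mp ha
  by_cases h1 : ∑ j, a i j ≤ 1
  · refine Finset.prod_eq_zero (Finset.mem_univ i) ?_
    rcases eq_zero_or_single h1 with h0 | ⟨j, hj⟩
    · exact absurd h0 hi
    · rw [hj, multinomialPMF_single]; simp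
  · exact markWeight_eq_zero (not_le.mp h1)

/-- The left side is the probability `1 - (1 - s_·)^n` that some customer chooses the point, and
Bernoulli's inequality bounds it. All finiteness statements rest on this estimate. -/
lemma markWeight_le_sum {n : ℕ} {s : Fin q → ℝ} (hs : s ∈ simplex q) :
    ∑' a : Fin n → Fin q → ℕ, (if a = 0 then 0 else markWeight s a) ≤
      n * ENNReal.ofReal (∑ j, s j) := by
  classical
  have hsum := tsum_markWeight (n := n) (s := s) (Or.inl hs)
  rw [ENNReal.tsum_eq_add_tsum_ite 0, markWeight_zero hs] at hsum
  have hnn : (0 : ℝ) ≤ ∑ j, s j := Finset.sum_nonneg fun j _ => (hs.1 j).le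
  have hB : 1 - n * (∑ j, s j) ≤ (1 - ∑ j, s j) ^ n := by
    have := one_add_mul_le_pow (a := -∑ j, s j) (by linarith [hs.2]) n
    simpa [sub_eq_add_neg] using this
  have h1 : (1 : ℝ≥0∞) ≤ ENNReal.ofReal ((1 - ∑ j, s j) ^ n) + n * ENNReal.ofReal (∑ j, s j) := by
    rw [← ENNReal.ofReal_natCast, ← ENNReal.ofReal_mul (by positivity),
      ← ENNReal.ofReal_add (pow_nonneg (by linarith [hs.2]) _) (by positivity), ENNReal.one_le_ofReal]
    linarith
  rw [← hsum] at h1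
  have h2 := (ENNReal.add_le_add_iff_left ENNReal.ofReal_ne_top).mp h1
  convert h2

/-- The integrand of `κ_c` is one term of the sum in `markWeight_le_sum`. The hypothesis `a ≠ 0`
matters because the weight of the zero array has no such bound. -/
lemma lintegral_kappa_lt_top {ρ : Kernel Ω (Fin q → ℝ)} [IsSFiniteKernel ρ] {B₀ : Measure Ω}
    [SFinite B₀] (hρ : ∀ ω, ρ ω (simplex q)ᶜ = 0)
    (hρ_int : ∫⁻ ω, ∫⁻ s, ENNReal.ofReal (∑ j, s j) ∂ρ ω ∂B₀ < ∞) {M : ℕ}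
    {a : Fin M → Fin q → ℕ} (ha : ∀ i, ∑ j, a i j ≤ 1) (ha0 : a ≠ 0) :
    ∫⁻ ω, kappa ρ M (∑ i, a i) ω ∂B₀ < ∞ := by
  classical
  calc ∫⁻ ω, kappa ρ M (∑ i, a i) ω ∂B₀
      ≤ ∫⁻ ω, M * ∫⁻ s, ENNReal.ofReal (∑ j, s j) ∂ρ ω ∂B₀ := by
        refine lintegral_mono fun ω => ?_
        dsimp only
        rw [kappa_eq hρ, ← lintegral_const_mul _ (by fun_prop)]
        refine lintegral_mono_ae ?_
        have : ∀ᵐ s ∂ρ ω, s ∈ simplex q := by rw [ae_iff]; exact hρ ω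
        filter_upwards [this] with s hs
        rw [← markWeight_eq_jumpWeight hs ha]
        refine le_trans ?_ (markWeight_le_sum (n := M) hs)
        refine le_trans ?_ (ENNReal.le_tsum a)
        rw [if_neg ha0]
    _ = M * ∫⁻ ω, ∫⁻ s, ENNReal.ofReal (∑ j, s j) ∂ρ ω ∂B₀ :=
        lintegral_const_mul _ (Measurable.lintegral_kernel (by fun_prop))
    _ < ∞ := ENNReal.mul_lt_top (ENNReal.natCast_lt_top M) hρ_int

/-- The jump kernel disintegrates the intensity of the points with marks `a`. -/
lemma lintegral_markWeight_jumpKernel {ρ : Kernel Ω (Fin q → ℝ)} [IsSFiniteKernel ρ]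
    {B₀ : Measure Ω} [SFinite B₀] (hρ : ∀ ω, ρ ω (simplex q)ᶜ = 0)
    (hρ_int : ∫⁻ ω, ∫⁻ s, ENNReal.ofReal (∑ j, s j) ∂ρ ω ∂B₀ < ∞) {M : ℕ}
    {a : Fin M → Fin q → ℕ} (ha0 : a ≠ 0) {h : (Fin q → ℝ) × Ω → ℝ≥0∞} (hh : Measurable h) :
    ∫⁻ e, h e * markWeight e.1 a ∂intensity ρ B₀ =
      ∫⁻ e, (∫⁻ s, h (s, e.2) ∂jumpKernel ρ M (e.2, a)) * markWeight e.1 a ∂intensity ρ B₀ := by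
  have := isMarkovKernel_jumpKernel hρ M
  by_cases ha : ∀ i, ∑ j, a i j ≤ 1
  swap
  · push Not at ha
    obtain ⟨i, hi⟩ := ha
    simp [markWeight_eq_zero hi]
  have hinner : Measurable fun o : Ω => ∫⁻ s, h (s, o) ∂jumpKernel ρ M (o, a) := by
    refine Measurable.lintegral_kernel_prod_right' (κ := (jumpKernel ρ M).comap (fun o => (o, a))
      (by fun_prop)) (f := fun x : Ω × (Fin q → ℝ) => h (x.2, x.1)) (by fun_prop)
  have hw : Measurable fun e : (Fin q → ℝ) × Ω => markWeight e.1 a :=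
    (measurable_markWeight a).comp measurable_fst
  rw [lintegral_intensity ρ B₀ (f := fun e => h e * markWeight e.1 a) (hh.mul hw),
    lintegral_intensity ρ B₀ (f := fun e => (∫⁻ s, h (s, e.2) ∂jumpKernel ρ M (e.2, a)) *
      markWeight e.1 a) ((hinner.comp measurable_snd).mul hw)]
  have hfin : ∀ᵐ ω ∂B₀, kappa ρ M (∑ i, a i) ω < ∞ :=
    ae_lt_top (measurable_kappa ρ M _) (lintegral_kappa_lt_top hρ hρ_int ha ha0).ne
  refine lintegral_congr_ae (hfin.mono fun ω hω => ?_)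
  dsimp only
  have hsim : ∀ᵐ s ∂ρ ω, s ∈ simplex q := by rw [ae_iff]; exact hρ ω
  have hwω : ∀ g : (Fin q → ℝ) → ℝ≥0∞, ∫⁻ s, g s * markWeight s a ∂ρ ω =
      ∫⁻ s, g s * ENNReal.ofReal (jumpWeight M (∑ i, a i) s) ∂ρ ω := fun g =>
    lintegral_congr_ae (hsim.mono fun s hs => by
      dsimp only; rw [markWeight_eq_jumpWeight hs ha])
  rw [hwω fun s => h (s, ω), hwω fun _ => ∫⁻ s, h (s, ω) ∂jumpKernel ρ M (ω, a),
    lintegral_const_mul _ (by fun_prop), ← kappa_eq hρ]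
  have hhω : Measurable fun s => h (s, ω) := by fun_prop
  -- If `κ = 0`, the weight vanishes `ρ ω`-almost everywhere and both sides are zero, whatever
  -- default the kernel takes.
  by_cases h0 : kappa ρ M (∑ i, a i) ω = 0
  · rw [h0, mul_zero, lintegral_eq_zero_iff (by fun_prop)]
    rw [kappa_eq hρ, lintegral_eq_zero_iff (by fun_prop)] at h0
    filter_upwards [h0] with s hs
    simp only [Pi.zero_apply] at hs ⊢
    rw [hs, mul_zero]
  · rw [jumpKernel_apply ⟨h0, hω.ne⟩, lintegral_jumpLaw ρ M _ ω hhω,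
      ENNReal.div_mul_cancel h0 hω.ne]

end Intensity

/-! ### The points of a multinomial IBP model as a marked Poisson process -/

/-- Take the test factor one at the earlier indices, where the conditional probabilities sum to one.
-/
lemma HasMarks.lintegral_single {𝒲 𝕌 A : Type*} [MeasurableSpace 𝒲] [MeasurableSpace 𝕌]
    [MeasurableSpace A] [Countable A] [MeasurableSingletonClass A] {P : Measure 𝒲} {U : 𝒲 → 𝕌}
    {β : ℕ → 𝒲 → A} {π : ℕ → 𝕌 → A → ℝ≥0∞} (h : HasMarks P U β π) (hU : Measurable U)
    (hβ : ∀ k, Measurable (β k)) (hπ : ∀ k a, Measurable fun u => π k u a)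
    (hπ_one : ∀ᵐ w ∂P, ∀ k, ∑' a, π k (U w) a = 1) (k : ℕ)
    {g : 𝕌 → A → ℝ≥0∞} (hg : ∀ a, Measurable fun u => g u a) :
    ∫⁻ w, g (U w) (β k w) ∂P = ∫⁻ w, ∑' a, g (U w) a * π k (U w) a ∂P := by
  classical
  have := h.lintegral_prod hU hβ hπ (k + 1) (g := fun l u a => if l = k then g u a else 1)
    (fun l a => by split_ifs <;> [exact hg a; exact measurable_const])
  have hprod : ∀ f : ℕ → ℝ≥0∞, (∀ l, l ≠ k → f l = 1) → ∏ l : Fin (k + 1), f l = f k := by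
    intro f hf
    rw [Finset.prod_eq_single (Fin.last k)]
    · simp
    · intro l _ hl
      exact hf l fun he => hl (Fin.ext he)
    · simp
  rw [lintegral_congr fun w => hprod (fun l => if l = k then g (U w) (β l w) else 1)
    (fun l hl => by simp [hl])] at this
  simp only [if_true] at this
  rw [this]
  refine lintegral_congr_ae (hπ_one.mono fun w hw => ?_)
  dsimp only
  rw [hprod (fun l => ∑' a, (if l = k then g (U w) a else 1) * π l (U w) a)
    (fun l hl => by simp [hl, hw])]
  simp

lemma pointProcess_eq_activeSum {q : ℕ} {Ω 𝒲 : Type*} [MeasurableSpace Ω]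
    (p : ℕ → 𝒲 → Fin q → ℝ) (θ : ℕ → 𝒲 → Ω) :
    pointProcess p θ = activeSum (fun k => {w | p k w ≠ 0}) fun k w => (p k w, θ k w) := by
  classical
  funext w
  unfold pointProcess activeSum
  congr 1
  funext k
  by_cases h : p k w = 0 <;> simp [h]

section Model

variable {q n : ℕ} {Ω : Type u} {𝒲 : Type v} [MeasurableSpace Ω] [MeasurableSpace 𝒲]
  {P : Measure 𝒲} {ν : Measure ((Fin q → ℝ) × Ω)}
  {p : ℕ → 𝒲 → Fin q → ℝ} {θ : ℕ → 𝒲 → Ω} {b : Fin n → ℕ → 𝒲 → Fin q → ℕ}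

lemma IsIBPModel.measurable_marks (h : IsIBPModel P ν p θ b) (k : ℕ) :
    Measurable fun w i => b i k w := measurable_pi_iff.mpr fun i => h.measurable_b i k

lemma IsIBPModel.measurableSet_active (h : IsIBPModel P ν p θ b) (k : ℕ) :
    MeasurableSet {w | p k w ≠ 0} :=
  (h.measurable_p k (measurableSet_singleton 0)).compl

lemma IsIBPModel.ae_tsum_markWeight (h : IsIBPModel P ν p θ b) :
    ∀ᵐ w ∂P, ∀ k, ∑' a : Fin n → Fin q → ℕ, markWeight (p k w) a = 1 :=
  h.p_mem.mono fun _ hw k => tsum_markWeight (hw k)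

lemma IsIBPModel.lintegral_mark [IsProbabilityMeasure P] (h : IsIBPModel P ν p θ b) (k : ℕ)
    {g : (Fin q → ℝ) → (Fin n → Fin q → ℕ) → ℝ≥0∞} (hg : ∀ a, Measurable fun s => g s a) :
    ∫⁻ w, g (p k w) (fun i => b i k w) ∂P =
      ∫⁻ w, ∑' a, g (p k w) a * markWeight (p k w) a ∂P :=
  h.hasMarks.lintegral_single h.measurable_pointSeq h.measurable_marks
    (fun k a => (measurable_markWeight a).comp (by fun_prop)) h.ae_tsum_markWeight k
    (g := fun u a => g (u k).1 a) fun a => (hg a).comp (by fun_prop)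

/-- Arrays of conditional probability zero almost surely do not occur: the indicator of `{markWeight
= 0}` has conditional mean zero. Hence `ae_marks`: absent points are not chosen, and no customer
takes a point twice. -/
lemma IsIBPModel.ae_markWeight_ne_zero [IsProbabilityMeasure P] (h : IsIBPModel P ν p θ b) :
    ∀ᵐ w ∂P, ∀ k, markWeight (p k w) (fun i => b i k w) ≠ 0 := by
  rw [ae_all_iff]
  intro k
  obtain ⟨g, hg, hz, hne⟩ : ∃ g : (Fin q → ℝ) → (Fin n → Fin q → ℕ) → ℝ≥0∞,
      (∀ a, Measurable fun s => g s a) ∧ (∀ s a, g s a * markWeight s a = 0) ∧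
      ∀ s a, markWeight s a = 0 → g s a ≠ 0 := by
    refine ⟨fun s a => {s : Fin q → ℝ | markWeight s a = 0}.indicator 1 s,
      fun a => measurable_one.indicator (measurable_markWeight a (measurableSet_singleton 0)),
      fun s a => ?_, fun s a h0 => ?_⟩
    · by_cases h0 : markWeight s a = 0
      · rw [h0, mul_zero]
      · beta_reduce
        rw [Set.indicator_of_notMem (show s ∉ {s : Fin q → ℝ | markWeight s a = 0} from h0), zero_mul]
    · beta_reduce
      rw [Set.indicator_of_mem (show s ∈ {s : Fin q → ℝ | markWeight s a = 0} from h0)]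
      simp
  have h1 : ∫⁻ w, g (p k w) (fun i => b i k w) ∂P = 0 := by
    rw [h.lintegral_mark k hg]
    simp only [hz, tsum_zero, lintegral_zero]
  have hm : Measurable fun w => g (p k w) fun i => b i k w := by
    have : Measurable (Function.uncurry fun (a : Fin n → Fin q → ℕ) (s : Fin q → ℝ) => g s a) :=
      measurable_from_prod_countable_right hg
    exact this.comp ((h.measurable_marks k).prodMk (h.measurable_p k))
  rw [lintegral_eq_zero_iff hm] at h1
  filter_upwards [h1] with w hw h0
  exact hne _ _ h0 hw

lemma IsIBPModel.ae_marks [IsProbabilityMeasure P] (h : IsIBPModel P ν p θ b) :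
    ∀ᵐ w ∂P, ∀ k, (p k w = 0 → ∀ i, b i k w = 0) ∧ ∀ i, ∑ j, b i k w j ≤ 1 := by
  filter_upwards [h.ae_markWeight_ne_zero] with w hw k
  refine ⟨fun h0 => ?_, fun i => ?_⟩
  · by_contra hne
    have := hw k
    rw [h0] at this
    exact this (markWeight_zero_left fun h => hne fun i => congrFun h i)
  · by_contra hlt
    exact hw k (markWeight_eq_zero (i := i) (not_le.mp hlt))

lemma IsIBPModel.ae_notMem_of_null [IsProbabilityMeasure P] (h : IsIBPModel P ν p θ b)
    {A : Set ((Fin q → ℝ) × Ω)} (hA : MeasurableSet A) (h0 : ν A = 0) :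
    ∀ᵐ w ∂P, ∀ k, p k w ≠ 0 → (p k w, θ k w) ∉ A := by
  classical
  have h1 := h.prm.lintegral_apply hA
  rw [h0, lintegral_eq_zero_iff (h.prm.measurable_apply hA)] at h1
  filter_upwards [h1] with w hw k hk hkA
  have hw' : pointProcess p θ w A = 0 := hw
  rw [pointProcess_eq_activeSum, ← lintegral_indicator_one hA,
    lintegral_activeSum _ _ _ (measurable_one.indicator hA), ENNReal.tsum_eq_zero] at hw'
  have := hw' k
  simp [hk, hkA] at this

/-- The expected number of chosen points is at most `n ∫ s_· dν`, by `markWeight_le_sum` and the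
mean formula of the Poisson process. -/
lemma IsIBPModel.ae_finite_marks [IsProbabilityMeasure P] (h : IsIBPModel P ν p θ b)
    (hint : ∫⁻ e, ENNReal.ofReal (∑ j, e.1 j) ∂ν < ∞) :
    ∀ᵐ w ∂P, {k | (fun i => b i k w) ≠ 0}.Finite := by
  classical
  let g : (Fin q → ℝ) → (Fin n → Fin q → ℕ) → ℝ≥0∞ := fun s a => if a = 0 then 0 else 1
  have hm : ∀ k, Measurable fun w => g (p k w) fun i => b i k w := fun k =>
    (Measurable.of_discrete (f := fun a : Fin n → Fin q → ℕ =>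
      if a = 0 then (0 : ℝ≥0∞) else 1)).comp (h.measurable_marks k)
  have hfin : ∫⁻ w, ∑' k, g (p k w) (fun i => b i k w) ∂P < ∞ := by
    calc ∫⁻ w, ∑' k, g (p k w) (fun i => b i k w) ∂P
        = ∑' k, ∫⁻ w, g (p k w) (fun i => b i k w) ∂P :=
          lintegral_tsum fun k => (hm k).aemeasurable
      _ ≤ ∑' k, ∫⁻ w, n * ENNReal.ofReal (∑ j, p k w j) ∂P := by
          refine ENNReal.tsum_le_tsum fun k => ?_
          rw [h.lintegral_mark k (g := g) fun a => measurable_const]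
          refine lintegral_mono_ae (h.p_mem.mono fun w hw => ?_)
          rcases hw k with hs | h0
          · refine le_trans (le_of_eq (tsum_congr fun a => ?_)) (markWeight_le_sum hs)
            by_cases ha : a = 0 <;> simp [g, ha]
          · rw [h0]
            refine le_trans (le_of_eq ?_) zero_le
            rw [ENNReal.tsum_eq_zero]
            intro a
            by_cases ha : a = 0
            · simp [g, ha]
            · simp [markWeight_zero_left ha]
      _ = n * ∫⁻ e, ENNReal.ofReal (∑ j, e.1 j) ∂ν := by
          have hp : ∀ k, Measurable fun w => ENNReal.ofReal (∑ j, p k w j) := fun k => by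
            have := h.measurable_p k
            fun_prop
          simp_rw [fun k => lintegral_const_mul (μ := P) (n : ℝ≥0∞) (hp k)]
          rw [ENNReal.tsum_mul_left, ← lintegral_tsum fun k => (hp k).aemeasurable,
            ← h.prm.lintegral_lintegral (by fun_prop)]
          congr 1
          refine lintegral_congr fun w => ?_
          rw [pointProcess_lintegral w (by fun_prop) (by simp)]
      _ < ∞ := ENNReal.mul_lt_top (ENNReal.natCast_lt_top n) hint
  filter_upwards [ae_lt_top (Measurable.tsum hm) hfin.ne] with w hw
  refine (ENNReal.finite_const_le_of_tsum_ne_top hw.ne one_ne_zero).subset fun k hk => ?_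
  change 1 ≤ (if (fun i => b i k w) = 0 then (0 : ℝ≥0∞) else 1)
  rw [if_neg hk]

/-- The intensity may be infinite, but `A r = {s_· ≥ 1 / (r + 1)}` has finite mass by Markov's
inequality. For `q > 0` every jump has positive sum, so two points with a common label would lie
together in some `A r`, against `IsPRM.measure_fiber_lt_two`. -/
lemma IsIBPModel.ae_injective_labels [IsProbabilityMeasure P] [StandardBorelSpace Ω]
    (h : IsIBPModel P ν p θ b) (hint : ∫⁻ e, ENNReal.ofReal (∑ j, e.1 j) ∂ν < ∞) (hq : 0 < q)
    (hatom : ∀ o, ν {e | e.2 = o} = 0) :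
    ∀ᵐ w ∂P, ∀ k l, p k w ≠ 0 → p l w ≠ 0 → θ k w = θ l w → k = l := by
  classical
  let T : (Fin q → ℝ) × Ω → ℝ := fun e => embeddingReal Ω e.2
  have hT : Measurable T := (measurable_embeddingReal Ω).comp measurable_snd
  let A : ℕ → Set ((Fin q → ℝ) × Ω) := fun r =>
    {e | ((r : ℝ≥0∞) + 1)⁻¹ ≤ ENNReal.ofReal (∑ j, e.1 j)}
  have hA : ∀ r, MeasurableSet (A r) := fun r => measurableSet_le measurable_const (by fun_prop)
  have hfin : ∀ r, ν (A r) ≠ ∞ := fun r => by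
    refine ne_top_of_le_ne_top ?_ (meas_ge_le_lintegral_div (by fun_prop) ?_ ?_)
    · exact ENNReal.div_ne_top hint.ne (ENNReal.inv_ne_zero.mpr (by simp))
    · exact ENNReal.inv_ne_zero.mpr (by simp)
    · exact ENNReal.inv_ne_top.mpr (by simp)
  have hnull : ∀ r t, ν (A r ∩ T ⁻¹' {t}) = 0 := fun r t => by
    by_cases ht : ∃ o, embeddingReal Ω o = t
    · obtain ⟨o, rfl⟩ := ht
      refine measure_mono_null (fun e he => ?_) (hatom o)
      exact (measurableEmbedding_embeddingReal Ω).injective he.2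
    · have : A r ∩ T ⁻¹' {t} = ∅ := by
        ext e
        simp only [Set.mem_inter_iff, Set.mem_preimage, Set.mem_singleton_iff,
          Set.mem_empty_iff_false, iff_false, not_and]
        exact fun _ he => ht ⟨_, he⟩
      rw [this, measure_empty]
  have key : ∀ᵐ w ∂P, ∀ r t, pointProcess p θ w (A r ∩ T ⁻¹' {t}) < 2 :=
    ae_all_iff.mpr fun r => h.prm.measure_fiber_lt_two hT (hA r) (hfin r) (hnull r)
  filter_upwards [key, h.p_mem] with w hw hp k l hk hl hkl
  by_contra hne
  have hpos : ∀ m, p m w ≠ 0 → 0 < ENNReal.ofReal (∑ j, p m w j) := fun m hm =>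
    ENNReal.ofReal_pos.mpr (sum_pos_of_mem_simplex hq ((hp m).resolve_right hm))
  obtain ⟨r, hr⟩ := ENNReal.exists_inv_nat_lt (lt_min (hpos k hk) (hpos l hl)).ne'
  have hr' : ((r : ℝ≥0∞) + 1)⁻¹ ≤ min (ENNReal.ofReal (∑ j, p k w j))
      (ENNReal.ofReal (∑ j, p l w j)) :=
    le_trans (ENNReal.inv_le_inv.mpr le_self_add) hr.le
  refine absurd (hw r (embeddingReal Ω (θ k w))) (not_lt.mpr ?_)
  have hAT := (hA r).inter (hT (measurableSet_singleton (embeddingReal Ω (θ k w))))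
  rw [pointProcess_eq_activeSum, ← lintegral_indicator_one hAT,
    lintegral_activeSum _ _ _ (measurable_one.indicator hAT)]
  refine le_trans ?_ (ENNReal.sum_le_tsum {k, l})
  rw [Finset.sum_pair hne]
  have hmk : (p k w, θ k w) ∈ A r ∩ T ⁻¹' {embeddingReal Ω (θ k w)} :=
    ⟨hr'.trans (min_le_left _ _), rfl⟩
  have hml : (p l w, θ l w) ∈ A r ∩ T ⁻¹' {embeddingReal Ω (θ k w)} :=
    ⟨hr'.trans (min_le_right _ _), by simp [T, hkl]⟩
  rw [if_pos (show w ∈ {w | p k w ≠ 0} from hk), if_pos (show w ∈ {w | p l w ≠ 0} from hl),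
    Set.indicator_of_mem hmk, Set.indicator_of_mem hml]
  norm_num

/-- The restriction of a model to its first customers. -/
lemma IsIBPModel.restrict (h : IsIBPModel P ν p θ b) {m : ℕ} (hm : m ≤ n) :
    IsIBPModel P ν p θ fun i : Fin m => b (Fin.castLE hm i) := by
  classical
  refine ⟨h.measurable_p, h.measurable_θ, fun i => h.measurable_b _, h.p_mem, h.prm,
    fun F a => ?_⟩
  let e : Fin m × ℕ ↪ Fin n × ℕ :=
    ⟨fun x => (Fin.castLE hm x.1, x.2), fun x y hxy => by
      simp only [Prod.mk.injEq, Fin.castLE_inj] at hxy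
      exact Prod.ext hxy.1 hxy.2⟩
  let a' : Fin n × ℕ → Fin q → ℕ := fun x => if hx : x.1 < m then a (⟨x.1, hx⟩, x.2) else 0
  have ha' : ∀ x, a' (e x) = a x := fun x => dif_pos x.1.2
  have := h.cond_b (F.map e) a'
  simp only [Finset.mem_map, forall_exists_index, and_imp, forall_apply_eq_imp_iff₂, ha',
    Finset.prod_map] at this
  exact this

/-- The mean measure of the points `((δ s a, ω), γ a)`, where `(s, ω)` is a point of the model
with marks `a`. -/
def markedIntensity {D C : Type*} [MeasurableSpace D] [MeasurableSpace C]
    (ν : Measure ((Fin q → ℝ) × Ω)) (δ : (Fin q → ℝ) → (Fin n → Fin q → ℕ) → D)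
    (γ : (Fin n → Fin q → ℕ) → C) : Measure ((D × Ω) × C) :=
  Measure.sum fun a => (ν.withDensity fun e => markWeight e.1 a).map fun e => ((δ e.1 a, e.2), γ a)

lemma lintegral_markedIntensity {D C : Type*} [MeasurableSpace D] [MeasurableSpace C]
    (ν : Measure ((Fin q → ℝ) × Ω)) {δ : (Fin q → ℝ) → (Fin n → Fin q → ℕ) → D}
    (hδ : ∀ a, Measurable fun s => δ s a) (γ : (Fin n → Fin q → ℕ) → C)
    {G : (D × Ω) × C → ℝ≥0∞} (hG : Measurable G) :
    ∫⁻ x, G x ∂markedIntensity ν δ γ =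
      ∑' a, ∫⁻ e, G ((δ e.1 a, e.2), γ a) * markWeight e.1 a ∂ν := by
  rw [markedIntensity, lintegral_sum_measure]
  refine tsum_congr fun a => ?_
  have hm : Measurable fun e : (Fin q → ℝ) × Ω => ((δ e.1 a, e.2), γ a) :=
    (((hδ a).comp measurable_fst).prodMk measurable_snd).prodMk measurable_const
  have hw : Measurable fun e : (Fin q → ℝ) × Ω => markWeight e.1 a :=
    (measurable_markWeight a).comp measurable_fst
  rw [lintegral_map hG hm, 
    lintegral_withDensity_eq_lintegral_mul _ hw
      (g := fun e => G ((δ e.1 a, e.2), γ a)) (hG.comp hm)]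
  refine lintegral_congr fun e => ?_
  simp only [Pi.mul_apply]
  ring

/-- Only the choices of the first `M` customers serve as marks; `δ` may keep any function of the
jump and of all `n` choices. The posterior takes `δ` to be the jump; the prediction adds the choice
of the last customer. -/
theorem IsIBPModel.isMarkedPoisson [IsProbabilityMeasure P] [StandardBorelSpace Ω]
    (h : IsIBPModel P ν p θ b) (hν : ∀ᵐ e ∂ν, e.1 ∈ simplex q)
    (hint : ∫⁻ e, ENNReal.ofReal (∑ j, e.1 j) ∂ν < ∞) (hq : 0 < q)
    (hatom : ∀ o, ν {e | e.2 = o} = 0) {M : ℕ} (hM : M ≤ n) {D : Type*} [MeasurableSpace D]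
    {δ : (Fin q → ℝ) → (Fin n → Fin q → ℕ) → D} (hδ : ∀ a, Measurable fun s => δ s a) :
    IsMarkedPoisson P (fun k w => δ (p k w) fun i => b i k w) θ
      (fun k w (i : Fin M) => b (Fin.castLE hM i) k w) (fun k => {w | p k w ≠ 0})
      (markedIntensity ν δ fun a (i : Fin M) => a (Fin.castLE hM i)) := by
  classical
  have hne : ∀ k w, (fun i : Fin M => b (Fin.castLE hM i) k w) ≠ 0 → (fun i => b i k w) ≠ 0 :=
    fun k w hc hb => hc (funext fun i => congrFun hb _)
  refine ⟨fun k => ?_, h.measurable_θ, fun k => measurable_pi_iff.mpr fun i => h.measurable_b _ k,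
    h.measurableSet_active, ?_, ?_, fun F hF => ?_⟩
  · have : Measurable (Function.uncurry fun (a : Fin n → Fin q → ℕ) (s : Fin q → ℝ) => δ s a) :=
      measurable_from_prod_countable_right hδ
    exact this.comp ((h.measurable_marks k).prodMk (h.measurable_p k))
  · filter_upwards [h.ae_marks] with w hw k hc h0
    exact hne k w hc (funext fun i => (hw k).1 h0 i)
  · filter_upwards [h.ae_marks, h.ae_finite_marks hint, h.ae_injective_labels hint hq hatom]
      with w hw hfin hinj
    have hact : ∀ k, (fun i : Fin M => b (Fin.castLE hM i) k w) ≠ 0 → p k w ≠ 0 := fun k hc h0 =>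
      hne k w hc (funext fun i => (hw k).1 h0 i)
    exact ⟨hfin.subset fun k hk => hne k w hk, fun k hk l hl hkl =>
      hinj k l (hact k hk) (hact l hl) hkl⟩
  · have hGm : ∀ a, Measurable fun e : (Fin q → ℝ) × Ω =>
        F ((δ e.1 a, e.2), fun i => a (Fin.castLE hM i)) := fun a =>
      hF.comp ((((hδ a).comp measurable_fst).prodMk measurable_snd).prodMk measurable_const)
    have hs : MeasurableSet {e : (Fin q → ℝ) × Ω | e.1 ≠ 0} :=
      (measurable_fst (measurableSet_singleton 0)).compl
    -- The test function is cut off at `s = 0` so that absent points do not count. The intensity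
    -- does not notice this, since zero lies outside the simplex when `q > 0`.
    have hL := h.laplace hν
      (f := fun e a => if e.1 ≠ 0 then F ((δ e.1 a, e.2), fun i => a (Fin.castLE hM i)) else 0)
      (fun a => Measurable.ite hs (hGm a) measurable_const) (by simp)
    refine (lintegral_congr fun w => ?_).trans (hL.trans ?_)
    · congr 1
      refine tsum_congr fun k => ?_
      by_cases hk : p k w = 0
      · rw [if_neg (show ¬(p k w, θ k w).1 ≠ 0 from not_not.mpr hk),
          if_neg (show w ∉ {w | p k w ≠ 0} from not_not.mpr hk)]
      · rw [if_pos (show (p k w, θ k w).1 ≠ 0 from hk), if_pos (show w ∈ {w | p k w ≠ 0} from hk)]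
    rw [lintegral_markedIntensity ν hδ _ (G := fun x => 1 - expNeg (F x)) (by fun_prop)]
    rw [← lintegral_tsum]
    · congr 1
      refine lintegral_congr_ae (hν.mono fun e he => tsum_congr fun a => ?_)
      have : e.1 ≠ 0 := fun h0 => zero_notMem_simplex hq (h0 ▸ he)
      rw [if_pos this]
    · intro a
      have := hGm a
      exact Measurable.aemeasurable (by fun_prop)

end Model

/-! ### Regularity of the chosen features -/

section Regular

variable {q : ℕ} {Ω : Type u} [MeasurableSpace Ω] {ρ : Kernel Ω (Fin q → ℝ)} [IsSFiniteKernel ρ]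
  {B₀ : Measure Ω}

lemma intensity_label_null [SFinite B₀] [NullSingletonClass B₀] [StandardBorelSpace Ω] (o : Ω) :
    intensity ρ B₀ {e | e.2 = o} = 0 := by
  have hm : MeasurableSet {e : (Fin q → ℝ) × Ω | e.2 = o} :=
    measurable_snd (measurableSet_singleton o)
  rw [← lintegral_indicator_one hm, lintegral_intensity ρ B₀ (measurable_one.indicator hm)]
  have h0 : ∀ᵐ ω ∂B₀, ω ≠ o := by
    rw [ae_iff]
    simp
  rw [lintegral_congr_ae (g := fun _ => 0), lintegral_zero]
  filter_upwards [h0] with ω hω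
  rw [lintegral_congr (g := fun _ => 0), lintegral_zero]
  intro s
  exact Set.indicator_of_notMem (by exact hω) _

lemma lintegral_sum_intensity_lt_top [SFinite B₀]
    (hρ_int : ∫⁻ ω, ∫⁻ s, ENNReal.ofReal (∑ j, s j) ∂ρ ω ∂B₀ < ∞) :
    ∫⁻ e, ENNReal.ofReal (∑ j, e.1 j) ∂intensity ρ B₀ < ∞ := by
  rwa [lintegral_intensity ρ B₀ (by fun_prop)]

/-- `κ_c` is finite `B₀`-almost everywhere by its integral bound. Where `κ_c = 0`, positivity of the
weight on the simplex forces `ρ ω = 0`, so such labels carry no intensity. -/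
lemma intensity_not_isRegular [SFinite B₀] (hρ : ∀ ω, ρ ω (simplex q)ᶜ = 0)
    (hρ_int : ∫⁻ ω, ∫⁻ s, ENNReal.ofReal (∑ j, s j) ∂ρ ω ∂B₀ < ∞) {M : ℕ}
    {a : Fin M → Fin q → ℕ} (ha : ∀ i, ∑ j, a i j ≤ 1) (ha0 : a ≠ 0) :
    intensity ρ B₀ {e | ¬ IsRegular ρ M (∑ i, a i) e.2} = 0 := by
  have hm : MeasurableSet {e : (Fin q → ℝ) × Ω | ¬ IsRegular ρ M (∑ i, a i) e.2} :=
    measurable_snd (measurableSet_isRegular ρ M (∑ i, a i)).compl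
  rw [← lintegral_indicator_one hm, lintegral_intensity ρ B₀ (measurable_one.indicator hm)]
  have hfin := ae_lt_top (measurable_kappa ρ M (∑ i, a i))
    (lintegral_kappa_lt_top hρ hρ_int ha ha0).ne
  rw [lintegral_congr_ae (g := fun _ => 0), lintegral_zero]
  filter_upwards [hfin] with ω hω
  by_cases h0 : kappa ρ M (∑ i, a i) ω = 0
  · have hz : ρ ω = 0 := by
      rw [kappa_eq hρ, lintegral_eq_zero_iff (measurable_jumpWeight _ _).ennreal_ofReal] at h0
      have hs : ∀ᵐ s ∂ρ ω, s ∈ simplex q := hρ ω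
      rw [← ae_eq_bot, ← Filter.empty_mem_iff_bot]
      filter_upwards [h0, hs] with s h1 h2
      exact absurd h1 (ENNReal.ofReal_pos.mpr (jumpWeight_pos h2)).ne'
    rw [hz, lintegral_zero_measure]
  · rw [lintegral_congr (g := fun _ => 0), lintegral_zero]
    intro s
    exact Set.indicator_of_notMem (not_not.mpr ⟨h0, hω.ne⟩) _

/-- There are only countably many arrays `a`. For each of them almost surely no point has an
irregular label, so the array actually observed may be inserted. -/
lemma IsIBPModel.ae_isRegular {M : ℕ} {𝒲 : Type v} [MeasurableSpace 𝒲] {P : Measure 𝒲}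
    [IsProbabilityMeasure P] {p : ℕ → 𝒲 → Fin q → ℝ} {θ : ℕ → 𝒲 → Ω}
    {b : Fin M → ℕ → 𝒲 → Fin q → ℕ} [SFinite B₀] (h : IsIBPModel P (intensity ρ B₀) p θ b)
    (hρ : ∀ ω, ρ ω (simplex q)ᶜ = 0)
    (hρ_int : ∫⁻ ω, ∫⁻ s, ENNReal.ofReal (∑ j, s j) ∂ρ ω ∂B₀ < ∞) :
    ∀ᵐ w ∂P, ∀ k, (fun i => b i k w) ≠ 0 → IsRegular ρ M (∑ i, b i k w) (θ k w) := by
  have key : ∀ᵐ w ∂P, ∀ a : Fin M → Fin q → ℕ, (∀ i, ∑ j, a i j ≤ 1) → a ≠ 0 →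
      ∀ k, p k w ≠ 0 → IsRegular ρ M (∑ i, a i) (θ k w) := by
    refine ae_all_iff.mpr fun a => ?_
    by_cases ha : (∀ i, ∑ j, a i j ≤ 1) ∧ a ≠ 0
    · have hm : MeasurableSet {e : (Fin q → ℝ) × Ω | ¬ IsRegular ρ M (∑ i, a i) e.2} :=
        measurable_snd (measurableSet_isRegular ρ M (∑ i, a i)).compl
      filter_upwards [h.ae_notMem_of_null hm (intensity_not_isRegular hρ hρ_int ha.1 ha.2)]
        with w hw _ _ k hk
      exact not_not.mp (hw k hk)
    · exact .of_forall fun w h1 h2 => absurd ⟨h1, h2⟩ ha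
  filter_upwards [key, h.ae_marks] with w hw hmk k hk
  exact hw _ (hmk k).2 hk k fun h0 => hk (funext fun i => (hmk k).1 h0 i)

end Regular

/-! ### Lists of the chosen features -/

section DishList

variable {q M K K' : ℕ} {Ω : Type*} [MeasurableSpace Ω] [MeasurableSingletonClass Ω]
  {z : Fin M → Fin q → Measure Ω}

lemma IsListing.apply_singleton {ω : Fin K → Ω} {c : Fin K → Fin M → Fin q → ℕ}
    (h : IsListing z ω c) (ℓ : Fin K) (i : Fin M) (j : Fin q) : z i j {ω ℓ} = c ℓ i j := by
  rw [h.apply i j (measurableSet_singleton _), Finset.sum_eq_single ℓ]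
  · simp
  · intro ℓ' _ hne
    simp [h.injective.ne hne]
  · simp

lemma IsListing.isDishList {ω : Fin K → Ω} {c : Fin K → Fin M → Fin q → ℕ}
    (h : IsListing z ω c) : IsDishList z ω fun ℓ => ∑ i, c ℓ i := by
  refine ⟨h.injective, ?_, fun ℓ j => ?_⟩
  · ext x
    constructor
    · rintro ⟨ℓ, rfl⟩
      by_contra hnot
      simp only [Set.mem_ofPred_eq, not_exists, not_not, h.apply_singleton, Nat.cast_eq_zero] at hnot
      exact h.ne_zero ℓ (funext fun i => funext fun j => hnot i j)
    · rintro ⟨i, j, hij⟩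
      by_contra hx
      refine hij ?_
      rw [h.apply i j (measurableSet_singleton _)]
      refine Finset.sum_eq_zero fun ℓ _ => ?_
      have : ω ℓ ≠ x := fun he => hx ⟨ℓ, he⟩
      simp [this]
  · simp [h.apply_singleton, Finset.sum_apply]

/-- A list of the chosen features is a reordering of any other one. -/
lemma IsListing.of_isDishList {ω₀ : Fin K' → Ω} {c₀ : Fin K' → Fin M → Fin q → ℕ}
    (h : IsListing z ω₀ c₀) {ω : Fin K → Ω} {c : Fin K → Fin q → ℕ} (hd : IsDishList z ω c) :
    ∃ e : Fin K ≃ Fin K', ω = ω₀ ∘ e ∧ IsListing z ω (c₀ ∘ e) ∧ ∀ ℓ, c ℓ = ∑ i, c₀ (e ℓ) i := by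
  have hr : Set.range ω = Set.range ω₀ := hd.range_eq.trans h.isDishList.range_eq.symm
  let e : Fin K ≃ Fin K' := (Equiv.ofInjective ω hd.injective).trans
    ((Equiv.setCongr hr).trans (Equiv.ofInjective ω₀ h.injective).symm)
  have he : ∀ ℓ, ω₀ (e ℓ) = ω ℓ := fun ℓ => by
    have : (Equiv.ofInjective ω₀ h.injective) (e ℓ) = (Equiv.setCongr hr)
        (Equiv.ofInjective ω hd.injective ℓ) := by simp [e]
    exact congrArg Subtype.val this
  have hω : ω = ω₀ ∘ e := funext fun ℓ => (he ℓ).symm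
  refine ⟨e, hω, ⟨hd.injective, fun ℓ => h.ne_zero _, fun i j => ?_⟩, fun ℓ => funext fun j => ?_⟩
  · rw [h.eq_sum i j, ← e.sum_comp]
    simp [hω]
  · have := hd.count ℓ j
    rw [← he ℓ] at this
    simp only [h.apply_singleton] at this
    rw [Finset.sum_apply]
    exact_mod_cast this.symm

end DishList

/-! ### The posterior of the points of a multinomial IBP model -/

lemma setLIntegral_markedIntensity {q n : ℕ} {Ω : Type*} [MeasurableSpace Ω] {D C : Type*}
    [MeasurableSpace D] [MeasurableSpace C] [Zero C] [MeasurableSingletonClass C]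
    (ν : Measure ((Fin q → ℝ) × Ω)) {δ : (Fin q → ℝ) → (Fin n → Fin q → ℕ) → D}
    (hδ : ∀ a, Measurable fun s => δ s a) (γ : (Fin n → Fin q → ℕ) → C)
    {G : (D × Ω) × C → ℝ≥0∞} (hG : Measurable G) :
    open scoped Classical in ∫⁻ x in {x | x.2 ≠ 0}, G x ∂markedIntensity ν δ γ =
      ∑' a, if γ a = 0 then 0 else
        ∫⁻ e, G ((δ e.1 a, e.2), γ a) * markWeight e.1 a ∂ν := by
  classical
  have hm : MeasurableSet {x : (D × Ω) × C | x.2 ≠ 0} :=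
    (measurable_snd (measurableSet_singleton 0)).compl
  rw [← lintegral_indicator hm, lintegral_markedIntensity ν hδ γ (hG.indicator hm)]
  refine tsum_congr fun a => ?_
  by_cases ha : γ a = 0
  · rw [if_pos ha, lintegral_congr (g := fun _ => 0), lintegral_zero]
    intro e
    rw [Set.indicator_of_notMem (by simpa using ha), zero_mul]
  · rw [if_neg ha]
    refine lintegral_congr fun e => ?_
    rw [Set.indicator_of_mem (by exact ha)]

lemma setLIntegral_markedIntensity_zero {q n : ℕ} {Ω : Type*} [MeasurableSpace Ω] {D C : Type*}
    [MeasurableSpace D] [MeasurableSpace C] [Zero C] [MeasurableSingletonClass C]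
    (ν : Measure ((Fin q → ℝ) × Ω)) {δ : (Fin q → ℝ) → (Fin n → Fin q → ℕ) → D}
    (hδ : ∀ a, Measurable fun s => δ s a) (γ : (Fin n → Fin q → ℕ) → C)
    {G : (D × Ω) × C → ℝ≥0∞} (hG : Measurable G) :
    open scoped Classical in ∫⁻ x in {x | x.2 = 0}, G x ∂markedIntensity ν δ γ =
      ∑' a, if γ a = 0 then ∫⁻ e, G ((δ e.1 a, e.2), γ a) * markWeight e.1 a ∂ν else 0 := by
  classical
  have hm : MeasurableSet {x : (D × Ω) × C | x.2 = 0} :=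
    measurable_snd (measurableSet_singleton 0)
  rw [← lintegral_indicator hm, lintegral_markedIntensity ν hδ γ (hG.indicator hm)]
  refine tsum_congr fun a => ?_
  by_cases ha : γ a = 0
  · rw [if_pos ha]
    refine lintegral_congr fun e => ?_
    rw [Set.indicator_of_mem (by exact ha)]
  · rw [if_neg ha, lintegral_congr (g := fun _ => 0), lintegral_zero]
    intro e
    rw [Set.indicator_of_notMem (by exact ha), zero_mul]

lemma lintegral_updatedIntensity {q : ℕ} {Ω : Type*} [MeasurableSpace Ω]
    (ρ : Kernel Ω (Fin q → ℝ)) (B₀ : Measure Ω) (M : ℕ) {f : (Fin q → ℝ) × Ω → ℝ≥0∞}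
    (hf : Measurable f) :
    ∫⁻ e, f e ∂updatedIntensity ρ B₀ M =
      ∫⁻ e, f e * ENNReal.ofReal ((1 - ∑ j, e.1 j) ^ M) ∂intensity ρ B₀ := by
  rw [updatedIntensity, lintegral_withDensity_eq_lintegral_mul _ (by fun_prop) hf]
  refine lintegral_congr fun e => ?_
  rw [Pi.mul_apply, mul_comm]

lemma IsPRM.map_id {𝒲 E : Type*} [MeasurableSpace 𝒲] [MeasurableSpace E] {P : Measure 𝒲}
    [IsProbabilityMeasure P] {ν : Measure E} {N : 𝒲 → Measure E} (hN : Measurable N)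
    (h : ∀ f : E → ℝ≥0∞, Measurable f →
      ∫⁻ w, expNeg (∫⁻ x, f x ∂N w) ∂P = expNeg (∫⁻ x, (1 - expNeg (f x)) ∂ν)) :
    IsPRM (P.map N) ν id := by
  have : IsProbabilityMeasure (P.map N) := Measure.isProbabilityMeasure_map hN.aemeasurable
  refine isPRM_of_laplace measurable_id fun f hf => ?_
  simp only [id_eq]
  rw [← h f hf, lintegral_map (f := fun m : Measure E => expNeg (∫⁻ x, f x ∂m))
    (measurable_expNeg.comp (Measure.measurable_lintegral hf)) hN]

section Posterior

variable {q M : ℕ} {Ω : Type u} {𝒲 : Type v} [MeasurableSpace Ω] [StandardBorelSpace Ω]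
  [Nonempty Ω] [MeasurableSpace 𝒲] {P : Measure 𝒲} [IsProbabilityMeasure P]
  {ρ : Kernel Ω (Fin q → ℝ)} [IsSFiniteKernel ρ] {B₀ : Measure Ω} [SFinite B₀]
  [NullSingletonClass B₀] {p : ℕ → 𝒲 → Fin q → ℝ} {θ : ℕ → 𝒲 → Ω}

omit [Nonempty Ω] in
lemma IsIBPModel.isMarkedPoisson_points {b : Fin M → ℕ → 𝒲 → Fin q → ℕ}
    (h : IsIBPModel P (intensity ρ B₀) p θ b) (hq : 0 < q) (hρ : ∀ ω, ρ ω (simplex q)ᶜ = 0)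
    (hρ_int : ∫⁻ ω, ∫⁻ s, ENNReal.ofReal (∑ j, s j) ∂ρ ω ∂B₀ < ∞) :
    IsMarkedPoisson P p θ (fun k w i => b i k w) (fun k => {w | p k w ≠ 0})
      (markedIntensity (intensity ρ B₀) (fun s _ => s) fun a => a) :=
  h.isMarkedPoisson (ae_intensity_mem_simplex hρ) (lintegral_sum_intensity_lt_top hρ_int) hq
    intensity_label_null le_rfl (δ := fun s _ => s) fun _ => measurable_id

-- A point of jump `s` is unchosen with probability `(1 - s_·)^M`, so the unchosen points have the
-- updated intensity.
omit [Nonempty Ω] in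
lemma IsIBPModel.laplace_unmarked {b : Fin M → ℕ → 𝒲 → Fin q → ℕ}
    (h : IsIBPModel P (intensity ρ B₀) p θ b) (hq : 0 < q) (hρ : ∀ ω, ρ ω (simplex q)ᶜ = 0)
    (hρ_int : ∫⁻ ω, ∫⁻ s, ENNReal.ofReal (∑ j, s j) ∂ρ ω ∂B₀ < ∞)
    {f : (Fin q → ℝ) × Ω → ℝ≥0∞} (hf : Measurable f) :
    ∫⁻ w, expNeg (∫⁻ x, f x ∂unmarked p θ (fun k w i => b i k w) (fun k => {w | p k w ≠ 0}) w) ∂P =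
      expNeg (∫⁻ x, (1 - expNeg (f x)) ∂updatedIntensity ρ B₀ M) := by
  classical
  rw [(h.isMarkedPoisson_points hq hρ hρ_int).laplace_unmarked hf,
    setLIntegral_markedIntensity_zero _ (δ := fun s _ => s) (fun _ => measurable_id) _
      (G := fun x => 1 - expNeg (f x.1)) (by fun_prop), lintegral_updatedIntensity _ _ _ (by fun_prop),
      tsum_eq_single (0 : Fin M → Fin q → ℕ), if_pos rfl]
  · congr 1
    refine lintegral_congr_ae ((ae_intensity_mem_simplex hρ).mono fun e he => ?_)
    exact congrArg _ (markWeight_zero he)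
  · exact fun a ha => if_neg ha

/-- The disintegration required by the abstract theorem is `lintegral_markWeight_jumpKernel`, summed
over the nonzero arrays. -/
theorem IsIBPModel.exists_posterior {b : Fin M → ℕ → 𝒲 → Fin q → ℕ}
    (h : IsIBPModel P (intensity ρ B₀) p θ b) (hq : 0 < q) (hρ : ∀ ω, ρ ω (simplex q)ᶜ = 0)
    (hρ_int : ∫⁻ ω, ∫⁻ s, ENNReal.ofReal (∑ j, s j) ∂ρ ω ∂B₀ < ∞) :
    ∃ (Q : Measure (Measure ((Fin q → ℝ) × Ω))) (_ : IsProbabilityMeasure Q)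
      (post : Kernel (Fin M → Fin q → Measure Ω) (Measure ((Fin q → ℝ) × Ω))),
      IsMarkovKernel post ∧ IsPRM Q (updatedIntensity ρ B₀ M) id ∧
      HasCondDistrib (pointProcess p θ) (countPattern θ fun k w i => b i k w) post P ∧
      ∀ {K : ℕ} {z : Fin M → Fin q → Measure Ω} {ω : Fin K → Ω} {c : Fin K → Fin M → Fin q → ℕ},
        IsListing z ω c → post z = addPoints Q (fun ℓ => jumpKernel ρ M (ω ℓ, c ℓ)) ω := by
  classical
  have hδ : ∀ a : Fin M → Fin q → ℕ, Measurable fun s : Fin q → ℝ => s := fun _ => measurable_id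
  have hmp := h.isMarkedPoisson_points hq hρ hρ_int
  have := isMarkovKernel_jumpKernel hρ M
  obtain ⟨post, hpost, hcd, hlist⟩ := hmp.exists_posterior (jumpKernel ρ M) fun g hg => by
    rw [setLIntegral_markedIntensity _ hδ _ hg, setLIntegral_markedIntensity _ hδ _
      (G := fun x => ∫⁻ d', g ((d', x.1.2), x.2) ∂jumpKernel ρ M (x.1.2, x.2)) ?_]
    · refine tsum_congr fun a => ?_
      split_ifs with ha
      · rfl
      · exact lintegral_markWeight_jumpKernel hρ hρ_int (h := fun e => g ((e.1, e.2), a)) ha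
          (by fun_prop)
    · exact Measurable.lintegral_kernel_prod_right'
        (κ := (jumpKernel ρ M).comap (fun x : (((Fin q → ℝ) × Ω) × (Fin M → Fin q → ℕ)) =>
          (x.1.2, x.2)) (by fun_prop))
        (f := fun y => g ((y.2, y.1.1.2), y.1.2)) (by fun_prop)
  have hQ := hmp.measurable_unmarked
  refine ⟨_, Measure.isProbabilityMeasure_map hQ.aemeasurable, post, hpost,
    IsPRM.map_id hQ fun f hf => ?_, ?_, hlist⟩
  · exact h.laplace_unmarked hq hρ hρ_int hf
  · rw [pointProcess_eq_activeSum]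
    exact hcd

end Posterior

/-! ### The posterior of the points with the marks of the next customer -/

section MarkKernel

variable {q : ℕ}

lemma lintegral_multinomial (s : Fin q → ℝ) (g : (Fin q → ℕ) → ℝ≥0∞) :
    ∫⁻ a, g a ∂multinomial q s = ∑' a, g a * ENNReal.ofReal (multinomialPMF s a) := by
  change ∫⁻ a, g a ∂(Measure.sum fun a : Fin q → ℕ =>
    ENNReal.ofReal (multinomialPMF s a) • Measure.dirac a) = _
  rw [lintegral_sum_measure]
  refine tsum_congr fun a => ?_
  rw [lintegral_smul_measure, lintegral_dirac, smul_eq_mul, mul_comm]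

variable {Ω : Type u} [MeasurableSpace Ω]

/-- The posterior kernel of a jump vector together with the mark of the next customer. -/
def jumpMarkKernel (ρ : Kernel Ω (Fin q → ℝ)) [IsSFiniteKernel ρ] (M : ℕ) :
    Kernel (Ω × (Fin M → Fin q → ℕ)) ((Fin q → ℝ) × (Fin q → ℕ)) :=
  jumpKernel ρ M ⊗ₖ (multinomial q).prodMkLeft _

variable {ρ : Kernel Ω (Fin q → ℝ)} [IsSFiniteKernel ρ] {M : ℕ}

lemma lintegral_jumpMarkKernel (hρ : ∀ ω, ρ ω (simplex q)ᶜ = 0) (x : Ω × (Fin M → Fin q → ℕ))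
    {g : (Fin q → ℝ) × (Fin q → ℕ) → ℝ≥0∞} (hg : Measurable g) :
    ∫⁻ y, g y ∂jumpMarkKernel ρ M x =
      ∫⁻ s, ∑' a, g (s, a) * ENNReal.ofReal (multinomialPMF s a) ∂jumpKernel ρ M x := by
  have := isMarkovKernel_jumpKernel hρ M
  rw [jumpMarkKernel, Kernel.lintegral_compProd _ _ _ hg]
  refine lintegral_congr fun s => ?_
  rw [Kernel.prodMkLeft_apply, lintegral_multinomial]

lemma isMarkovKernel_jumpMarkKernel (hρ : ∀ ω, ρ ω (simplex q)ᶜ = 0) (M : ℕ) :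
    IsMarkovKernel (jumpMarkKernel ρ M) := by
  have := isMarkovKernel_jumpKernel hρ M
  refine ⟨fun x => ⟨?_⟩⟩
  rw [← lintegral_one, lintegral_jumpMarkKernel hρ x (g := fun _ => 1) measurable_const]
  rw [lintegral_congr_ae (g := fun _ => 1), lintegral_one, measure_univ]
  filter_upwards [jumpKernel_ae_mem_simplex hρ x] with s hs
  simpa using tsum_multinomialPMF_eq_one (Or.inl hs)

lemma jumpMarkKernel_apply (hρ : ∀ ω, ρ ω (simplex q)ᶜ = 0) {ω : Ω}
    {a : Fin M → Fin q → ℕ} (h : IsRegular ρ M (∑ i, a i) ω) :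
    jumpMarkKernel ρ M (ω, a) = jumpLaw ρ M (∑ i, a i) ω ⊗ₘ multinomial q := by
  have := h.isProbabilityMeasure hρ
  refine Measure.ext_of_lintegral _ fun g hg => ?_
  rw [lintegral_jumpMarkKernel hρ _ hg, Measure.lintegral_compProd hg, jumpKernel_apply h]
  exact lintegral_congr fun s => (lintegral_multinomial _ _).symm

lemma markWeight_castSucc (s : Fin q → ℝ) (a : Fin (M + 1) → Fin q → ℕ) :
    markWeight s a = markWeight s (fun i : Fin M => a i.castSucc) *
      ENNReal.ofReal (multinomialPMF s (a (Fin.last M))) :=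
  Fin.prod_univ_castSucc _

lemma tsum_snoc {X : Type*} (f : (Fin (M + 1) → X) → ℝ≥0∞) :
    ∑' a, f a = ∑' (a : Fin M → X) (b : X), f (Fin.snoc (α := fun _ => X) a b) := by
  rw [← (Fin.snocEquiv fun _ => X).tsum_eq, ENNReal.tsum_prod', ENNReal.tsum_comm]
  rfl

end MarkKernel

/-! ### Recovering the point process and the feature process from a marked configuration -/

section SplitMarks

variable {q : ℕ} {Ω : Type*} [MeasurableSpace Ω]

/-- The point process and the feature process of a configuration of points with marks. -/
def splitMarks (W : Measure (((Fin q → ℝ) × (Fin q → ℕ)) × Ω)) :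
    Measure ((Fin q → ℝ) × Ω) × (Fin q → Measure Ω) :=
  (W.map fun x => (x.1.1, x.2), fun j => (W.withDensity fun x => (x.1.2 j : ℝ≥0∞)).map Prod.snd)

lemma measurable_markValue (j : Fin q) :
    Measurable fun x : ((Fin q → ℝ) × (Fin q → ℕ)) × Ω => (x.1.2 j : ℝ≥0∞) :=
  (Measurable.of_discrete (f := fun a : Fin q → ℕ => (a j : ℝ≥0∞))).comp
    (measurable_snd.comp measurable_fst)

lemma splitMarks_snd_apply (W : Measure (((Fin q → ℝ) × (Fin q → ℕ)) × Ω)) (j : Fin q)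
    {A : Set Ω} (hA : MeasurableSet A) :
    (splitMarks W).2 j A = ∫⁻ x, (x.1.2 j : ℝ≥0∞) * A.indicator 1 x.2 ∂W := by
  change ((W.withDensity fun x => (x.1.2 j : ℝ≥0∞)).map Prod.snd) A = _
  rw [Measure.map_apply measurable_snd hA, withDensity_apply _ (measurable_snd hA),
    ← lintegral_indicator (measurable_snd hA)]
  refine lintegral_congr fun x => ?_
  by_cases hx : x.2 ∈ A
  · rw [Set.indicator_of_mem (by exact hx), Set.indicator_of_mem hx]
    simp
  · rw [Set.indicator_of_notMem (by exact hx), Set.indicator_of_notMem hx]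
    simp

lemma measurable_splitMarks : Measurable (splitMarks (q := q) (Ω := Ω)) := by
  refine (Measure.measurable_map _ (by fun_prop)).prodMk (measurable_pi_iff.mpr fun j => ?_)
  refine Measure.measurable_of_measurable_coe _ fun A hA => ?_
  have : (fun W : Measure (((Fin q → ℝ) × (Fin q → ℕ)) × Ω) => (splitMarks W).2 j A) =
      fun W => ∫⁻ x, (x.1.2 j : ℝ≥0∞) * A.indicator 1 x.2 ∂W :=
    funext fun W => splitMarks_snd_apply W j hA
  exact this ▸ Measure.measurable_lintegral ((measurable_markValue j).mul
    ((measurable_one.indicator hA).comp measurable_snd))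

lemma splitMarks_add_sum_dirac {K : ℕ} (W : Measure (((Fin q → ℝ) × (Fin q → ℕ)) × Ω))
    (d : Fin K → (Fin q → ℝ) × (Fin q → ℕ)) (ω : Fin K → Ω) :
    splitMarks (W + ∑ ℓ, Measure.dirac (d ℓ, ω ℓ)) =
      ((splitMarks W).1 + ∑ ℓ, Measure.dirac ((d ℓ).1, ω ℓ),
        fun j => (splitMarks W).2 j + ∑ ℓ, ((d ℓ).2 j : ℝ≥0∞) • Measure.dirac (ω ℓ)) := by
  have hm : Measurable fun x : ((Fin q → ℝ) × (Fin q → ℕ)) × Ω => (x.1.1, x.2) := by fun_prop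
  refine Prod.ext ?_ (funext fun j => ?_)
  · change Measure.map _ _ = Measure.map _ _ + _
    rw [Measure.map_add _ _ hm]
    congr 1
    refine Measure.ext fun A hA => ?_
    rw [Measure.map_apply hm hA, Measure.finsetSum_apply, Measure.finsetSum_apply]
    refine Finset.sum_congr rfl fun ℓ _ => ?_
    rw [Measure.dirac_apply' _ (hm hA), Measure.dirac_apply' _ hA]
    rfl
  · refine Measure.ext fun A hA => ?_
    rw [splitMarks_snd_apply _ _ hA, lintegral_add_measure, Measure.add_apply,
      splitMarks_snd_apply _ _ hA, lintegral_finsetSum_measure, Measure.finsetSum_apply]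
    congr 1
    refine Finset.sum_congr rfl fun ℓ _ => ?_
    rw [lintegral_dirac' (f := fun x : ((Fin q → ℝ) × (Fin q → ℕ)) × Ω =>
        (x.1.2 j : ℝ≥0∞) * A.indicator 1 x.2) _ ((measurable_markValue j).mul
      ((measurable_one.indicator hA).comp measurable_snd)), Measure.smul_apply,
      Measure.dirac_apply' _ hA, smul_eq_mul]

/-- The auxiliary `p'` and `b'` allow two uses: all points with the choices of the last customer,
and the unchosen points, where chosen indices are reset to zero. -/
lemma splitMarks_activeSum {𝒲 : Type*} {p : ℕ → 𝒲 → Fin q → ℝ} {θ : ℕ → 𝒲 → Ω}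
    {b : ℕ → 𝒲 → Fin q → ℕ} {S : ℕ → Set 𝒲} {w : 𝒲} {p' : ℕ → 𝒲 → Fin q → ℝ}
    {b' : ℕ → 𝒲 → Fin q → ℕ} (hin : ∀ k, w ∈ S k → p' k w = p k w ∧ b' k w = b k w ∧ p k w ≠ 0)
    (hout : ∀ k, w ∉ S k → p' k w = 0 ∧ b' k w = 0) :
    splitMarks (activeSum S (fun k w => ((p k w, b k w), θ k w)) w) =
      (pointProcess p' θ w, featureProcess b' θ w) := by
  classical
  have hm : Measurable fun x : ((Fin q → ℝ) × (Fin q → ℕ)) × Ω => (x.1.1, x.2) := by fun_prop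
  refine Prod.ext ?_ (funext fun j => ?_)
  · refine Measure.ext_of_lintegral _ fun f hf => ?_
    change ∫⁻ x, f x ∂Measure.map _ _ = _
    rw [lintegral_map hf hm, lintegral_activeSum _ _ _
      (f := fun x : ((Fin q → ℝ) × (Fin q → ℕ)) × Ω => f (x.1.1, x.2)) (hf.comp hm),
      pointProcess_eq_activeSum, lintegral_activeSum _ _ _ hf]
    refine tsum_congr fun k => ?_
    by_cases hk : w ∈ S k
    · obtain ⟨h1, _, h3⟩ := hin k hk
      rw [if_pos hk, if_pos (show w ∈ {w | p' k w ≠ 0} from h1.trans_ne h3), h1]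
    · rw [if_neg hk, if_neg (show w ∉ {w | p' k w ≠ 0} from not_not.mpr (hout k hk).1)]
  · refine Measure.ext fun A hA => ?_
    rw [splitMarks_snd_apply _ _ hA, lintegral_activeSum _ _ _
      (f := fun x : ((Fin q → ℝ) × (Fin q → ℕ)) × Ω => (x.1.2 j : ℝ≥0∞) * A.indicator 1 x.2)
      ((measurable_markValue j).mul
      ((measurable_one.indicator hA).comp measurable_snd))]
    simp only [featureProcess, Measure.sum_apply _ hA, Measure.smul_apply,
      Measure.dirac_apply' _ hA, smul_eq_mul]
    refine tsum_congr fun k => ?_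
    by_cases hk : w ∈ S k
    · rw [if_pos hk, (hin k hk).2.1]
    · rw [if_neg hk, (hout k hk).2]
      simp

end SplitMarks

/-! ### Conditional law of the points together with the next customer's choices -/

section Prediction

variable {q M : ℕ} {Ω : Type u} {𝒲 : Type v} [MeasurableSpace Ω] [StandardBorelSpace Ω]
  [Nonempty Ω] [MeasurableSpace 𝒲] {P : Measure 𝒲} [IsProbabilityMeasure P]
  {ρ : Kernel Ω (Fin q → ℝ)} [IsSFiniteKernel ρ] {B₀ : Measure Ω} [SFinite B₀]
  [NullSingletonClass B₀] {p : ℕ → 𝒲 → Fin q → ℝ} {θ : ℕ → 𝒲 → Ω}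

-- The weight of `M + 1` choices factors into that of the first `M` and `M(1, s)` for the last.
-- Summing out the last choice on the left gives a function of the jump alone, covered by
-- `lintegral_markWeight_jumpKernel`. On the right the last factor sums to one.
omit [StandardBorelSpace Ω] [Nonempty Ω] [NullSingletonClass B₀] in
lemma setLIntegral_markedIntensity_jumpMarkKernel (hρ : ∀ ω, ρ ω (simplex q)ᶜ = 0)
    (hρ_int : ∫⁻ ω, ∫⁻ s, ENNReal.ofReal (∑ j, s j) ∂ρ ω ∂B₀ < ∞)
    {g : (((Fin q → ℝ) × (Fin q → ℕ)) × Ω) × (Fin M → Fin q → ℕ) → ℝ≥0∞} (hg : Measurable g) :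
    let Λ := markedIntensity (intensity ρ B₀) (fun s (a : Fin (M + 1) → Fin q → ℕ) =>
      (s, a (Fin.last M))) fun a i => a (Fin.castSucc i)
    ∫⁻ x in {x | x.2 ≠ 0}, g x ∂Λ =
      ∫⁻ x in {x | x.2 ≠ 0}, ∫⁻ d, g ((d, x.1.2), x.2) ∂jumpMarkKernel ρ M (x.1.2, x.2) ∂Λ := by
  classical
  intro Λ
  have hν := ae_intensity_mem_simplex (B₀ := B₀) hρ
  have hδ : ∀ a : Fin (M + 1) → Fin q → ℕ, Measurable fun s : Fin q → ℝ => (s, a (Fin.last M)) :=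
    fun _ => by fun_prop
  have := isMarkovKernel_jumpMarkKernel hρ M
  have hJm : Measurable fun x : (((Fin q → ℝ) × (Fin q → ℕ)) × Ω) × (Fin M → Fin q → ℕ) =>
      ∫⁻ d, g ((d, x.1.2), x.2) ∂jumpMarkKernel ρ M (x.1.2, x.2) :=
    Measurable.lintegral_kernel_prod_right'
      (κ := (jumpMarkKernel ρ M).comap
        (fun x : (((Fin q → ℝ) × (Fin q → ℕ)) × Ω) × (Fin M → Fin q → ℕ) => (x.1.2, x.2))
        (by fun_prop))
      (f := fun y => g ((y.2, y.1.1.2), y.1.2)) (by fun_prop)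
  have hpmf : ∀ a : Fin q → ℕ, Measurable fun s : Fin q → ℝ =>
      ENNReal.ofReal (multinomialPMF s a) := fun a => (measurable_multinomialPMF a).ennreal_ofReal
  rw [setLIntegral_markedIntensity _ hδ _ hg, setLIntegral_markedIntensity _ hδ _ hJm,
    tsum_snoc, tsum_snoc]
  refine tsum_congr fun a => ?_
  simp only [Fin.snoc_castSucc, Fin.snoc_last, markWeight_castSucc]
  by_cases ha : a = 0
  · refine tsum_congr fun c => ?_
    rw [if_pos (by exact ha), if_pos (by exact ha)]
  simp only [ha, if_false]
  have hmw : Measurable fun e : (Fin q → ℝ) × Ω => markWeight e.1 a :=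
    (measurable_markWeight a).comp measurable_fst
  have hJa : Measurable fun e : (Fin q → ℝ) × Ω =>
      ∫⁻ d, g ((d, e.2), a) ∂jumpMarkKernel ρ M (e.2, a) :=
    hJm.comp (f := fun e : (Fin q → ℝ) × Ω => (((e.1, (0 : Fin q → ℕ)), e.2), a)) (by fun_prop)
  rw [← lintegral_tsum fun c => Measurable.aemeasurable ?_,
    ← lintegral_tsum fun c => Measurable.aemeasurable ?_]
  · have key := lintegral_markWeight_jumpKernel hρ hρ_int (B₀ := B₀) ha (h := fun e =>
      ∑' c, g (((e.1, c), e.2), a) * ENNReal.ofReal (multinomialPMF e.1 c))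
      (Measurable.tsum fun c => Measurable.mul (by fun_prop) ((hpmf c).comp measurable_fst))
    refine (lintegral_congr fun e => ?_).trans (key.trans (lintegral_congr_ae ?_))
    · rw [← ENNReal.tsum_mul_right]
      exact tsum_congr fun c => by ring
    · filter_upwards [hν] with e he
      have hs := tsum_multinomialPMF_eq_one (Or.inl he)
      rw [lintegral_jumpMarkKernel hρ _ (g := fun d => g ((d, e.2), a)) (by fun_prop)]
      simp only [← mul_assoc]
      rw [ENNReal.tsum_mul_left, hs, mul_one]
  · exact hJa.mul (hmw.mul ((hpmf c).comp measurable_fst))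
  · exact Measurable.mul (by fun_prop) (hmw.mul ((hpmf c).comp measurable_fst))

theorem IsIBPModel.exists_prediction {b : Fin (M + 1) → ℕ → 𝒲 → Fin q → ℕ}
    (h : IsIBPModel P (intensity ρ B₀) p θ b) (hq : 0 < q) (hρ : ∀ ω, ρ ω (simplex q)ᶜ = 0)
    (hρ_int : ∫⁻ ω, ∫⁻ s, ENNReal.ofReal (∑ j, s j) ∂ρ ω ∂B₀ < ∞) :
    ∃ post : Kernel (Fin M → Fin q → Measure Ω)
        (Measure (((Fin q → ℝ) × (Fin q → ℕ)) × Ω)), IsMarkovKernel post ∧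
      HasCondDistrib (activeSum (fun k => {w | p k w ≠ 0}) fun k w =>
          ((p k w, b (Fin.last M) k w), θ k w))
        (countPattern θ fun k w (i : Fin M) => b i.castSucc k w) post P ∧
      ∀ {K : ℕ} {z : Fin M → Fin q → Measure Ω} {ω : Fin K → Ω} {c : Fin K → Fin M → Fin q → ℕ},
        IsListing z ω c → post z = addPoints (P.map (unmarked
            (fun k w => (p k w, b (Fin.last M) k w)) θ (fun k w (i : Fin M) => b i.castSucc k w)
            fun k => {w | p k w ≠ 0}))
          (fun ℓ => jumpMarkKernel ρ M (ω ℓ, c ℓ)) ω := by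
  have hν := ae_intensity_mem_simplex (B₀ := B₀) hρ
  have hδ : ∀ a : Fin (M + 1) → Fin q → ℕ, Measurable fun s : Fin q → ℝ => (s, a (Fin.last M)) :=
    fun _ => by fun_prop
  have hmp : IsMarkedPoisson P (fun k w => (p k w, b (Fin.last M) k w)) θ
      (fun k w (i : Fin M) => b i.castSucc k w) (fun k => {w | p k w ≠ 0})
      (markedIntensity (intensity ρ B₀) (fun s (a : Fin (M + 1) → Fin q → ℕ) =>
        (s, a (Fin.last M))) fun a i => a (Fin.castSucc i)) :=
    h.isMarkedPoisson hν (lintegral_sum_intensity_lt_top hρ_int) hq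
      intensity_label_null (Nat.le_succ M) (δ := fun s a => (s, a (Fin.last M))) hδ
  have := isMarkovKernel_jumpMarkKernel hρ M
  exact hmp.exists_posterior (jumpMarkKernel ρ M) fun g hg =>
    setLIntegral_markedIntensity_jumpMarkKernel hρ hρ_int hg

end Prediction

/-! ### A criterion for the law of a pair of a point process and a feature process -/

section ProductMarks

variable {q : ℕ} {Ω 𝒲 : Type*} [MeasurableSpace Ω] [MeasurableSpace 𝒲]

/-- The integrated form of the conditional independence of the marks `b k` given the points, with
conditional laws `M(1, p k)`. -/
def HasProductMarks (P : Measure 𝒲) (p : ℕ → 𝒲 → Fin q → ℝ) (θ : ℕ → 𝒲 → Ω)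
    (b : ℕ → 𝒲 → Fin q → ℕ) : Prop :=
  ∀ (m : ℕ) (g : ℕ → (Fin q → ℝ) × Ω → (Fin q → ℕ) → ℝ≥0∞), (∀ k a, Measurable fun e => g k e a) →
    ∫⁻ w, ∏ k : Fin m, g k (p k w, θ k w) (b k w) ∂P =
      ∫⁻ w, ∏ k : Fin m, ∑' a, g k (p k w, θ k w) a * ENNReal.ofReal (multinomialPMF (p k w) a) ∂P

variable {P : Measure 𝒲} {p : ℕ → 𝒲 → Fin q → ℝ} {θ : ℕ → 𝒲 → Ω} {b : ℕ → 𝒲 → Fin q → ℕ}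

lemma multinomialPMF_le_one {s : Fin q → ℝ} (hs : s ∈ simplex q ∨ s = 0) (a : Fin q → ℕ) :
    multinomialPMF s a ≤ 1 := by
  rw [← ENNReal.ofReal_le_one, ← tsum_multinomialPMF_eq_one hs]
  exact ENNReal.le_tsum (f := fun a => ENNReal.ofReal (multinomialPMF s a)) a

/-- Test functions are products of indicators for the cylinder and the event. Indices outside `F`
disappear because their point masses sum to one. -/
lemma HasProductMarks.measure_inter (h : HasProductMarks P p θ b)
    (hp : ∀ᵐ w ∂P, ∀ k, p k w ∈ simplex q ∨ p k w = 0) (hpm : ∀ k, Measurable (p k))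
    (hθm : ∀ k, Measurable (θ k)) (hbm : ∀ k, Measurable (b k)) (s F : Finset ℕ)
    {t : ℕ → Set ((Fin q → ℝ) × Ω)} (ht : ∀ k, MeasurableSet (t k)) (a : ℕ → Fin q → ℕ) :
    P (pointSeq p θ ⁻¹' (s : Set ℕ).pi t ∩ {w | ∀ k ∈ F, b k w = a k}) =
      ∫⁻ w in pointSeq p θ ⁻¹' (s : Set ℕ).pi t,
        ∏ k ∈ F, ENNReal.ofReal (multinomialPMF (p k w) (a k)) ∂P := by
  classical
  obtain ⟨m, hm⟩ : ∃ m, s ∪ F ⊆ Finset.range m := (s ∪ F).exists_nat_subset_range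
  have hs : s ⊆ Finset.range m := Finset.subset_union_left.trans hm
  have hF : F ⊆ Finset.range m := Finset.subset_union_right.trans hm
  have hU : Measurable (pointSeq p θ) := measurable_pi_iff.mpr fun k => (hpm k).prodMk (hθm k)
  have hcyl : MeasurableSet (pointSeq p θ ⁻¹' (s : Set ℕ).pi t) :=
    hU (MeasurableSet.pi s.countable_toSet fun k _ => ht k)
  have hE : MeasurableSet {w | ∀ k ∈ F, b k w = a k} := by
    have : {w | ∀ k ∈ F, b k w = a k} = ⋂ k ∈ F, b k ⁻¹' {a k} := by ext; simp
    rw [this]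
    exact F.measurableSet_biInter fun k _ => hbm k (measurableSet_singleton _)
  have hprod : ∀ (x y : ℕ → ℝ≥0∞), ∏ k : Fin m,
      ((if (k : ℕ) ∈ s then x k else 1) * if (k : ℕ) ∈ F then y k else 1) =
        (∏ k ∈ s, x k) * ∏ k ∈ F, y k := by
    intro x y
    rw [Fin.prod_univ_eq_prod_range (fun k => (if k ∈ s then x k else 1) * if k ∈ F then y k else 1),
      Finset.prod_mul_distrib, Finset.prod_ite_mem, Finset.prod_ite_mem,
      Finset.inter_eq_right.mpr hs, Finset.inter_eq_right.mpr hF]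
  have hind : ∀ w, ∏ k ∈ s, (t k).indicator (1 : (Fin q → ℝ) × Ω → ℝ≥0∞) (p k w, θ k w) =
      (pointSeq p θ ⁻¹' (s : Set ℕ).pi t).indicator 1 w := by
    intro w
    by_cases hw : w ∈ pointSeq p θ ⁻¹' (s : Set ℕ).pi t
    · rw [Set.indicator_of_mem hw]
      exact Finset.prod_eq_one fun k hk => Set.indicator_of_mem (hw k hk) _
    · rw [Set.indicator_of_notMem hw]
      obtain ⟨k, hk, hkt⟩ : ∃ k ∈ s, (p k w, θ k w) ∉ t k := by
        by_contra! hall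
        exact hw fun k hk => hall k hk
      exact Finset.prod_eq_zero hk (Set.indicator_of_notMem hkt _)
  have hev : ∀ w, ∏ k ∈ F, (if b k w = a k then (1 : ℝ≥0∞) else 0) =
      {w | ∀ k ∈ F, b k w = a k}.indicator 1 w := by
    intro w
    by_cases hw : w ∈ {w | ∀ k ∈ F, b k w = a k}
    · rw [Set.indicator_of_mem hw]
      exact Finset.prod_eq_one fun k hk => if_pos (hw k hk)
    · rw [Set.indicator_of_notMem hw]
      obtain ⟨k, hk, hkt⟩ : ∃ k ∈ F, b k w ≠ a k := by
        by_contra! hall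
        exact hw hall
      exact Finset.prod_eq_zero hk (if_neg hkt)
  have key := h m (fun k e β => (if k ∈ s then (t k).indicator 1 e else 1) *
      if k ∈ F then (if β = a k then 1 else 0) else 1) fun k β => by
    refine Measurable.mul ?_ ?_
    · split_ifs
      · exact measurable_one.indicator (ht k)
      · exact measurable_const
    · exact measurable_const
  rw [← lintegral_indicator_one (hcyl.inter hE), ← lintegral_indicator hcyl]
  refine Eq.trans (lintegral_congr fun w => ?_) (key.trans (lintegral_congr_ae ?_))
  · rw [hprod (fun k => (t k).indicator 1 (p k w, θ k w)) fun k => if b k w = a k then 1 else 0,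
      hind, hev]
    by_cases h1 : w ∈ pointSeq p θ ⁻¹' (s : Set ℕ).pi t <;>
      by_cases h2 : w ∈ {w | ∀ k ∈ F, b k w = a k} <;> simp [Set.indicator, h1, h2]
  · filter_upwards [hp] with w hw
    have hk : ∀ k : Fin m, ∑' β : Fin q → ℕ,
        (if (k : ℕ) ∈ s then (t k).indicator (1 : (Fin q → ℝ) × Ω → ℝ≥0∞) (p k w, θ k w) else 1) *
          (if (k : ℕ) ∈ F then (if β = a k then 1 else 0) else 1) *
          ENNReal.ofReal (multinomialPMF (p k w) β) =
        (if (k : ℕ) ∈ s then (t k).indicator 1 (p k w, θ k w) else 1) *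
          if (k : ℕ) ∈ F then ENNReal.ofReal (multinomialPMF (p k w) (a k)) else 1 := by
      intro k
      simp only [mul_assoc]
      rw [ENNReal.tsum_mul_left]
      congr 1
      by_cases hkF : (k : ℕ) ∈ F
      · simp only [if_pos hkF]
        rw [tsum_eq_single (a k)]
        · simp
        · intro β hβ
          simp [hβ]
      · simp only [if_neg hkF, one_mul]
        exact tsum_multinomialPMF_eq_one (hw k)
    rw [Finset.prod_congr rfl fun k _ => hk k,
      hprod (fun k => (t k).indicator 1 (p k w, θ k w))
        fun k => ENNReal.ofReal (multinomialPMF (p k w) (a k)), hind]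
    by_cases h1 : w ∈ pointSeq p θ ⁻¹' (s : Set ℕ).pi t <;> simp [Set.indicator, h1]

/-- Both sides are finite measures in `B`, and `measure_inter` gives equality on cylinders, a
generating π-system. -/
lemma HasProductMarks.measure_preimage_inter [IsProbabilityMeasure P] (h : HasProductMarks P p θ b)
    (hp : ∀ᵐ w ∂P, ∀ k, p k w ∈ simplex q ∨ p k w = 0) (hpm : ∀ k, Measurable (p k))
    (hθm : ∀ k, Measurable (θ k)) (hbm : ∀ k, Measurable (b k)) (F : Finset ℕ)
    (a : ℕ → Fin q → ℕ) {B : Set (ℕ → (Fin q → ℝ) × Ω)} (hB : MeasurableSet B) :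
    P (pointSeq p θ ⁻¹' B ∩ {w | ∀ k ∈ F, b k w = a k}) =
      ∫⁻ w in pointSeq p θ ⁻¹' B,
        ∏ k ∈ F, ENNReal.ofReal (multinomialPMF (p k w) (a k)) ∂P := by
  have hU : Measurable (pointSeq p θ) := measurable_pi_iff.mpr fun k => (hpm k).prodMk (hθm k)
  have happly1 : ∀ B, MeasurableSet B →
      ((P.restrict {w | ∀ k ∈ F, b k w = a k}).map (pointSeq p θ)) B =
        P (pointSeq p θ ⁻¹' B ∩ {w | ∀ k ∈ F, b k w = a k}) := fun B hB => by
    rw [Measure.map_apply hU hB, Measure.restrict_apply (hU hB)]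
  have happly2 : ∀ B, MeasurableSet B →
      ((P.withDensity fun w => ∏ k ∈ F, ENNReal.ofReal (multinomialPMF (p k w) (a k))).map
        (pointSeq p θ)) B = ∫⁻ w in pointSeq p θ ⁻¹' B,
        ∏ k ∈ F, ENNReal.ofReal (multinomialPMF (p k w) (a k)) ∂P := fun B hB => by
    rw [Measure.map_apply hU hB, withDensity_apply _ (hU hB)]
  rw [← happly1 B hB, ← happly2 B hB]
  congr 1
  have hcyl : ∀ (s : Finset ℕ) (t : ℕ → Set ((Fin q → ℝ) × Ω)), (∀ k, MeasurableSet (t k)) →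
      MeasurableSet ((s : Set ℕ).pi t) := fun s t ht =>
    MeasurableSet.pi s.countable_toSet fun k _ => ht k
  refine ext_of_generate_finite _ (generateFrom_squareCylinders (ι := ℕ)
    (α := fun _ => (Fin q → ℝ) × Ω)).symm (isPiSystem_squareCylinders
    (fun _ => MeasurableSpace.isPiSystem_measurableSet) (by simp)) ?_ ?_
  · rintro _ ⟨s, t, ht, rfl⟩
    have ht' : ∀ k, MeasurableSet (t k) := fun k => ht k (Set.mem_univ k)
    rw [happly1 _ (hcyl s t ht'), happly2 _ (hcyl s t ht')]
    exact h.measure_inter hp hpm hθm hbm s F ht' a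
  · rw [happly1 _ .univ, happly2 _ .univ]
    simpa using h.measure_inter hp hpm hθm hbm ∅ F (t := fun _ => Set.univ) (fun _ => .univ) a

lemma HasProductMarks.condExp [IsProbabilityMeasure P] (h : HasProductMarks P p θ b)
    (hp : ∀ᵐ w ∂P, ∀ k, p k w ∈ simplex q ∨ p k w = 0) (hpm : ∀ k, Measurable (p k))
    (hθm : ∀ k, Measurable (θ k)) (hbm : ∀ k, Measurable (b k)) (F : Finset ℕ)
    (a : ℕ → Fin q → ℕ) :
    P⟦{w | ∀ k ∈ F, b k w = a k} | MeasurableSpace.comap (pointSeq p θ) inferInstance⟧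
      =ᵐ[P] fun w => ∏ k ∈ F, multinomialPMF (p k w) (a k) := by
  have hU : Measurable (pointSeq p θ) := measurable_pi_iff.mpr fun k => (hpm k).prodMk (hθm k)
  have hE : MeasurableSet {w | ∀ k ∈ F, b k w = a k} := by
    have : {w | ∀ k ∈ F, b k w = a k} = ⋂ k ∈ F, b k ⁻¹' {a k} := by ext; simp
    rw [this]
    exact F.measurableSet_biInter fun k _ => hbm k (measurableSet_singleton _)
  have hnn : ∀ᵐ w ∂P, 0 ≤ ∏ k ∈ F, multinomialPMF (p k w) (a k) := by
    filter_upwards [hp] with w hw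
    exact Finset.prod_nonneg fun k _ => multinomialPMF_nonneg (hw k) _
  have hmeas : Measurable fun w => ∏ k ∈ F, multinomialPMF (p k w) (a k) :=
    Finset.measurable_prod _ fun k _ => (measurable_multinomialPMF (a k)).comp (hpm k)
  have hint : Integrable (fun w => ∏ k ∈ F, multinomialPMF (p k w) (a k)) P := by
    refine Integrable.of_bound hmeas.aestronglyMeasurable 1 ?_
    filter_upwards [hp, hnn] with w hw h0
    rw [Real.norm_of_nonneg h0]
    exact Finset.prod_le_one (fun k _ => multinomialPMF_nonneg (hw k) _)
      fun k _ => multinomialPMF_le_one (hw k) _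
  refine (ae_eq_condExp_of_forall_setIntegral_eq hU.comap_le ?_ ?_ ?_ ?_).symm
  · exact (integrable_const (1 : ℝ)).indicator hE
  · exact fun _ _ _ => hint.integrableOn
  · rintro _ ⟨B, hB, rfl⟩ _
    rw [integral_eq_lintegral_of_nonneg_ae (ae_restrict_of_ae hnn)
      hmeas.aestronglyMeasurable.restrict, integral_indicator_const _ hE,
      measureReal_restrict_apply hE, smul_eq_mul, mul_one, Measure.real, Set.inter_comm,
      h.measure_preimage_inter hp hpm hθm hbm F a hB]
    congr 1
    refine lintegral_congr_ae (ae_restrict_of_ae (hp.mono fun w hw => ?_))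
    exact ENNReal.ofReal_prod_of_nonneg fun k _ => multinomialPMF_nonneg (hw k) _
  · have : Measurable fun u : ℕ → (Fin q → ℝ) × Ω => ∏ k ∈ F, multinomialPMF (u k).1 (a k) :=
      Finset.measurable_prod _ fun k _ => (measurable_multinomialPMF (a k)).comp (by fun_prop)
    exact (this.comp (comap_measurable (pointSeq p θ))).stronglyMeasurable.aestronglyMeasurable

end ProductMarks

lemma measurable_pointProcess {q : ℕ} {Ω 𝒲 : Type*} [MeasurableSpace Ω] [MeasurableSpace 𝒲]
    {p : ℕ → 𝒲 → Fin q → ℝ} {θ : ℕ → 𝒲 → Ω} (hp : ∀ k, Measurable (p k))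
    (hθ : ∀ k, Measurable (θ k)) : Measurable (pointProcess p θ) := by
  rw [pointProcess_eq_activeSum]
  exact measurable_activeSum (fun k => (hp k (measurableSet_singleton 0)).compl)
    fun k => (hp k).prodMk (hθ k)

lemma measurable_featureProcess {q : ℕ} {Ω 𝒲 : Type*} [MeasurableSpace Ω] [MeasurableSpace 𝒲]
    {b : ℕ → 𝒲 → Fin q → ℕ} {θ : ℕ → 𝒲 → Ω} (hb : ∀ k, Measurable (b k))
    (hθ : ∀ k, Measurable (θ k)) : Measurable (featureProcess b θ) :=
  (measurable_pi_apply (0 : Fin 1)).comp (measurable_countPattern hθ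
    (c := fun k w (_ : Fin 1) => b k w) fun k => measurable_pi_iff.mpr fun _ => hb k)

/-- The model is moved to the canonical space of marked sequences, which lives in the universe of
`Ω` as `IsIBPPairLaw` demands. The hypotheses are statements about the law of the sequence, so they
survive the transport. -/
theorem isIBPPairLaw_of_hasProductMarks {q : ℕ} {Ω : Type u} {𝒲 : Type v} [MeasurableSpace Ω]
    [MeasurableSpace 𝒲] {P : Measure 𝒲} [IsProbabilityMeasure P] {ν : Measure ((Fin q → ℝ) × Ω)}
    {p : ℕ → 𝒲 → Fin q → ℝ} {θ : ℕ → 𝒲 → Ω} {b : ℕ → 𝒲 → Fin q → ℕ}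
    (h : HasProductMarks P p θ b) (hp : ∀ᵐ w ∂P, ∀ k, p k w ∈ simplex q ∨ p k w = 0)
    (hpm : ∀ k, Measurable (p k)) (hθm : ∀ k, Measurable (θ k)) (hbm : ∀ k, Measurable (b k))
    (hN : ∀ f : (Fin q → ℝ) × Ω → ℝ≥0∞, Measurable f →
      ∫⁻ w, expNeg (∫⁻ e, f e ∂(pointProcess p θ w)) ∂P = expNeg (∫⁻ e, (1 - expNeg (f e)) ∂ν)) :
    IsIBPPairLaw ν (P.map fun w => (pointProcess p θ w, featureProcess b θ w)) := by
  let 𝒱 : Type u := ℕ → ((Fin q → ℝ) × Ω) × (Fin q → ℕ)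
  let Φ : 𝒲 → 𝒱 := fun w k => ((p k w, θ k w), b k w)
  have hΦ : Measurable Φ :=
    measurable_pi_iff.mpr fun k => ((hpm k).prodMk (hθm k)).prodMk (hbm k)
  let p' : ℕ → 𝒱 → Fin q → ℝ := fun k v => (v k).1.1
  let θ' : ℕ → 𝒱 → Ω := fun k v => (v k).1.2
  let b' : ℕ → 𝒱 → Fin q → ℕ := fun k v => (v k).2
  have hp'm : ∀ k, Measurable (p' k) := fun k => by fun_prop
  have hθ'm : ∀ k, Measurable (θ' k) := fun k => by fun_prop
  have hb'm : ∀ k, Measurable (b' k) := fun k => by fun_prop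
  have hQ : IsProbabilityMeasure (P.map Φ) := Measure.isProbabilityMeasure_map hΦ.aemeasurable
  have hp' : ∀ᵐ v ∂P.map Φ, ∀ k, p' k v ∈ simplex q ∨ p' k v = 0 := by
    rw [ae_map_iff hΦ.aemeasurable]
    · exact hp
    · have : {v : 𝒱 | ∀ k, p' k v ∈ simplex q ∨ p' k v = 0} =
          ⋂ k, p' k ⁻¹' (simplex q ∪ {0}) := by
        ext
        simp [or_comm]
      rw [this]
      exact .iInter fun k => hp'm k (measurableSet_simplex.union (measurableSet_singleton 0))
  have h' : HasProductMarks (P.map Φ) p' θ' b' := by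
    intro m g hg
    have hg1 : Measurable fun v : 𝒱 => ∏ k : Fin m, g k (p' k v, θ' k v) (b' k v) := by
      refine Finset.measurable_prod _ fun k _ => ?_
      have : Measurable (Function.uncurry fun (a : Fin q → ℕ) (e : (Fin q → ℝ) × Ω) => g k e a) :=
        measurable_from_prod_countable_right (hg k)
      exact this.comp ((hb'm k).prodMk ((hp'm k).prodMk (hθ'm k)))
    have hg2 : Measurable fun v : 𝒱 => ∏ k : Fin m,
        ∑' a, g k (p' k v, θ' k v) a * ENNReal.ofReal (multinomialPMF (p' k v) a) :=
      Finset.measurable_prod _ fun k _ => Measurable.tsum fun a =>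
        ((hg k a).comp ((hp'm k).prodMk (hθ'm k))).mul
          ((measurable_multinomialPMF a).comp (hp'm k)).ennreal_ofReal
    rw [lintegral_map hg1 hΦ, lintegral_map hg2 hΦ]
    exact h m g hg
  have hmN := measurable_pointProcess hp'm hθ'm
  refine ⟨𝒱, inferInstance, P.map Φ, hQ, p', θ', b',
    ⟨hp'm, hθ'm, fun _ => hb'm, hp', isPRM_of_laplace hmN fun f hf => ?_, fun F a => ?_⟩, ?_⟩
  · rw [lintegral_map (f := fun v => expNeg (∫⁻ e, f e ∂(pointProcess p' θ' v)))
      (measurable_expNeg.comp ((Measure.measurable_lintegral hf).comp hmN)) hΦ]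
    exact hN f hf
  · have ha : ∀ x : Fin 1 × ℕ, a (0, x.2) = a x := fun x =>
      congrArg a (Prod.ext (Subsingleton.elim _ _) rfl)
    have key := h'.condExp hp' hp'm hθ'm hb'm (F.image Prod.snd) fun k => a (0, k)
    simp only [Finset.forall_mem_image, ha] at key
    rw [funext fun v => Finset.prod_image (s := F) (g := Prod.snd)
      (f := fun k => multinomialPMF (p' k v) (a (0, k))) fun x _ y _ hxy =>
        Prod.ext (Subsingleton.elim _ _) hxy] at key
    simp only [ha] at key
    exact key
  · rw [Measure.map_map (hmN.prodMk (measurable_featureProcess hb'm hθ'm)) hΦ]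
    rfl

/-! ### The points not chosen by the first customers -/

section Thinned

variable {q M : ℕ} {Ω : Type u} {𝒲 : Type v} [MeasurableSpace Ω] [MeasurableSpace 𝒲]
  {P : Measure 𝒲} [IsProbabilityMeasure P] {ν : Measure ((Fin q → ℝ) × Ω)}
  {p : ℕ → 𝒲 → Fin q → ℝ} {θ : ℕ → 𝒲 → Ω} {b : Fin (M + 1) → ℕ → 𝒲 → Fin q → ℕ}

open scoped Classical in
/-- The value `x` if the marks of the first `M` customers vanish, and `0` otherwise. -/
def keepUnchosen {X : Type*} [Zero X] (a : Fin (M + 1) → Fin q → ℕ) (x : X) : X :=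
  if (fun i : Fin M => a i.castSucc) = 0 then x else 0

lemma measurable_keepUnchosen {X : Type*} [Zero X] [MeasurableSpace X]
    (a : Fin (M + 1) → Fin q → ℕ) : Measurable (keepUnchosen (X := X) a) := by
  unfold keepUnchosen
  split_ifs
  · exact measurable_id
  · exact measurable_const

/-- The jump vector of the `k`-th point, if it has not been chosen by the first `M` customers. -/
def unchosenJump (p : ℕ → 𝒲 → Fin q → ℝ) (b : Fin (M + 1) → ℕ → 𝒲 → Fin q → ℕ) (k : ℕ) (w : 𝒲) :
    Fin q → ℝ := keepUnchosen (fun i => b i k w) (p k w)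

/-- The mark of the last customer at the `k`-th point, if this point has not been chosen by the
first `M` customers. -/
def unchosenMark (b : Fin (M + 1) → ℕ → 𝒲 → Fin q → ℕ) (k : ℕ) (w : 𝒲) : Fin q → ℕ :=
  keepUnchosen (fun i => b i k w) (b (Fin.last M) k w)

omit [IsProbabilityMeasure P] in
lemma IsIBPModel.measurable_unchosenJump (h : IsIBPModel P ν p θ b) (k : ℕ) :
    Measurable (unchosenJump p b k) := by
  have : Measurable (Function.uncurry fun (a : Fin (M + 1) → Fin q → ℕ) (s : Fin q → ℝ) =>
      keepUnchosen a s) := measurable_from_prod_countable_right measurable_keepUnchosen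
  exact this.comp ((h.measurable_marks k).prodMk (h.measurable_p k))

omit [IsProbabilityMeasure P] in
lemma IsIBPModel.measurable_unchosenMark (h : IsIBPModel P ν p θ b) (k : ℕ) :
    Measurable (unchosenMark b k) :=
  (Measurable.of_discrete (f := fun a : Fin (M + 1) → Fin q → ℕ =>
    keepUnchosen a (a (Fin.last M)))).comp (h.measurable_marks k)

/-- If the first `M` choices vanish, the last one is still `M(1, s)`, by independence. Otherwise
jump and mark are both reset to zero, which agrees with `M(1, 0)` being the Dirac mass at zero. So
in every case the retained mark is `M(1, ·)` at the retained jump. -/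
lemma tsum_keepUnchosen {s : Fin q → ℝ} (hs : s ∈ simplex q ∨ s = 0)
    (g : (Fin q → ℝ) → (Fin q → ℕ) → ℝ≥0∞) :
    ∑' a : Fin (M + 1) → Fin q → ℕ,
        g (keepUnchosen a s) (keepUnchosen a (a (Fin.last M))) * markWeight s a =
      ∑' a : Fin (M + 1) → Fin q → ℕ, (∑' c, g (keepUnchosen a s) c *
        ENNReal.ofReal (multinomialPMF (keepUnchosen a s) c)) * markWeight s a := by
  rw [tsum_snoc, tsum_snoc]
  refine tsum_congr fun a => ?_
  simp only [markWeight_castSucc, Fin.snoc_castSucc, Fin.snoc_last]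
  have hone := tsum_multinomialPMF_eq_one hs
  by_cases ha : a = 0
  · have hk : ∀ {X : Type} [Zero X] (x : X) (c : Fin q → ℕ),
        keepUnchosen (Fin.snoc (α := fun _ => Fin q → ℕ) a c) x = x := fun x c =>
      if_pos (by simpa using ha)
    simp only [hk, ← mul_assoc]
    rw [ENNReal.tsum_mul_left, hone, mul_one, ← ENNReal.tsum_mul_right]
    exact tsum_congr fun c => by ring
  · have hk : ∀ {X : Type} [Zero X] (x : X) (c : Fin q → ℕ),
        keepUnchosen (Fin.snoc (α := fun _ => Fin q → ℕ) a c) x = 0 := fun x c =>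
      if_neg (by simpa using ha)
    simp only [hk]
    rw [tsum_multinomialPMF]
    simp

/-- The thinned jumps depend on the choices of the first `M` customers, so the conditioning differs
from that of the model. In integrated form both sides are averages over all `M + 1` choices given
the original points, and they agree factor by factor by `tsum_keepUnchosen`. -/
lemma IsIBPModel.hasProductMarks_unchosen (h : IsIBPModel P ν p θ b) :
    HasProductMarks P (unchosenJump p b) θ (unchosenMark b) := by
  intro m g hg
  have hβ := h.measurable_marks
  have hπ : ∀ k (a : Fin (M + 1) → Fin q → ℕ), Measurable fun u : ℕ → (Fin q → ℝ) × Ω =>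
      markWeight (u k).1 a := fun k a => (measurable_markWeight a).comp (by fun_prop)
  have hpt : ∀ (k : ℕ) (a : Fin (M + 1) → Fin q → ℕ), Measurable fun u : ℕ → (Fin q → ℝ) × Ω =>
      (keepUnchosen a (u k).1, (u k).2) := fun k a =>
    ((measurable_keepUnchosen a).comp (by fun_prop)).prodMk (by fun_prop)
  have hg' : ∀ k, ∀ a : Fin (M + 1) → Fin q → ℕ, Measurable fun e : (Fin q → ℝ) × Ω =>
      g k e (keepUnchosen a (a (Fin.last M))) := fun k a => hg k _
  have h1 := h.hasMarks.lintegral_prod h.measurable_pointSeq hβ hπ m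
    (g := fun k u a => g k (keepUnchosen a (u k).1, (u k).2) (keepUnchosen a (a (Fin.last M))))
    fun k a => (hg' k a).comp (hpt k a)
  have h2 := h.hasMarks.lintegral_prod h.measurable_pointSeq hβ hπ m
    (g := fun k u a => ∑' c, g k (keepUnchosen a (u k).1, (u k).2) c *
      ENNReal.ofReal (multinomialPMF (keepUnchosen a (u k).1) c))
    fun k a => Measurable.tsum fun c => ((hg k c).comp (hpt k a)).mul
      ((measurable_multinomialPMF c).comp (hpt k a).fst).ennreal_ofReal
  refine h1.trans (Eq.trans (lintegral_congr_ae ?_) h2.symm)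
  filter_upwards [h.p_mem] with w hw
  exact Finset.prod_congr rfl fun k _ => tsum_keepUnchosen (hw k) fun s c => g k (s, θ k w) c

omit [MeasurableSpace 𝒲] in
lemma pointProcess_unchosenJump (w : 𝒲) : pointProcess (unchosenJump p b) θ w =
    unmarked p θ (fun k w (i : Fin M) => b i.castSucc k w) (fun k => {w | p k w ≠ 0}) w := by
  classical
  rw [pointProcess_eq_activeSum]
  refine Measure.ext_of_lintegral _ fun f hf => ?_
  rw [unmarked, lintegral_activeSum _ _ _ hf, lintegral_activeSum _ _ _ hf]
  refine tsum_congr fun k => ?_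
  simp only [Set.mem_ofPred_eq, Set.mem_inter_iff, unchosenJump, keepUnchosen]
  by_cases hc : (fun i : Fin M => b i.castSucc k w) = 0
  · simp [hc]
  · simp [hc]

variable [StandardBorelSpace Ω] [Nonempty Ω]
  {ρ : Kernel Ω (Fin q → ℝ)} [IsSFiniteKernel ρ] {B₀ : Measure Ω} [SFinite B₀]
  [NullSingletonClass B₀]

omit [Nonempty Ω] in
lemma IsIBPModel.isIBPPairLaw_unchosen (h : IsIBPModel P (intensity ρ B₀) p θ b) (hq : 0 < q)
    (hρ : ∀ ω, ρ ω (simplex q)ᶜ = 0)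
    (hρ_int : ∫⁻ ω, ∫⁻ s, ENNReal.ofReal (∑ j, s j) ∂ρ ω ∂B₀ < ∞) :
    IsIBPPairLaw (updatedIntensity ρ B₀ M) (P.map fun w =>
      (pointProcess (unchosenJump p b) θ w, featureProcess (unchosenMark b) θ w)) := by
  refine isIBPPairLaw_of_hasProductMarks h.hasProductMarks_unchosen ?_ h.measurable_unchosenJump
    h.measurable_θ h.measurable_unchosenMark fun f hf => ?_
  · filter_upwards [h.p_mem] with w hw k
    unfold unchosenJump keepUnchosen
    split_ifs
    · exact hw k
    · exact Or.inr rfl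
  · simp only [pointProcess_unchosenJump]
    exact (h.restrict (Nat.le_succ M)).laplace_unmarked hq hρ hρ_int hf

theorem IsIBPModel.exists_prediction_pair (h : IsIBPModel P (intensity ρ B₀) p θ b) (hq : 0 < q)
    (hρ : ∀ ω, ρ ω (simplex q)ᶜ = 0)
    (hρ_int : ∫⁻ ω, ∫⁻ s, ENNReal.ofReal (∑ j, s j) ∂ρ ω ∂B₀ < ∞) :
    ∃ (L : Measure (Measure ((Fin q → ℝ) × Ω) × (Fin q → Measure Ω)))
      (_ : IsProbabilityMeasure L)
      (pred : Kernel (Fin M → Fin q → Measure Ω)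
        (Measure ((Fin q → ℝ) × Ω) × (Fin q → Measure Ω))),
      IsMarkovKernel pred ∧ IsIBPPairLaw (updatedIntensity ρ B₀ M) L ∧
      HasCondDistrib (fun w => (pointProcess p θ w, featureProcess (b (Fin.last M)) θ w))
        (countPattern θ fun k w (i : Fin M) => b i.castSucc k w) pred P ∧
      ∀ {K : ℕ} {z : Fin M → Fin q → Measure Ω} {ω : Fin K → Ω} {c : Fin K → Fin M → Fin q → ℕ},
        IsListing z ω c → pred z =
          (L.prod (Measure.pi fun ℓ => jumpMarkKernel ρ M (ω ℓ, c ℓ))).map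
            fun x => (x.1.1 + ∑ ℓ, Measure.dirac ((x.2 ℓ).1, ω ℓ),
              fun j => x.1.2 j + ∑ ℓ, ((x.2 ℓ).2 j : ℝ≥0∞) • Measure.dirac (ω ℓ)) := by
  obtain ⟨post, hpost, hcd, hlist⟩ := h.exists_prediction hq hρ hρ_int
  have := isMarkovKernel_jumpMarkKernel hρ M
  -- The identity is only almost sure: the feature process sums over all indices, and absent ones
  -- contribute nothing only where their marks vanish.
  have hae : ∀ᵐ w ∂P, splitMarks (activeSum (fun k => {w | p k w ≠ 0})
      (fun k w => ((p k w, b (Fin.last M) k w), θ k w)) w) =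
      (pointProcess p θ w, featureProcess (b (Fin.last M)) θ w) := by
    filter_upwards [h.ae_marks] with w hw
    exact splitMarks_activeSum (fun k hk => ⟨rfl, rfl, hk⟩)
      fun k hk => ⟨not_not.mp hk, (hw k).1 (not_not.mp hk) _⟩
  have hae' : ∀ᵐ w ∂P, splitMarks (unmarked (fun k w => (p k w, b (Fin.last M) k w)) θ
      (fun k w (i : Fin M) => b i.castSucc k w) (fun k => {w | p k w ≠ 0}) w) =
      (pointProcess (unchosenJump p b) θ w, featureProcess (unchosenMark b) θ w) := by
    filter_upwards [h.ae_marks] with w hw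
    refine splitMarks_activeSum (fun k hk => ?_) fun k hk => ?_
    · exact ⟨if_pos hk.2, if_pos hk.2, hk.1⟩
    · by_cases hc : (fun i : Fin M => b i.castSucc k w) = 0
      · have h0 : p k w = 0 := by
          by_contra h0
          exact hk ⟨h0, hc⟩
        exact ⟨(if_pos hc).trans h0, (if_pos hc).trans ((hw k).1 h0 _)⟩
      · exact ⟨if_neg hc, if_neg hc⟩
  have hWm : Measurable (unmarked (fun k w => (p k w, b (Fin.last M) k w)) θ
      (fun k w (i : Fin M) => b i.castSucc k w) (fun k => {w | p k w ≠ 0})) :=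
    measurable_activeSum (fun k => (h.measurableSet_active k).inter
      ((measurable_pi_iff.mpr fun i => h.measurable_b _ k) (measurableSet_singleton 0)))
      fun k => ((h.measurable_p k).prodMk (h.measurable_b _ k)).prodMk (h.measurable_θ k)
  have hLm : Measurable fun w =>
      (pointProcess (unchosenJump p b) θ w, featureProcess (unchosenMark b) θ w) :=
    (measurable_pointProcess h.measurable_unchosenJump h.measurable_θ).prodMk
      (measurable_featureProcess h.measurable_unchosenMark h.measurable_θ)
  have hL : P.map (fun w =>
      (pointProcess (unchosenJump p b) θ w, featureProcess (unchosenMark b) θ w)) =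
      (P.map (unmarked (fun k w => (p k w, b (Fin.last M) k w)) θ
        (fun k w (i : Fin M) => b i.castSucc k w) fun k => {w | p k w ≠ 0})).map splitMarks := by
    rw [Measure.map_map measurable_splitMarks hWm]
    exact (Measure.map_congr hae').symm
  have : IsProbabilityMeasure (P.map (unmarked (fun k w => (p k w, b (Fin.last M) k w)) θ
      (fun k w (i : Fin M) => b i.castSucc k w) fun k => {w | p k w ≠ 0})) :=
    Measure.isProbabilityMeasure_map hWm.aemeasurable
  refine ⟨_, Measure.isProbabilityMeasure_map hLm.aemeasurable, post.map splitMarks,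
    Kernel.IsMarkovKernel.map _ measurable_splitMarks, h.isIBPPairLaw_unchosen hq hρ hρ_int,
    ?_, fun {K z ω c} hz => ?_⟩
  · have := hcd.comp_left measurable_splitMarks
    refine HasLaw.congr this ?_
    filter_upwards [hae] with w hw
    exact Prod.ext rfl hw.symm
  · have hpair : Measurable fun x : (Measure ((Fin q → ℝ) × Ω) × (Fin q → Measure Ω)) ×
        (Fin K → (Fin q → ℝ) × (Fin q → ℕ)) =>
        (x.1.1 + ∑ ℓ, Measure.dirac ((x.2 ℓ).1, ω ℓ),
          fun j => x.1.2 j + ∑ ℓ, ((x.2 ℓ).2 j : ℝ≥0∞) • Measure.dirac (ω ℓ)) := by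
      refine Measurable.prodMk ?_ (measurable_pi_iff.mpr fun j => ?_)
      · exact (measurable_add_sum_dirac ω).comp
          (f := fun x : (Measure ((Fin q → ℝ) × Ω) × (Fin q → Measure Ω)) ×
            (Fin K → (Fin q → ℝ) × (Fin q → ℕ)) => (x.1.1, fun ℓ => (x.2 ℓ).1)) (by fun_prop)
      · refine Measure.measurable_of_measurable_coe _ fun A hA => ?_
        simp only [Measure.add_apply, Measure.finsetSum_apply, Measure.smul_apply, smul_eq_mul]
        refine ((Measure.measurable_coe hA).comp (by fun_prop)).add
          (Finset.measurable_sum _ fun ℓ _ => Measurable.mul_const ?_ _)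
        exact (Measurable.of_discrete (f := fun a : Fin q → ℕ => (a j : ℝ≥0∞))).comp
          (by fun_prop)
    have hprod := Measure.map_prod_map (P.map (unmarked (fun k w => (p k w, b (Fin.last M) k w)) θ
      (fun k w (i : Fin M) => b i.castSucc k w) fun k => {w | p k w ≠ 0}))
      (Measure.pi fun ℓ => jumpMarkKernel ρ M (ω ℓ, c ℓ)) measurable_splitMarks measurable_id
    rw [Measure.map_id] at hprod
    rw [Kernel.map_apply _ measurable_splitMarks, hlist hz, addPoints,
      Measure.map_map measurable_splitMarks (measurable_add_sum_dirac ω), hL, hprod,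
      Measure.map_map hpair (measurable_splitMarks.prodMap measurable_id)]
    congr 1
    funext x
    exact splitMarks_add_sum_dirac x.1 x.2 ω

end Thinned

/-! ### The marks of the next customer at the chosen features -/

section Mixture

variable {q : ℕ} {μ : Measure (Fin q → ℝ)}

lemma ae_coord_mem_Icc (hμ : ∀ᵐ s ∂μ, s ∈ simplex q) :
    ∀ᵐ s ∂μ, ∀ k, 0 < s k ∧ s k ≤ 1 := by
  filter_upwards [hμ] with s hs k
  exact ⟨hs.1 k, (Finset.single_le_sum (f := s) (fun j _ => (hs.1 j).le)
    (Finset.mem_univ k)).trans hs.2.le⟩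

lemma integrable_coord [IsFiniteMeasure μ] (hμ : ∀ᵐ s ∂μ, s ∈ simplex q) (k : Fin q) :
    Integrable (fun s => s k) μ := by
  refine Integrable.of_bound (measurable_pi_apply k).aestronglyMeasurable 1 ?_
  filter_upwards [ae_coord_mem_Icc hμ] with s hs
  rw [Real.norm_of_nonneg (hs k).1.le]
  exact (hs k).2

lemma integral_pos_of_ae_pos [IsProbabilityMeasure μ] {f : (Fin q → ℝ) → ℝ} (hf : Integrable f μ)
    (h : ∀ᵐ s ∂μ, 0 < f s) : 0 < ∫ s, f s ∂μ := by
  rw [integral_pos_iff_support_of_nonneg_ae (h.mono fun _ hs => hs.le) hf]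
  refine pos_iff_ne_zero.mpr fun h0 => ?_
  obtain ⟨s, h1, h2⟩ := ((measure_eq_zero_iff_ae_notMem.mp h0).and h).exists
  exact h1 h2.ne'

lemma integral_mem_simplex [IsProbabilityMeasure μ] (hμ : ∀ᵐ s ∂μ, s ∈ simplex q) :
    (fun k => ∫ s, s k ∂μ) ∈ simplex q := by
  refine ⟨fun k => integral_pos_of_ae_pos (integrable_coord hμ k) (hμ.mono fun s hs => hs.1 k), ?_⟩
  have hsum : Integrable (fun s : Fin q → ℝ => ∑ k, s k) μ :=
    integrable_finsetSum _ fun k _ => integrable_coord hμ k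
  have := integral_pos_of_ae_pos (f := fun s => 1 - ∑ k, s k) ((integrable_const 1).sub hsum)
    (hμ.mono fun s hs => sub_pos.mpr hs.2)
  rw [integral_sub (integrable_const 1) hsum, integral_finsetSum _ fun k _ =>
    integrable_coord hμ k] at this
  simpa using this

/-- The point masses `1 - s_·` and `s_j` are affine in `s`, so integrating over `s` replaces it by
its mean. -/
lemma snd_compProd_multinomial [IsProbabilityMeasure μ] (hμ : ∀ᵐ s ∂μ, s ∈ simplex q) :
    (μ ⊗ₘ multinomial q).snd = multinomial q fun k => ∫ s, s k ∂μ := by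
  have hsum : Integrable (fun s : Fin q → ℝ => ∑ k, s k) μ :=
    integrable_finsetSum _ fun k _ => integrable_coord hμ k
  have h0 : ∫⁻ s, ENNReal.ofReal (1 - ∑ j, s j) ∂μ = ENNReal.ofReal (1 - ∑ j, ∫ s, s j ∂μ) := by
    rw [← ofReal_integral_eq_lintegral_ofReal (f := fun s : Fin q → ℝ => 1 - ∑ j, s j)
      ((integrable_const 1).sub hsum)
      (hμ.mono fun s hs => (sub_pos.mpr hs.2).le), integral_sub (integrable_const 1) hsum,
      integral_finsetSum _ fun k _ => integrable_coord hμ k]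
    simp
  have h1 : ∀ k, ∫⁻ s, ENNReal.ofReal (s k) ∂μ = ENNReal.ofReal (∫ s, s k ∂μ) := fun k =>
    (ofReal_integral_eq_lintegral_ofReal (integrable_coord hμ k)
      (hμ.mono fun s hs => (hs.1 k).le)).symm
  refine Measure.ext_of_lintegral _ fun g hg => ?_
  rw [Measure.snd, lintegral_map hg measurable_snd,
    Measure.lintegral_compProd (f := fun x : (Fin q → ℝ) × (Fin q → ℕ) => g x.2)
      (hg.comp measurable_snd)]
  simp only [lintegral_multinomial, tsum_multinomialPMF]
  rw [lintegral_add_left (by fun_prop), lintegral_const_mul _ (by fun_prop), h0,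
    lintegral_finsetSum _ (fun k _ => by fun_prop)]
  congr 1
  refine Finset.sum_congr rfl fun k _ => ?_
  rw [lintegral_const_mul _ (by fun_prop), h1]

variable {r : Fin q → ℝ}

lemma toNNReal_smul_eq (x : unitInterval) (y : ℝ≥0∞) :
    unitInterval.toNNReal x • y = ENNReal.ofReal (x : ℝ) * y := by
  rw [ENNReal.smul_def, smul_eq_mul]
  congr 1
  rw [← ENNReal.ofReal_coe_nnreal]
  rfl

lemma map_sum_multinomial (hr : r ∈ simplex q) (hI : ∑ j, r j ∈ unitInterval) :
    (multinomial q r).map (fun a => ∑ j, a j) = bernoulliMeasure 1 0 ⟨∑ j, r j, hI⟩ := by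
  have hm : Measurable fun a : Fin q → ℕ => ∑ j, a j := .of_discrete
  refine Measure.ext_of_lintegral _ fun g hg => ?_
  rw [lintegral_map hg hm, lintegral_multinomial, tsum_multinomialPMF, bernoulliMeasure_def,
    lintegral_add_measure, lintegral_smul_measure, lintegral_smul_measure, lintegral_dirac,
    lintegral_dirac, add_comm]
  congr 1
  · simp only [Finset.sum_pi_single', Finset.mem_univ, if_true]
    rw [← Finset.mul_sum, ← ENNReal.ofReal_sum_of_nonneg fun j _ => (hr.1 j).le, mul_comm]
    exact (toNNReal_smul_eq ⟨∑ j, r j, hI⟩ (g 1)).symm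
  · simp only [Pi.zero_apply, Finset.sum_const_zero]
    rw [mul_comm]
    exact (toNNReal_smul_eq (unitInterval.symm ⟨∑ j, r j, hI⟩) (g 0)).symm

lemma multinomial_sum_eq_one (hr : r ∈ simplex q) :
    multinomial q r {a | ∑ j, a j = 1} = ENNReal.ofReal (∑ j, r j) := by
  have hm : MeasurableSet {a : Fin q → ℕ | ∑ j, a j = 1} := .of_discrete
  rw [← lintegral_indicator_one hm, lintegral_multinomial, tsum_multinomialPMF,
    Set.indicator_of_notMem (by simp), zero_mul, zero_add,
    ENNReal.ofReal_sum_of_nonneg fun j _ => (hr.1 j).le]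
  refine Finset.sum_congr rfl fun j _ => ?_
  rw [Set.indicator_of_mem (by simp), Pi.one_apply, one_mul]

/-- Given total one, only unit vectors remain, with masses `r j` to be divided by their sum; `q > 0`
makes that sum positive. -/
lemma cond_multinomial_singleton (hq : 0 < q) (hr : r ∈ simplex q) (a : Fin q → ℕ) :
    (multinomial q r)[|{a' | ∑ j, a' j = 1}] {a} =
      if ∑ j, a j = 1 then ENNReal.ofReal (∏ j, (r j / ∑ k, r k) ^ a j) else 0 := by
  have hm : MeasurableSet {a : Fin q → ℕ | ∑ j, a j = 1} := .of_discrete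
  rw [cond_apply hm, multinomial_sum_eq_one hr]
  split_ifs with ha
  · rw [Set.inter_eq_right.mpr (Set.singleton_subset_iff.mpr (show a ∈ {a' | ∑ j, a' j = 1} from ha)),
      multinomial_singleton]
    rcases eq_zero_or_single ha.le with rfl | ⟨j, rfl⟩
    · simp at ha
    · rw [multinomialPMF_single, Finset.prod_eq_single j, Pi.single_eq_same, pow_one,
        ENNReal.ofReal_div_of_pos (sum_pos_of_mem_simplex hq hr), mul_comm, ENNReal.div_eq_inv_mul,
        mul_comm]
      · intro i _ hi
        rw [Pi.single_eq_of_ne hi, pow_zero]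
      · simp
  · rw [Set.inter_singleton_eq_empty.mpr (show a ∉ {a' | ∑ j, a' j = 1} from ha), measure_empty, mul_zero]

end Mixture

/-! ### Means of the jump laws -/

section JumpLaw

variable {q M : ℕ} {Ω : Type u} [MeasurableSpace Ω] {ρ : Kernel Ω (Fin q → ℝ)}
  {c : Fin q → ℕ} {ω : Ω}

lemma jumpLaw_ae_mem_simplex (hρ : ∀ ω, ρ ω (simplex q)ᶜ = 0) :
    ∀ᵐ s ∂jumpLaw ρ M c ω, s ∈ simplex q := jumpLaw_simplex_compl hρ M c ω

lemma IsRegular.integrableOn (h : IsRegular ρ M c ω)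
    (k : Fin q) : IntegrableOn (fun s => s k * jumpWeight M c s) (simplex q) (ρ ω) := by
  have hm : Measurable fun s : Fin q → ℝ => s k * jumpWeight M c s :=
    (measurable_pi_apply k).mul (measurable_jumpWeight M c)
  refine ⟨hm.aestronglyMeasurable, ?_⟩
  refine lt_of_le_of_lt ?_ (lt_top_iff_ne_top.mpr h.2)
  refine setLIntegral_mono_ae (measurable_jumpWeight M c).ennreal_ofReal.aemeasurable
    (.of_forall fun s hs => ?_)
  have hw := (jumpWeight_pos (M := M) (c := c) hs).le
  rw [Real.enorm_of_nonneg (mul_nonneg (hs.1 k).le hw)]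
  refine ENNReal.ofReal_le_ofReal (mul_le_of_le_one_left hw ?_)
  exact (Finset.single_le_sum (f := s) (fun j _ => (hs.1 j).le) (Finset.mem_univ k)).trans hs.2.le

lemma integral_jumpLaw (hρ : ∀ ω, ρ ω (simplex q)ᶜ = 0) (k : Fin q) : ∫ s, s k ∂jumpLaw ρ M c ω =
      (∫ s in simplex q, s k * jumpWeight M c s ∂ρ ω) / (kappa ρ M c ω).toReal := by
  have hs : ∀ᵐ s ∂ρ ω, s ∈ simplex q := hρ ω
  have hm : Measurable fun s : Fin q → ℝ => s k * jumpWeight M c s :=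
    (measurable_pi_apply k).mul (measurable_jumpWeight M c)
  rw [Measure.restrict_eq_self_of_ae_mem hs,
    integral_eq_lintegral_of_nonneg_ae
      ((jumpLaw_ae_mem_simplex hρ).mono fun s hs => (hs.1 k).le)
      (measurable_pi_apply k).aestronglyMeasurable,
    integral_eq_lintegral_of_nonneg_ae
      (hs.mono fun s hs => mul_nonneg (hs.1 k).le (jumpWeight_pos hs).le)
      hm.aestronglyMeasurable, ← ENNReal.toReal_div, lintegral_jumpLaw ρ M c ω (by fun_prop)]
  congr 2
  refine lintegral_congr_ae (hs.mono fun s hs => ?_)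
  exact (ENNReal.ofReal_mul (hs.1 k).le).symm

end JumpLaw

/-! ### Regularity along every list of the chosen features -/

section Lists

variable {q M : ℕ} {Ω : Type u} {𝒲 : Type v} [MeasurableSpace Ω] [StandardBorelSpace Ω]
  [MeasurableSpace 𝒲] {P : Measure 𝒲} [IsProbabilityMeasure P]
  {ρ : Kernel Ω (Fin q → ℝ)} [IsSFiniteKernel ρ] {B₀ : Measure Ω} [SFinite B₀]
  [NullSingletonClass B₀] {p : ℕ → 𝒲 → Fin q → ℝ} {θ : ℕ → 𝒲 → Ω}
  {b : Fin M → ℕ → 𝒲 → Fin q → ℕ}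

/-- Almost surely the chosen features can be listed, and `κ_c` is positive and finite at each of
them. -/
lemma IsIBPModel.ae_isDishList (h : IsIBPModel P (intensity ρ B₀) p θ b) (hq : 0 < q)
    (hρ : ∀ ω, ρ ω (simplex q)ᶜ = 0)
    (hρ_int : ∫⁻ ω, ∫⁻ s, ENNReal.ofReal (∑ j, s j) ∂ρ ω ∂B₀ < ∞) :
    ∀ᵐ w ∂P, (∃ (K : ℕ) (ω : Fin K → Ω) (c : Fin K → Fin q → ℕ),
        IsDishList (countPattern θ (fun k w i => b i k w) w) ω c) ∧
      ∀ (K : ℕ) (ω : Fin K → Ω) (c : Fin K → Fin q → ℕ),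
        IsDishList (countPattern θ (fun k w i => b i k w) w) ω c →
          ∃ c' : Fin K → Fin M → Fin q → ℕ,
            IsListing (countPattern θ (fun k w i => b i k w) w) ω c' ∧
            ∀ ℓ, c ℓ = ∑ i, c' ℓ i ∧ IsRegular ρ M (∑ i, c' ℓ i) (ω ℓ) := by
  filter_upwards [(h.isMarkedPoisson_points hq hρ hρ_int).simple, h.ae_isRegular hρ hρ_int]
    with w hs hreg
  obtain ⟨K₀, k, -, hk, hlist⟩ := hs.exists_listing
  refine ⟨⟨K₀, _, _, hlist.isDishList⟩, fun K ω c hd => ?_⟩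
  obtain ⟨e, rfl, hl, hc⟩ := hlist.of_isDishList hd
  refine ⟨_, hl, fun ℓ => ⟨hc ℓ, ?_⟩⟩
  have hmem : k (e ℓ) ∈ {k | (fun i => b i k w) ≠ 0} := hk ▸ Set.mem_range_self (e ℓ)
  exact hreg _ hmem

end Lists

end MultinomialIBP

end

/-! ### The posterior and the prediction rule -/

open MultinomialIBP in
theorem proposition5p1 {Ω : Type u} [MeasurableSpace Ω] [StandardBorelSpace Ω]
    {𝒲 : Type v} [MeasurableSpace 𝒲] (P : Measure 𝒲) [IsProbabilityMeasure P]
    {q : ℕ} (hq : 0 < q)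
    (B₀ : Measure Ω) [IsProbabilityMeasure B₀] [NullSingletonClass B₀]
    (ρ : Kernel Ω (Fin q → ℝ)) [IsSFiniteKernel ρ]
    (hρ : ∀ ω, ρ ω (simplex q)ᶜ = 0)
    (hρ_int : ∫⁻ ω, ∫⁻ s, ENNReal.ofReal (∑ j, s j) ∂ρ ω ∂B₀ < ∞)
    {M n : ℕ} (hM : M ≤ n)
    (p : ℕ → 𝒲 → Fin q → ℝ) (θ : ℕ → 𝒲 → Ω) (b : Fin n → ℕ → 𝒲 → Fin q → ℕ)
    (hmodel : IsIBPModel P (intensity ρ B₀) p θ b)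
    (Z : 𝒲 → Fin M → Fin q → Measure Ω)
    (hZ : ∀ w i, Z w i = featureProcess (b (Fin.castLE hM i)) θ w) :
    -- almost surely there are finitely many chosen features
    (∀ᵐ w ∂P, ∃ (K : ℕ) (ω : Fin K → Ω) (c : Fin K → Fin q → ℕ), IsDishList (Z w) ω c) ∧
    -- the laws of the jumps are well defined
    (∀ᵐ w ∂P, ∀ (K : ℕ) (ω : Fin K → Ω) (c : Fin K → Fin q → ℕ), IsDishList (Z w) ω c →
      ∀ ℓ, kappa ρ M (c ℓ) (ω ℓ) ≠ 0 ∧ kappa ρ M (c ℓ) (ω ℓ) ≠ ∞ ∧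
        IsProbabilityMeasure (jumpLaw ρ M (c ℓ) (ω ℓ))) ∧
    -- the posterior distribution of `N`
    (∃ (Q : Measure (Measure ((Fin q → ℝ) × Ω))) (_ : IsProbabilityMeasure Q)
      (post : Kernel (Fin M → Fin q → Measure Ω) (Measure ((Fin q → ℝ) × Ω)))
      (_ : IsMarkovKernel post),
      IsPRM Q (updatedIntensity ρ B₀ M) id ∧
      HasCondDistrib (pointProcess p θ) Z post P ∧
      ∀ᵐ w ∂P, ∀ (K : ℕ) (ω : Fin K → Ω) (c : Fin K → Fin q → ℕ), IsDishList (Z w) ω c →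
        post (Z w) =
          (Q.prod (Measure.pi fun ℓ => jumpLaw ρ M (c ℓ) (ω ℓ))).map
            fun x => x.1 + ∑ ℓ, Measure.dirac (x.2 ℓ, ω ℓ)) ∧
    -- the prediction rule for customer `M + 1`, jointly with `N`
    (∀ hn : M < n,
      ∃ (L : Measure (Measure ((Fin q → ℝ) × Ω) × (Fin q → Measure Ω)))
        (_ : IsProbabilityMeasure L)
        (pred : Kernel (Fin M → Fin q → Measure Ω)
          (Measure ((Fin q → ℝ) × Ω) × (Fin q → Measure Ω)))
        (_ : IsMarkovKernel pred),
        IsIBPPairLaw (updatedIntensity ρ B₀ M) L ∧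
        HasCondDistrib (fun w => (pointProcess p θ w, featureProcess (b ⟨M, hn⟩) θ w)) Z pred P ∧
        ∀ᵐ w ∂P, ∀ (K : ℕ) (ω : Fin K → Ω) (c : Fin K → Fin q → ℕ), IsDishList (Z w) ω c →
          pred (Z w) =
            (L.prod (Measure.pi fun ℓ => jumpLaw ρ M (c ℓ) (ω ℓ) ⊗ₘ multinomial q)).map
              fun x => (x.1.1 + ∑ ℓ, Measure.dirac ((x.2 ℓ).1, ω ℓ),
                fun j => x.1.2 j + ∑ ℓ, ((x.2 ℓ).2 j : ℝ≥0∞) • Measure.dirac (ω ℓ))) ∧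
    -- the law of `b^(ℓ)`, the second marginal of `jumpLaw ⊗ₘ multinomial`
    (∀ᵐ w ∂P, ∀ (K : ℕ) (ω : Fin K → Ω) (c : Fin K → Fin q → ℕ), IsDishList (Z w) ω c →
      ∀ ℓ, ∃ r : Fin q → ℝ, r ∈ simplex q ∧
        (∀ k, Integrable (fun s => s k) (jumpLaw ρ M (c ℓ) (ω ℓ)) ∧
          r k = ∫ s, s k ∂jumpLaw ρ M (c ℓ) (ω ℓ) ∧
          IntegrableOn (fun s => s k * jumpWeight M (c ℓ) s) (simplex q) (ρ (ω ℓ)) ∧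
          r k = (∫ s in simplex q, s k * jumpWeight M (c ℓ) s ∂ρ (ω ℓ)) /
            (kappa ρ M (c ℓ) (ω ℓ)).toReal) ∧
        (jumpLaw ρ M (c ℓ) (ω ℓ) ⊗ₘ multinomial q).snd = multinomial q r ∧
        (∃ hr : ∑ j, r j ∈ unitInterval,
          (jumpLaw ρ M (c ℓ) (ω ℓ) ⊗ₘ multinomial q).snd.map (fun a => ∑ j, a j) =
            bernoulliMeasure 1 0 ⟨∑ j, r j, hr⟩) ∧
        ∀ a : Fin q → ℕ,
          ((jumpLaw ρ M (c ℓ) (ω ℓ) ⊗ₘ multinomial q).snd)[|{a' | ∑ j, a' j = 1}] {a} =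
            if ∑ j, a j = 1 then ENNReal.ofReal (∏ j, (r j / ∑ k, r k) ^ a j) else 0) := by
  have hΩ : Nonempty Ω := nonempty_of_isProbabilityMeasure B₀
  have hm := hmodel.restrict hM
  have hZ' : Z = countPattern θ fun k w (i : Fin M) => b (Fin.castLE hM i) k w :=
    funext fun w => funext fun i => hZ w i
  subst hZ'
  have hdish := hm.ae_isDishList hq hρ hρ_int
  refine ⟨hdish.mono fun w hw => hw.1, ?_, ?_, fun hn => ?_, ?_⟩
  · filter_upwards [hdish] with w hw K ω c hd ℓ
    obtain ⟨c', -, hc⟩ := hw.2 K ω c hd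
    rw [(hc ℓ).1]
    exact ⟨(hc ℓ).2.1, (hc ℓ).2.2, (hc ℓ).2.isProbabilityMeasure hρ⟩
  · obtain ⟨Q, hQ, post, hpost, hprm, hcd, hlist⟩ := hm.exists_posterior hq hρ hρ_int
    refine ⟨Q, hQ, post, hpost, hprm, hcd, ?_⟩
    filter_upwards [hdish] with w hw K ω c hd
    obtain ⟨c', hl, hc⟩ := hw.2 K ω c hd
    -- The arrays `c'` behind the counts enter the kernel only through their sums, and regularity
    -- rules out the default branch.
    rw [hlist hl, addPoints, show (fun ℓ => jumpKernel ρ M (ω ℓ, c' ℓ)) =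
      fun ℓ => jumpLaw ρ M (c ℓ) (ω ℓ) from funext fun ℓ => by
        rw [(hc ℓ).1, jumpKernel_apply (hc ℓ).2]]
  -- Restricting to the first `M + 1` customers makes customer `M + 1` the last one of the model.
  · obtain ⟨L, hL, pred, hpred, hpair, hcd, hlist⟩ :=
      (hmodel.restrict (Nat.succ_le_of_lt hn)).exists_prediction_pair hq hρ hρ_int
    refine ⟨L, hL, pred, hpred, hpair, hcd, ?_⟩
    filter_upwards [hdish] with w hw K ω c hd
    obtain ⟨c', hl, hc⟩ := hw.2 K ω c hd
    rw [hlist hl, show (fun ℓ => jumpMarkKernel ρ M (ω ℓ, c' ℓ)) =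
      fun ℓ => jumpLaw ρ M (c ℓ) (ω ℓ) ⊗ₘ multinomial q from funext fun ℓ => by
        rw [(hc ℓ).1, jumpMarkKernel_apply hρ (hc ℓ).2]]
  · filter_upwards [hdish] with w hw K ω c hd ℓ
    obtain ⟨c', -, hc⟩ := hw.2 K ω c hd
    have hreg : IsRegular ρ M (c ℓ) (ω ℓ) := (hc ℓ).1 ▸ (hc ℓ).2
    have := hreg.isProbabilityMeasure hρ
    have hμ : ∀ᵐ s ∂jumpLaw ρ M (c ℓ) (ω ℓ), s ∈ simplex q := jumpLaw_ae_mem_simplex hρ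
    have hr := integral_mem_simplex hμ
    have hI : ∑ k, ∫ s, s k ∂jumpLaw ρ M (c ℓ) (ω ℓ) ∈ unitInterval :=
      ⟨Finset.sum_nonneg fun k _ => (hr.1 k).le, hr.2.le⟩
    refine ⟨fun k => ∫ s, s k ∂jumpLaw ρ M (c ℓ) (ω ℓ), hr, fun k =>
      ⟨integrable_coord hμ k, rfl, hreg.integrableOn k, integral_jumpLaw hρ k⟩,
      snd_compProd_multinomial hμ, ⟨hI, ?_⟩, fun a => ?_⟩
    · rw [snd_compProd_multinomial hμ]
      exact map_sum_multinomial hr hI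
    · rw [snd_compProd_multinomial hμ]
      exact cond_multinomial_singleton hq hr a
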